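/- **Setting.** All vectors and matrices are over $\mathbb F_2$, and $|v|$ is the Hamming weight of $v$. For $H\in\mathbb F_2^{m\times n}$ and $s\in\mathbb F_2^n$ let $H_s$ be the submatrix of the rows of $H$ that are not orthogonal to $s$, let $\mathcal C_s$ be the code spanned by the columns of $H_s$, let $\mathcal C_s^{\perp}$ be its dual code, and let $\mathcal D_s=\mathcal C_s\cap\mathcal C_s^\perp$. The family $\mathcal H_{n,m,g}$ consists of the pairs $(H,s)$ such that $H_s$ has at least one row, $\mathcal D_s$ is doubly even (all its codewords have weight divisible by $4$), $\operatorname{rank}(H_s^TH_s)=g$, and $\operatorname{rank}(H)=n$. **The stabilizer construction** with parameters $n,m,g$ is the following random process. Every "draw" is uniform on the stated finite set and made with fresh randomness. 1. Draw $(m_1,d)$ from the pairs of non-negative integers with $g+d\le n$, $0<m_1\le m$, $n-g-d\le m-m_1$, $g+2d\le m_1$, $m_1\equiv g \pmod 2$, such that in addition $4\mid m_1$ and $d\ge 1$ if $g=0$, and $m_1\equiv 0,1,7\pmod 8$ if $m_1\le 2d+1$. 2. Sample $D\in\mathbb F_2^{m_1\times d}$ column by column, starting with no column if $g>0$, and with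 the all-ones column $\mathbf 1$ if $g=0$. To add a column, let $U$ be the span of the present columns and $E$ the space of the even-weight vectors orthogonal to $U$. Draw $a_1\in E\setminus U$. If $4\mid |a_1|$, the new column is $a_1$. Otherwise, if the set $\{v\in E: v\cdot a_1=0,\ v\notin U+\langle a_1\rangle\}$ is non-empty, draw $a_2$ from it; the new column is $a_2$ if $4\mid|a_2|$, and $a_1+a_2$ if not. If that set is empty, draw the new column from $\{v\notin U: v\perp U,\ 4\mid |v|\}$. 3. Sample $F\in\mathbb F_2^{m_1\times g}$ as follows, where $\mathcal D$ is the column space of $D$. If $g=0$, $F$ has no columns. If $g>0$ and $m_1$ is odd, start with the single column $\mathbf 1$. If $g>0$, $m_1$ is even and $\mathbf 1\notin\mathcal D$, draw $c_2$ from the odd-weight vectors in $\mathcal D^\perp$ and start with $(\mathbf 1+c_2,\,c_2)$. If $g>0$, $m_1$ is even and $\mathbf 1\in\mathcal D$, draw $c_1\in\mathcal D^\perp\setminus\mathcal D$, then $c_2\in\{v\in\mathcal D^\perp:c_1\cdot v=1\}$, and start with $(c_1,c_2)$. Then, until there are $g$ columns, let $\mathcal C$ be the span of all columns of $D$ and of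 the present columns of $F$, draw $a\in\mathcal C^\perp\setminus\mathcal D$, then $b\in\{v\in\mathcal C^\perp:a\cdot v=1\}$, and append $a,b$ to $F$. 4. Put $r=g+d$ and $M=(F,D,\mathbf 0_{m_1\times(n-r)})$, and draw $s$ from the solutions of $Ms=\mathbf 1$. 5. Below $M$ add $m-m_1$ redundant rows, one after the other: each of the first $n-r$ is drawn from the vectors that are orthogonal to $s$ and outside the span of all earlier rows, each of the others from all vectors orthogonal to $s$. This gives $H\in\mathbb F_2^{m\times n}$. 6. Draw an $m\times m$ permutation matrix $P$ and an invertible $Q\in\mathbb F_2^{n\times n}$, and output $(PHQ,\,Q^{-1}s)$. **Theorem.** The stabilizer construction is an efficient classical sampling algorithm for instances of $\mathcal H_{n,m,g}$. That is, there are a single program for a probabilistic random access machine and a polynomial $p$ with natural coefficients such that, for all $n,m,g\ge 0$ with $\mathcal H_{n,m,g}\neq\emptyset$: * on input $n,m,g$, the program halts after at most $p(n+m+g)$ steps, whatever its random choices; * its output is distributed exactly as the output of the stabilizer construction with parameters $n,m,g$; * every output of the stabilizer construction that has positive probability belongs to $\mathcal H_{n,m,g}$. That is, for every output pair $(H,s)$,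 $\mathcal D_s$ is doubly even, $\operatorname{rank}(H_s^TH_s)=g$, and $H$ has full column rank (and $H_s$ is not empty). Here the machine has arrays of natural numbers. Programs are built from assignments, sequencing, branches and while-loops over expressions made from constants, array cells, addition and truncated subtraction, and from the instruction that writes a uniformly random integer of $\{0,\dots,N\}$, for $N$ the value of an expression, to an array cell. A step is the execution of one command; numbers have $O(t)$ bits after $t$ steps. -/

import Mathlib

open scoped Matrix

namespace IQP

/-! ## Binary linear codes and the family of instances -/

/-- Column vectors of length `k` over the field with two elements. -/
abbrev Vec (k : ℕ) : Type := Fin k → ZMod 2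

/-- The dual code of a binary linear code of length `ι`. -/
def dualCode {ι : Type} [Fintype ι] (C : Submodule (ZMod 2) (ι → ZMod 2)) :
    Submodule (ZMod 2) (ι → ZMod 2) where
  carrier := {v | ∀ w ∈ C, v ⬝ᵥ w = 0}
  zero_mem' := fun w _ => zero_dotProduct w
  add_mem' := fun {a b} ha hb w hw => by rw [add_dotProduct, ha w hw, hb w hw, add_zero]
  smul_mem' := fun c a ha w hw => by rw [smul_dotProduct, ha w hw, smul_zero]

/-- A code is doubly even if the Hamming weight of each codeword is a multiple of four. -/
def IsDoublyEven {ι : Type} [Fintype ι] (C : Submodule (ZMod 2) (ι → ZMod 2)) : Prop :=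
  ∀ v ∈ C, 4 ∣ hammingNorm v

/-- The matrix `H_s`: the rows of `H` that are not orthogonal to `s`. -/
def secretRows {m n : ℕ} (H : Matrix (Fin m) (Fin n) (ZMod 2)) (s : Vec n) :
    Matrix {i : Fin m // (H *ᵥ s) i = 1} (Fin n) (ZMod 2) :=
  H.submatrix Subtype.val id

/-- The code `C_s` generated by the columns of `H_s`. -/
def secretCode {m n : ℕ} (H : Matrix (Fin m) (Fin n) (ZMod 2)) (s : Vec n) :
    Submodule (ZMod 2) ({i : Fin m // (H *ᵥ s) i = 1} → ZMod 2) :=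
  Submodule.span (ZMod 2) (Set.range (secretRows H s).col)

/-- The self-dual intersection `D_s`, that is, the intersection of `C_s` and its dual code. -/
def secretSelfDual {m n : ℕ} (H : Matrix (Fin m) (Fin n) (ZMod 2)) (s : Vec n) :
    Submodule (ZMod 2) ({i : Fin m // (H *ᵥ s) i = 1} → ZMod 2) :=
  secretCode H s ⊓ dualCode (secretCode H s)

/-- The family `H_{n,m,g}`. The matrix `H_s` has at least one row, so that `s` is a proper
secret (given the full column rank of `H`, this just says `s ≠ 0`). -/
def family (n m g : ℕ) : Set (Matrix (Fin m) (Fin n) (ZMod 2) × Vec n) :=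
  {x | Nonempty {i : Fin m // (x.1 *ᵥ x.2) i = 1} ∧
    IsDoublyEven (secretSelfDual x.1 x.2) ∧
    ((secretRows x.1 x.2)ᵀ * secretRows x.1 x.2).rank = g ∧
    x.1.rank = n}

/-! ## The stabilizer construction as a random process -/

open Classical in
/-- A uniformly random element of a nonempty finite set (and a default value otherwise). -/
noncomputable def draw {α : Type} [Inhabited α] (S : Set α) : PMF α :=
  if h : S.Finite ∧ S.Nonempty then
    PMF.uniformOfFinset h.1.toFinset (h.1.toFinset_nonempty.mpr h.2)
  else pure default

/-- The linear span of a list of vectors. -/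
def spanOf {k : ℕ} (L : List (Vec k)) : Submodule (ZMod 2) (Vec k) :=
  Submodule.span (ZMod 2) {v | v ∈ L}

/-- The vectors that are orthogonal to all vectors of a list. -/
def orthTo {k : ℕ} (L : List (Vec k)) : Set (Vec k) :=
  {v | ∀ c ∈ L, c ⬝ᵥ v = 0}

/-- The constraints on the number `m₁` of rows of `H_s` and the dimension `d` of `D_s`.
The last two say that suitable codes exist: for `g = 0` the all-ones vector lies in `D_s`, and
a doubly even code with `m₁ = 2 d` or `m₁ = 2 d + 1` has a length congruent to 0, 1 or 7
modulo 8. -/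
def admissible (n m g : ℕ) : Set (ℕ × ℕ) :=
  {q | g + q.2 ≤ n ∧ 0 < q.1 ∧ q.1 ≤ m ∧ n + q.1 ≤ m + g + q.2 ∧ g + 2 * q.2 ≤ q.1 ∧
    q.1 % 2 = g % 2 ∧ (g = 0 → 4 ∣ q.1 ∧ 1 ≤ q.2) ∧
    (q.1 ≤ 2 * q.2 + 1 → q.1 % 8 = 0 ∨ q.1 % 8 = 1 ∨ q.1 % 8 = 7)}

open Classical in
/-- Sample a further column for `D`: a vector of weight 0 modulo 4 that is orthogonal to the
columns so far and lies outside their span. -/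
noncomputable def extendD {k : ℕ} (D : List (Vec k)) : PMF (Vec k) := do
  let a₁ ← draw {v | Even (hammingNorm v) ∧ v ∈ orthTo D ∧ v ∉ spanOf D}
  if 4 ∣ hammingNorm a₁ then
    pure a₁
  else if {v : Vec k | Even (hammingNorm v) ∧ v ∈ orthTo (D ++ [a₁]) ∧
      v ∉ spanOf (D ++ [a₁])}.Nonempty then do
    let a₂ ← draw {v | Even (hammingNorm v) ∧ v ∈ orthTo (D ++ [a₁]) ∧ v ∉ spanOf (D ++ [a₁])}
    if 4 ∣ hammingNorm a₂ then pure a₂ else pure (a₁ + a₂)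
  else
    draw {v | 4 ∣ hammingNorm v ∧ v ∈ orthTo D ∧ v ∉ spanOf D}

/-- Append `t` sampled columns to `D`. -/
noncomputable def growD {k : ℕ} : ℕ → List (Vec k) → PMF (List (Vec k))
  | 0, D => pure D
  | t + 1, D => do
    let c ← extendD D
    growD t (D ++ [c])

/-- Sample the columns of `D`. For `g = 0` the all-ones vector has to be one of them. -/
noncomputable def sampleD (k g d : ℕ) : PMF (List (Vec k)) :=
  if g = 0 then growD (d - 1) [1] else growD d []

/-- Append `t` pairs of sampled columns to `F`. -/
noncomputable def growF {k : ℕ} (D : List (Vec k)) : ℕ → List (Vec k) → PMF (List (Vec k))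
  | 0, F => pure F
  | t + 1, F => do
    let a ← draw {v | v ∈ orthTo (D ++ F) ∧ v ∉ spanOf D}
    let b ← draw {v | v ∈ orthTo (D ++ F) ∧ a ⬝ᵥ v = 1}
    growF D t (F ++ [a, b])

open Classical in
/-- Sample the `g` columns of `F`, given those of `D`. -/
noncomputable def sampleF {k : ℕ} (g : ℕ) (D : List (Vec k)) : PMF (List (Vec k)) :=
  if g = 0 then
    pure []
  else if Odd k then
    growF D ((g - 1) / 2) [1]
  else if (1 : Vec k) ∉ spanOf D then do
    let c₂ ← draw {v | v ∈ orthTo D ∧ Odd (hammingNorm v)}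
    growF D ((g - 2) / 2) [1 + c₂, c₂]
  else do
    let c₁ ← draw {v | v ∈ orthTo D ∧ v ∉ spanOf D}
    let c₂ ← draw {v | v ∈ orthTo D ∧ c₁ ⬝ᵥ v = 1}
    growF D ((g - 2) / 2) [c₁, c₂]

/-- Append `t` random redundant rows orthogonal to `s`, each outside the span of all earlier
rows. -/
noncomputable def addIndependentRows {n : ℕ} (s : Vec n) :
    ℕ → List (Vec n) → PMF (List (Vec n))
  | 0, L => pure L
  | t + 1, L => do
    let p ← draw {p | p ⬝ᵥ s = 0 ∧ p ∉ spanOf L}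
    addIndependentRows s t (L ++ [p])

/-- Append `t` random redundant rows orthogonal to `s`. -/
noncomputable def addRows {n : ℕ} (s : Vec n) : ℕ → List (Vec n) → PMF (List (Vec n))
  | 0, L => pure L
  | t + 1, L => do
    let p ← draw {p | p ⬝ᵥ s = 0}
    addRows s t (L ++ [p])

/-- The obfuscation of an instance: `H ↦ P H Q` and `s ↦ Q⁻¹ s` for a uniformly random
permutation `P` of the rows and a uniformly random invertible matrix `Q`. -/
noncomputable def obfuscate {m n : ℕ} (H : Matrix (Fin m) (Fin n) (ZMod 2)) (s : Vec n) :
    PMF (Matrix (Fin m) (Fin n) (ZMod 2) × Vec n) := do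
  let σ ← draw (Set.univ : Set (Equiv.Perm (Fin m)))
  let Q ← draw (Set.univ : Set (GL (Fin n) (ZMod 2)))
  pure (H.submatrix σ id * Q.val, (Q⁻¹).val *ᵥ s)

/-- The output distribution of the stabilizer construction. -/
noncomputable def stabilizerConstruction (n m g : ℕ) :
    PMF (Matrix (Fin m) (Fin n) (ZMod 2) × Vec n) := do
  let q ← draw (admissible n m g)
  let D ← sampleD q.1 g q.2
  let F ← sampleF g D
  let Hs : Matrix (Fin q.1) (Fin n) (ZMod 2) := Matrix.of fun i j => (F ++ D).getD j 0 i
  let s ← draw {s : Vec n | Hs *ᵥ s = 1}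
  let L ← addIndependentRows s (n - (g + q.2)) (List.ofFn Hs)
  let L' ← addRows s (m - q.1 - (n - (g + q.2))) L
  obfuscate (Matrix.of fun i => L'.getD i 0) s

/-! ## Randomized algorithms: programs for a probabilistic random access machine -/

/-- The memory: countably many two-dimensional arrays of natural numbers. -/
abbrev Mem : Type := ℕ → ℕ → ℕ → ℕ

/-- Arithmetic expressions. Only constants, array cells, addition and truncated subtraction are
available, so numbers have only `O(t)` bits after `t` steps. -/
inductive Expr : Type
  | lit (k : ℕ)
  | cell (x : ℕ) (i j : Expr)
  | add (a b : Expr)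
  | sub (a b : Expr)

/-- The value of an expression. -/
def Expr.eval (μ : Mem) : Expr → ℕ
  | lit k => k
  | cell x i j => μ x (i.eval μ) (j.eval μ)
  | add a b => a.eval μ + b.eval μ
  | sub a b => a.eval μ - b.eval μ

/-- Programs: assignment to the cell `x[i, j]`, assignment to it of a uniformly random element of
`{0, …, e}`, sequential composition, branching and looping on whether an expression is nonzero. -/
inductive Prog : Type
  | skip
  | set (x : ℕ) (i j e : Expr)
  | rand (x : ℕ) (i j e : Expr)
  | seq (c₁ c₂ : Prog)
  | cond (e : Expr) (c₁ c₂ : Prog)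
  | loop (e : Expr) (c : Prog)

/-- Overwrite a single memory cell. -/
def Mem.write (μ : Mem) (x i j v : ℕ) : Mem :=
  fun x' i' j' => if x' = x ∧ i' = i ∧ j' = j then v else μ x' i' j'

/-- A configuration: the commands still to be executed, and the memory. -/
structure Config where
  todo : List Prog
  mem : Mem

/-- One step of computation, as a distribution on the next configuration. A halted
configuration, one with nothing left to do, stays as it is. -/
noncomputable def Config.step : Config → PMF Config
  | ⟨[], μ⟩ => PMF.pure ⟨[], μ⟩
  | ⟨.skip :: k, μ⟩ => PMF.pure ⟨k, μ⟩
  | ⟨.set x i j e :: k, μ⟩ => PMF.pure ⟨k, μ.write x (i.eval μ) (j.eval μ) (e.eval μ)⟩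
  | ⟨.rand x i j e :: k, μ⟩ =>
    (PMF.uniformOfFintype (Fin (e.eval μ + 1))).map
      fun r => ⟨k, μ.write x (i.eval μ) (j.eval μ) r⟩
  | ⟨.seq c₁ c₂ :: k, μ⟩ => PMF.pure ⟨c₁ :: c₂ :: k, μ⟩
  | ⟨.cond e c₁ c₂ :: k, μ⟩ => PMF.pure ⟨(if e.eval μ ≠ 0 then c₁ else c₂) :: k, μ⟩
  | ⟨.loop e c :: k, μ⟩ => PMF.pure ⟨if e.eval μ ≠ 0 then c :: .loop e c :: k else k, μ⟩

/-- The distribution of the configuration after `t` steps. -/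
noncomputable def Config.run : ℕ → Config → PMF Config
  | 0, c => PMF.pure c
  | t + 1, c => c.step.bind (Config.run t)

/-- The initial configuration of a program: the input `n, m, g` is in the first three cells of row
zero of array 0, and all other cells are zero. -/
def Prog.start (A : Prog) (n m g : ℕ) : Config where
  todo := [A]
  mem := fun x i j =>
    if x = 0 ∧ i = 0 then (if j = 0 then n else if j = 1 then m else if j = 2 then g else 0)
    else 0

/-- The output: the matrix `H` is read from array 1 and the vector `s` from row zero of array 2,
where a nonzero cell stands for the bit 1. -/
def Mem.output (n m : ℕ) (μ : Mem) : Matrix (Fin m) (Fin n) (ZMod 2) × Vec n :=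
  (Matrix.of fun i j => if μ 1 i j = 0 then 0 else 1, fun j => if μ 2 0 j = 0 then 0 else 1)

/-- On input `n, m, g` the program halts within `t` steps, whatever its random choices. -/
def Prog.HaltsWithin (A : Prog) (n m g t : ℕ) : Prop :=
  ∀ c ∈ (Config.run t (A.start n m g)).support, c.todo = []

/-- The distribution of the output on input `n, m, g`, read off after `t` steps. -/
noncomputable def Prog.outputDist (A : Prog) (n m g t : ℕ) :
    PMF (Matrix (Fin m) (Fin n) (ZMod 2) × Vec n) :=
  (Config.run t (A.start n m g)).map fun c => c.mem.output n m

end IQP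

open scoped Matrix
namespace IQP

/-! There are two halves: a coding-theoretic one, showing that no draw of the construction gets
stuck and that the outcome lies in the family, and an exact simulation by a program of polynomial
cost.

Coding theory. The columns of D stay independent with doubly even span, and the code C spanned by
all columns of D and F has radical exactly span D (`DInv`, `FInv`). Hence rank(MᵀM) = dim C - dim
rad C = g (`rank_gram`). The all-ones vector lies in C, so Ms = 1 is solvable; the independent
redundant rows complete the column rank; permuting rows and multiplying by an invertible matrix
changes the code only by relabelling coordinates (`mem_family_of`, `obfuscate_support`). Most draws
are nonempty by counting dimensions. The exception is a column that brings D close to half of the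
length k. For a doubly even code C, Poisson summation gives ∑ i^|v| = (1 + i)^k, the sum being over
v in the dual code (`sum_dualCode_I_pow`). For k ≡ 0, 1, 7 mod 8 the right side has positive real
part. But if the dual code had even vectors outside C, all of weight 2 mod 4, the real part of the
left side would be at most |C| - |C| = 0 (`IsDoublyEven.exists_four_dvd`). Evaluating the same sum
for k = 2d and k = 2d + 1 shows that the condition modulo 8 is also necessary
(`IsDoublyEven.card_mod_eight`). With the parity of the rank of an alternating form, this shows that
suitable parameters exist whenever the family is nonempty (`admissible_nonempty`).

Simulation. `Sim` relates a program to a distribution on mathematical objects and charges a cost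
that is, by recursion on the program, a polynomial in a common bound N on the rounds of each loop.
The draws of columns and rows reduce to uniform draws from V \ W for subspaces W ≤ V: even weight is
orthogonality to 1; lying in span L is orthogonality to a basis of its orthogonal space
(`perp_map_range`); the draw restricted to weights divisible by four is given by the single
condition a·v = 1 (`DInv.set_eq`); inhomogeneous systems are homogenised by one more coordinate
(`Sim.drawAff`). Elimination (`Hoare.reduce`) maintains one basis whose first a vectors span W and
whose first A vectors span V, and the binary digits of a uniform number in [2^a, 2^A) give a uniform
element of V \ W (`comb_uniform`). The parameters are drawn from an enumerated list, the permutation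
comes from a shuffle, and the invertible matrix is built column by column; these two are uniform
because successive draws with constant numbers of choices are (`draw_bind`). -/

/-! ## A program logic for the random access machine -/

/-- Whether an expression reads no array from a list. -/
def Expr.avoids (ws : List ℕ) : Expr → Bool
  | lit _ => true
  | cell x i j => !ws.contains x && i.avoids ws && j.avoids ws
  | add a b => a.avoids ws && b.avoids ws
  | sub a b => a.avoids ws && b.avoids ws

/-- The arrays a program may write to. -/
@[simp] def Prog.writes : Prog → List ℕ
  | skip => []
  | set x _ _ _ => [x]
  | rand x _ _ _ => [x]
  | seq c₁ c₂ => c₁.writes ++ c₂.writes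
  | cond _ c₁ c₂ => c₁.writes ++ c₂.writes
  | loop _ c => c.writes

/-- A bound on the number of steps of a program each of whose loops makes at most `N` rounds. -/
def Prog.cost (N : ℕ) : Prog → ℕ
  | skip => 1
  | set _ _ _ _ => 1
  | rand _ _ _ _ => 1
  | seq c₁ c₂ => 1 + (c₁.cost N + c₂.cost N)
  | cond _ c₁ c₂ => 1 + (c₁.cost N + c₂.cost N)
  | loop _ c => N * (c.cost N + 1) + 1

/-- `Prog.cost` as a polynomial in the bound on the number of rounds. -/
noncomputable def Prog.costPoly : Prog → Polynomial ℕ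
  | skip => 1
  | set _ _ _ _ => 1
  | rand _ _ _ _ => 1
  | seq c₁ c₂ => 1 + (c₁.costPoly + c₂.costPoly)
  | cond _ c₁ c₂ => 1 + (c₁.costPoly + c₂.costPoly)
  | loop _ c => Polynomial.X * (c.costPoly + 1) + 1

theorem Prog.eval_costPoly (N : ℕ) (c : Prog) : c.costPoly.eval N = c.cost N := by
  induction c <;> simp_all [costPoly, cost]

/-- Two memories agree outside of some arrays. -/
def Frame (ws : List ℕ) (μ μ' : Mem) : Prop := ∀ x, x ∉ ws → μ' x = μ x

theorem Frame.refl (ws : List ℕ) (μ : Mem) : Frame ws μ μ := fun _ _ => rfl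

theorem Frame.mono {ws ws' : List ℕ} {μ μ' : Mem} (h : Frame ws μ μ') (hs : ws ⊆ ws') :
    Frame ws' μ μ' := fun x hx => h x fun h' => hx (hs h')

theorem Frame.trans {ws : List ℕ} {μ μ' μ'' : Mem} (h : Frame ws μ μ') (h' : Frame ws μ' μ'') :
    Frame ws μ μ'' := fun x hx => (h' x hx).trans (h x hx)

theorem Frame.append {ws ws' : List ℕ} {μ μ' μ'' : Mem} (h : Frame ws μ μ')
    (h' : Frame ws' μ' μ'') : Frame (ws ++ ws') μ μ'' :=
  (h.mono (List.subset_append_left _ _)).trans (h'.mono (List.subset_append_right _ _))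

theorem Frame.write (μ : Mem) (x i j v : ℕ) : Frame [x] μ (μ.write x i j v) := by
  intro y hy
  funext i' j'
  have : y ≠ x := by simpa using hy
  simp [Mem.write, this]

theorem Frame.eval {ws : List ℕ} {μ μ' : Mem} (h : Frame ws μ μ') {e : Expr}
    (he : e.avoids ws = true) : e.eval μ' = e.eval μ := by
  induction e with
  | lit k => rfl
  | cell x i j hi hj =>
    simp only [Expr.avoids, Bool.and_eq_true, Bool.not_eq_true', List.contains_eq_mem,
      decide_eq_false_iff_not] at he
    simp only [Expr.eval, hi he.1.2, hj he.2, h x he.1.1]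
  | add a b ha hb =>
    simp only [Expr.avoids, Bool.and_eq_true] at he
    simp only [Expr.eval, ha he.1, hb he.2]
  | sub a b ha hb =>
    simp only [Expr.avoids, Bool.and_eq_true] at he
    simp only [Expr.eval, ha he.1, hb he.2]

/-- From a configuration, the machine halts within `T` steps, and `out` of the final memory has
the distribution `ν`. -/
def Out {β : Type} (out : Mem → β) (c : Config) (T : ℕ) (ν : PMF β) : Prop :=
  (∀ c' ∈ (Config.run T c).support, c'.todo = []) ∧
    (Config.run T c).map (fun c' => out c'.mem) = ν

theorem Config.run_halted (T : ℕ) (c : Config) (h : c.todo = []) : c.run T = PMF.pure c := by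
  obtain ⟨l, μ⟩ := c
  obtain rfl : l = [] := h
  induction T with
  | zero => rfl
  | succ T ih => simp only [Config.run, Config.step, PMF.pure_bind]; exact ih

theorem Config.run_add (T T' : ℕ) (c : Config) : c.run (T + T') = (c.run T).bind (Config.run T') := by
  induction T generalizing c with
  | zero => simp [Config.run]
  | succ T ih =>
    rw [Nat.succ_add]
    simp only [Config.run, PMF.bind_bind]
    congr 1
    funext c
    exact ih c

theorem PMF.bind_congr_support {α β : Type} (p : PMF α) {f g : α → PMF β}
    (h : ∀ a ∈ p.support, f a = g a) : p.bind f = p.bind g := by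
  ext b
  rw [PMF.bind_apply, PMF.bind_apply]
  refine tsum_congr fun a => ?_
  by_cases ha : a ∈ p.support
  · rw [h a ha]
  · rw [(PMF.apply_eq_zero_iff _ _).mpr ha, zero_mul, zero_mul]

/-- Halted configurations are fixed by further steps. This allows a worst-case cost to be charged on
every path. -/
theorem Out.mono {β : Type} {out : Mem → β} {c : Config} {T T' : ℕ} {ν : PMF β}
    (h : Out out c T ν) (hT : T ≤ T') : Out out c T' ν := by
  obtain ⟨r, rfl⟩ := Nat.exists_eq_add_of_le hT
  have : c.run (T + r) = c.run T := by
    rw [Config.run_add, PMF.bind_congr_support (g := PMF.pure), PMF.bind_pure]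
    exact fun a ha => Config.run_halted r a (h.1 a ha)
  simpa only [Out, this] using h

theorem Out.of_step {β : Type} {out : Mem → β} {c : Config} {T : ℕ} {α : Type} {q : PMF α}
    {cf : α → Config} (hq : c.step = q.map cf) {f : α → PMF β}
    (h : ∀ a ∈ q.support, Out out (cf a) T (f a)) : Out out c (1 + T) (q.bind f) := by
  rw [add_comm]
  constructor
  · intro c' hc'
    simp only [Config.run, hq, PMF.bind_map, PMF.mem_support_bind_iff] at hc'
    obtain ⟨a, ha, h'⟩ := hc'
    exact (h a ha).1 c' h'
  · simp only [Config.run, hq, PMF.bind_map, PMF.map_bind]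
    exact PMF.bind_congr_support _ fun a ha => (h a ha).2

theorem Out.of_pure_step {β : Type} {out : Mem → β} {c c' : Config} {T : ℕ} {ν : PMF β}
    (hq : c.step = PMF.pure c') (h : Out out c' T ν) : Out out c (1 + T) ν := by
  have := Out.of_step (out := out) (c := c) (T := T) (q := PMF.pure ()) (cf := fun _ => c')
    (by rw [hq, PMF.pure_map]) (f := fun _ => ν) (fun _ _ => h)
  rwa [PMF.pure_bind] at this

/-- The program `c`, started from the memory `μ`, samples from `d`: within the cost of `c` it
halts with a memory related by `Q` to a sample. Arrays that `c` does not write to are left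
alone. -/
def Sim (N : ℕ) (c : Prog) (μ : Mem) {α : Type} (d : PMF α) (Q : α → Mem → Prop) : Prop :=
  ∀ (β : Type) (out : Mem → β) (k : List Prog) (T : ℕ) (f : α → PMF β),
    (∀ a ∈ d.support, ∀ μ', Q a μ' → Frame c.writes μ μ' → Out out ⟨k, μ'⟩ T (f a)) →
    Out out ⟨c :: k, μ⟩ (c.cost N + T) (d.bind f)

/-- Total correctness of a program that uses no randomness. -/
def Hoare (N : ℕ) (c : Prog) (μ : Mem) (Q : Mem → Prop) : Prop :=
  Sim N c μ (PMF.pure ()) fun _ => Q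

variable {N : ℕ} {c c₁ c₂ : Prog} {μ : Mem} {α γ : Type}

theorem Sim.conseq {d : PMF α} {Q Q' : α → Mem → Prop} (h : Sim N c μ d Q)
    (hQ : ∀ a ∈ d.support, ∀ μ', Q a μ' → Frame c.writes μ μ' → Q' a μ') : Sim N c μ d Q' :=
  fun β out k T f hf => h β out k T f fun a ha μ' hq hF => hf a ha μ' (hQ a ha μ' hq hF) hF

theorem Hoare.conseq {Q Q' : Mem → Prop} (h : Hoare N c μ Q)
    (hQ : ∀ μ', Q μ' → Frame c.writes μ μ' → Q' μ') : Hoare N c μ Q' :=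
  Sim.conseq h fun _ _ => hQ

/-- Relabels the sample without running any code: the raw random integer of the machine becomes the
object it encodes. -/
theorem Sim.map {d : PMF α} {Q : α → Mem → Prop} (g : α → γ) {Q' : γ → Mem → Prop}
    (h : Sim N c μ d Q)
    (hQ : ∀ a ∈ d.support, ∀ μ', Q a μ' → Frame c.writes μ μ' → Q' (g a) μ') :
    Sim N c μ (d.map g) Q' := by
  intro β out k T f hf
  rw [PMF.bind_map]
  exact h β out k T _ fun a ha μ' hq hF =>
    hf (g a) ((PMF.mem_support_map_iff _ _ _).mpr ⟨a, ha, rfl⟩) μ' (hQ a ha μ' hq hF) hF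

theorem Hoare.sim_pure {Q : α → Mem → Prop} (a : α) (h : Hoare N c μ (Q a)) :
    Sim N c μ (PMF.pure a) Q := by
  simpa only [PMF.pure_map] using Sim.map (fun _ => a) (Q' := Q) h fun _ _ _ h _ => h

/-- `Sim` quantifies over the commands still to be run and over the rest `f` of the computation, so
the second program is simply part of the continuation of the first. -/
theorem Sim.seq {d : PMF α} {Q : α → Mem → Prop} {e : α → PMF γ} {R : γ → Mem → Prop}
    (h₁ : Sim N c₁ μ d Q)
    (h₂ : ∀ a ∈ d.support, ∀ μ', Q a μ' → Frame c₁.writes μ μ' → Sim N c₂ μ' (e a) R) :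
    Sim N (.seq c₁ c₂) μ (d.bind e) R := by
  intro β out k T f hf
  rw [PMF.bind_bind, Prog.cost, add_assoc, add_assoc]
  refine Out.of_pure_step rfl ?_
  refine h₁ β out _ _ _ fun a ha μ' hq hF => ?_
  refine h₂ a ha μ' hq hF β out _ _ _ fun b hb μ'' hr hF' => ?_
  refine hf b ?_ μ'' hr ?_
  · exact (PMF.mem_support_bind_iff _ _ _).mpr ⟨a, ha, hb⟩
  · exact (hF.mono (by simp [Prog.writes])).trans (hF'.mono (by simp [Prog.writes]))

theorem Hoare.seq_sim {Q : Mem → Prop} {d : PMF α} {R : α → Mem → Prop} (h₁ : Hoare N c₁ μ Q)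
    (h₂ : ∀ μ', Q μ' → Frame c₁.writes μ μ' → Sim N c₂ μ' d R) : Sim N (.seq c₁ c₂) μ d R := by
  have := Sim.seq (e := fun _ => d) h₁ fun _ _ => h₂
  rwa [PMF.pure_bind] at this

theorem Hoare.seq {Q R : Mem → Prop} (h₁ : Hoare N c₁ μ Q)
    (h₂ : ∀ μ', Q μ' → Frame c₁.writes μ μ' → Hoare N c₂ μ' R) : Hoare N (.seq c₁ c₂) μ R :=
  Hoare.seq_sim h₁ h₂

theorem Sim.seq_hoare {d : PMF α} {Q R : α → Mem → Prop} (h₁ : Sim N c₁ μ d Q)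
    (h₂ : ∀ a ∈ d.support, ∀ μ', Q a μ' → Frame c₁.writes μ μ' → Hoare N c₂ μ' (R a)) :
    Sim N (.seq c₁ c₂) μ d R := by
  have := Sim.seq (e := PMF.pure) (R := R) h₁ fun a ha μ' hq hF =>
    Hoare.sim_pure a (h₂ a ha μ' hq hF)
  rwa [PMF.bind_pure] at this

theorem Hoare.skip {Q : Mem → Prop} (h : Q μ) : Hoare N .skip μ Q := by
  intro β out k T f hf
  rw [PMF.pure_bind]
  exact Out.of_pure_step rfl (hf () (by simp) _ h (Frame.refl _ _))

theorem Hoare.set {x : ℕ} {i j e : Expr} {Q : Mem → Prop}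
    (h : Q (μ.write x (i.eval μ) (j.eval μ) (e.eval μ))) : Hoare N (.set x i j e) μ Q := by
  intro β out k T f hf
  rw [PMF.pure_bind]
  exact Out.of_pure_step rfl (hf () (by simp) _ h (Frame.write _ _ _ _ _))

theorem Hoare.set_seq {x : ℕ} {i j e : Expr} {d : PMF α} {R : α → Mem → Prop}
    (h : Sim N c (μ.write x (i.eval μ) (j.eval μ) (e.eval μ)) d R) :
    Sim N (.seq (.set x i j e) c) μ d R :=
  Hoare.seq_sim (Hoare.set (Q := (· = _)) rfl) fun _ hμ' _ => hμ' ▸ h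

theorem Sim.rand {x : ℕ} {i j e : Expr} {Q : Fin (e.eval μ + 1) → Mem → Prop}
    (h : ∀ r, Q r (μ.write x (i.eval μ) (j.eval μ) r)) :
    Sim N (.rand x i j e) μ (PMF.uniformOfFintype (Fin (e.eval μ + 1))) Q := by
  intro β out k T f hf
  exact Out.of_step (by simp only [Config.step]; exact PMF.map_comp _ _ _) fun r _ =>
    hf r (by simp) _ (h r) (Frame.write _ _ _ _ _)

/-- The test is determined by the memory, so both branches may be compared with the same
distribution; the branch not taken has a contradictory hypothesis. -/
theorem Sim.cond {e : Expr} {d : PMF α} {Q : α → Mem → Prop}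
    (h₁ : e.eval μ ≠ 0 → Sim N c₁ μ d Q) (h₂ : e.eval μ = 0 → Sim N c₂ μ d Q) :
    Sim N (.cond e c₁ c₂) μ d Q := by
  intro β out k T f hf
  rw [Prog.cost, add_assoc]
  by_cases he : e.eval μ = 0
  · refine Out.of_pure_step (c' := ⟨c₂ :: k, μ⟩) (by simp [Config.step, he]) ?_
    refine (h₂ he β out k T f fun a ha μ' hq hF => hf a ha μ' hq (hF.mono ?_)).mono (by omega)
    simp [Prog.writes]
  · refine Out.of_pure_step (c' := ⟨c₁ :: k, μ⟩) (by simp [Config.step, he]) ?_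
    refine (h₁ he β out k T f fun a ha μ' hq hF => hf a ha μ' hq (hF.mono ?_)).mono (by omega)
    simp [Prog.writes]

/-- Iterate a random step `t` times, starting with the number `i`. -/
noncomputable def iter (f : ℕ → α → PMF α) : ℕ → ℕ → α → PMF α
  | 0, _, a => PMF.pure a
  | t + 1, i, a => (f i a).bind (iter f t (i + 1))

theorem iter_pure (t i : ℕ) (a : α) : iter (fun _ => PMF.pure) t i a = PMF.pure a := by
  induction t generalizing i with
  | zero => rfl
  | succ t ih => simp [iter, ih]

theorem Sim.loop {e : Expr} (f : ℕ → α → PMF α) (I : ℕ → α → Mem → Prop) (cnt : ℕ) (a : α)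
    (hcnt : cnt ≤ N) (h0 : I 0 a μ)
    (hstep : ∀ i < cnt, ∀ a μ', I i a μ' → Frame c.writes μ μ' →
      e.eval μ' ≠ 0 ∧ Sim N c μ' (f i a) (I (i + 1)))
    (hend : ∀ a μ', I cnt a μ' → Frame c.writes μ μ' → e.eval μ' = 0) :
    Sim N (.loop e c) μ (iter f cnt 0 a) (I cnt) := by
  intro β out k T F hF
  -- Generalised to start in round `i` with `t` rounds left. The frame accumulates because `hstep`
  -- refers to the memory before the loop.
  have key : ∀ t i a μ', i + t = cnt → I i a μ' → Frame c.writes μ μ' →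
      (∀ a' ∈ (iter f t i a).support, ∀ μ'', I cnt a' μ'' → Frame c.writes μ μ'' →
        Out out ⟨k, μ''⟩ T (F a')) →
      Out out ⟨.loop e c :: k, μ'⟩ (t * (c.cost N + 1) + 1 + T) ((iter f t i a).bind F) := by
    intro t
    induction t with
    | zero =>
      intro i a μ' hi hI hfr hout
      obtain rfl : i = cnt := hi
      rw [iter, PMF.pure_bind, zero_mul, zero_add]
      refine Out.of_pure_step (c' := ⟨k, μ'⟩) (by simp [Config.step, hend a μ' hI hfr]) ?_
      exact hout a (by simp [iter]) μ' hI hfr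
    | succ t ih =>
      intro i a μ' hi hI hfr hout
      obtain ⟨he, hs⟩ := hstep i (by omega) a μ' hI hfr
      have : (t + 1) * (c.cost N + 1) + 1 + T = 1 + (c.cost N + (t * (c.cost N + 1) + 1 + T)) := by
        ring
      rw [iter, PMF.bind_bind, this]
      refine Out.of_pure_step (c' := ⟨c :: .loop e c :: k, μ'⟩) (by simp [Config.step, he]) ?_
      refine hs β out _ _ _ fun b hb μ'' hI' hF' => ?_
      refine ih (i + 1) b μ'' (by omega) hI' (hfr.trans hF') fun a' ha' => hout a' ?_
      exact (PMF.mem_support_bind_iff _ _ _).mpr ⟨b, hb, ha'⟩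
  refine (key cnt 0 a μ (by omega) h0 (Frame.refl _ _) hF).mono ?_
  have := Nat.mul_le_mul_right (c.cost N + 1) hcnt
  simp only [Prog.cost]
  omega

/-- The scalar variable in the first cell of an array. -/
abbrev Expr.var (x : ℕ) : Expr := .cell x (.lit 0) (.lit 0)

/-- Assignment to a scalar variable. -/
abbrev Prog.assign (x : ℕ) (e : Expr) : Prog := .set x (.lit 0) (.lit 0) e

/-- Execute `c` with the scalar variable `x` running through the numbers below `e`. -/
def Prog.forTo (x : ℕ) (e : Expr) (c : Prog) : Prog :=
  .seq (.assign x (.lit 0))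
    (.loop (.sub e (.var x)) (.seq c (.assign x (.add (.var x) (.lit 1)))))

@[simp] theorem Prog.writes_forTo (x : ℕ) (e : Expr) (c : Prog) :
    (forTo x e c).writes = x :: (c.writes ++ [x]) := rfl

@[simp] theorem Mem.write_apply (μ : Mem) (x i j v x' i' j' : ℕ) :
    μ.write x i j v x' i' j' = if x' = x ∧ i' = i ∧ j' = j then v else μ x' i' j' := rfl

theorem Mem.write_of_ne (μ : Mem) {x x' : ℕ} (h : x' ≠ x) (i j v : ℕ) :
    μ.write x i j v x' = μ x' := by
  funext i' j'
  simp [Mem.write, h]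

/-- The bound is re-evaluated before every round, hence the requirement that `e` reads neither the
counter nor an array written by the body. The invariant is asked for after the counter has been
advanced. -/
theorem Sim.forTo {x : ℕ} {e : Expr} (f : ℕ → α → PMF α) (I : ℕ → α → Mem → Prop) (cnt : ℕ)
    (a : α) (hx : x ∉ c.writes) (he : e.avoids (x :: c.writes) = true) (hcnt : e.eval μ = cnt)
    (hN : cnt ≤ N) (h0 : I 0 a (μ.write x 0 0 0))
    (hstep : ∀ i < cnt, ∀ a μ', I i a μ' → μ' x 0 0 = i → Frame (x :: c.writes) μ μ' →
      Sim N c μ' (f i a) fun a' μ'' => I (i + 1) a' (μ''.write x 0 0 (i + 1))) :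
    Sim N (.forTo x e c) μ (iter f cnt 0 a) (I cnt) := by
  refine Hoare.set_seq ?_
  refine Sim.conseq (Sim.loop f (fun i a μ' => μ' x 0 0 = i ∧ I i a μ') cnt a hN ⟨?_, h0⟩ ?_ ?_) ?_
  · simp [Expr.eval]
  · intro i hi a μ' hI hfr
    have hfr' : Frame (x :: c.writes) μ μ' := ((Frame.write μ x 0 0 0).mono (by simp)).trans
      (hfr.mono (by simp [Prog.writes]))
    constructor
    · simp only [Expr.eval, hfr'.eval he, hI.1, hcnt]
      omega
    · refine Sim.seq_hoare (hstep i hi a μ' hI.2 hI.1 hfr') fun a' ha' μ'' h hF => Hoare.set ?_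
      have hxx : μ'' x 0 0 = i := by rw [hF x hx, hI.1]
      simp only [Expr.eval, hxx]
      exact ⟨by simp, h⟩
  · intro a μ' hI hfr
    have hfr' : Frame (x :: c.writes) μ μ' := ((Frame.write μ x 0 0 0).mono (by simp)).trans
      (hfr.mono (by simp [Prog.writes]))
    simp only [Expr.eval, hfr'.eval he, hI.1, hcnt]
    omega
  · exact fun a _ μ' h _ => h.2

theorem Hoare.forTo {x : ℕ} {e : Expr} (I : ℕ → Mem → Prop) (cnt : ℕ)
    (hx : x ∉ c.writes) (he : e.avoids (x :: c.writes) = true) (hcnt : e.eval μ = cnt)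
    (hN : cnt ≤ N) (h0 : I 0 (μ.write x 0 0 0))
    (hstep : ∀ i < cnt, ∀ μ', I i μ' → μ' x 0 0 = i → Frame (x :: c.writes) μ μ' →
      Hoare N c μ' fun μ'' => I (i + 1) (μ''.write x 0 0 (i + 1))) :
    Hoare N (.forTo x e c) μ (I cnt) := by
  have := Sim.forTo (fun _ => PMF.pure) (fun i (_ : Unit) => I i) cnt () hx he hcnt hN h0
    fun i hi _ => hstep i hi
  rwa [iter_pure] at this

end IQP
namespace IQP

/-! ## Families of vectors and their spans -/

/-- The span of the first `A` vectors of a sequence. -/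
def spn {K : ℕ} (b : ℕ → Vec K) (A : ℕ) : Submodule (ZMod 2) (Vec K) :=
  Submodule.span (ZMod 2) (b '' Set.Iio A)

/-- The vectors orthogonal to all vectors of a list, as a subspace. -/
def perp {K : ℕ} (L : List (Vec K)) : Submodule (ZMod 2) (Vec K) where
  carrier := orthTo L
  zero_mem' := fun c _ => dotProduct_zero c
  add_mem' := fun {a b} ha hb c hc => by rw [dotProduct_add, ha c hc, hb c hc, add_zero]
  smul_mem' := fun r a ha c hc => by rw [dotProduct_smul, ha c hc, smul_zero]

variable {K : ℕ}

theorem mem_perp {L : List (Vec K)} {v : Vec K} : v ∈ perp L ↔ ∀ c ∈ L, c ⬝ᵥ v = 0 := Iff.rfl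

theorem perp_append (L L' : List (Vec K)) : perp (L ++ L') = perp L ⊓ perp L' := by
  ext v
  simp only [Submodule.mem_inf, mem_perp, List.mem_append, or_imp, forall_and]

@[simp] theorem perp_nil : perp ([] : List (Vec K)) = ⊤ := by
  ext v
  simp [mem_perp]

theorem mem_spn {b : ℕ → Vec K} {A i : ℕ} (hi : i < A) : b i ∈ spn b A :=
  Submodule.subset_span ⟨i, hi, rfl⟩

theorem spn_le {b : ℕ → Vec K} {A : ℕ} {W : Submodule (ZMod 2) (Vec K)}
    (h : ∀ i < A, b i ∈ W) : spn b A ≤ W := by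
  refine Submodule.span_le.mpr ?_
  rintro _ ⟨i, hi, rfl⟩
  exact h i hi

theorem spn_mono {b : ℕ → Vec K} {A A' : ℕ} (h : A ≤ A') : spn b A ≤ spn b A' :=
  spn_le fun _ hi => mem_spn (hi.trans_le h)

theorem spn_succ (b : ℕ → Vec K) (A : ℕ) :
    spn b (A + 1) = spn b A ⊔ Submodule.span (ZMod 2) {b A} := by
  rw [spn, spn, ← Submodule.span_union]
  congr 1
  ext v
  simp only [Set.mem_image, Set.mem_Iio, Set.mem_union, Set.mem_singleton_iff]
  constructor
  · rintro ⟨i, hi, rfl⟩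
    rcases Nat.lt_succ_iff_lt_or_eq.mp hi with h | rfl
    · exact Or.inl ⟨i, h, rfl⟩
    · exact Or.inr rfl
  · rintro (⟨i, hi, rfl⟩ | rfl)
    · exact ⟨i, by omega, rfl⟩
    · exact ⟨A, by omega, rfl⟩

/-- Elimination rearranges an initial segment only; longer initial spans survive, and with them the
independence of the whole basis. -/
theorem spn_congr {b b' : ℕ → Vec K} {A P : ℕ} (hA : A ≤ P) (h : spn b' A = spn b A)
    (h' : ∀ i, A ≤ i → b' i = b i) : spn b' P = spn b P := by
  induction P, hA using Nat.le_induction with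
  | base => exact h
  | succ P hP ih => rw [spn_succ, spn_succ, ih, h' P hP]

/-- The first `A` vectors of a sequence are linearly independent. -/
def Indep (b : ℕ → Vec K) (A : ℕ) : Prop :=
  LinearIndependent (ZMod 2) fun i : Fin A => b i

theorem range_fin_eq (b : ℕ → Vec K) (A : ℕ) :
    Set.range (fun i : Fin A => b i) = b '' Set.Iio A := by
  ext v
  simp only [Set.mem_range, Set.mem_image, Set.mem_Iio]
  exact ⟨fun ⟨i, hi⟩ => ⟨i, i.2, hi⟩, fun ⟨i, hi, h⟩ => ⟨⟨i, hi⟩, h⟩⟩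

theorem indep_iff (b : ℕ → Vec K) (A : ℕ) : Indep b A ↔ Module.finrank (ZMod 2) (spn b A) = A := by
  rw [Indep, linearIndependent_iff_card_eq_finrank_span, range_fin_eq, Fintype.card_fin, eq_comm]
  rfl

theorem Indep.mono {b : ℕ → Vec K} {A A' : ℕ} (h : Indep b A') (hA : A ≤ A') : Indep b A :=
  LinearIndependent.comp h (Fin.castLE hA) (Fin.castLE_injective hA)

theorem Indep.congr {b b' : ℕ → Vec K} {A : ℕ} (h : Indep b A) (hs : spn b' A = spn b A) :
    Indep b' A := by
  rwa [indep_iff, hs, ← indep_iff]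

/-- Replace two consecutive vectors `u`, `w` by `w + y u`, `u`. -/
def mixAt (b : ℕ → Vec K) (j : ℕ) (y : ZMod 2) : ℕ → Vec K :=
  Function.update (Function.update b j (b (j + 1) + y • b j)) (j + 1) (b j)

theorem spn_mixAt (b : ℕ → Vec K) {j A : ℕ} (hj : j + 1 < A) (y : ZMod 2) :
    spn (mixAt b j y) A = spn b A := by
  have e1 : mixAt b j y j = b (j + 1) + y • b j := by simp [mixAt]
  have e2 : mixAt b j y (j + 1) = b j := by simp [mixAt]
  have e3 : ∀ i, i ≠ j → i ≠ j + 1 → mixAt b j y i = b i := fun i h h' => by simp [mixAt, h, h']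
  apply le_antisymm
  · refine spn_le fun i hi => ?_
    by_cases h1 : i = j
    · rw [h1, e1]
      exact add_mem (mem_spn hj) (Submodule.smul_mem _ _ (mem_spn (by omega)))
    by_cases h2 : i = j + 1
    · rw [h2, e2]
      exact mem_spn (by omega)
    rw [e3 i h1 h2]
    exact mem_spn hi
  · refine spn_le fun i hi => ?_
    by_cases h1 : i = j
    · rw [h1, ← e2]
      exact mem_spn hj
    by_cases h2 : i = j + 1
    · have : b i = mixAt b j y j - y • mixAt b j y (j + 1) := by rw [e1, e2, h2]; abel
      rw [this]
      exact sub_mem (mem_spn (by omega)) (Submodule.smul_mem _ _ (mem_spn hj))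
    rw [← e3 i h1 h2]
    exact mem_spn hi

/-- The functional `c` vanishes on all vectors but the last, so its kernel arises by dropping that
one. -/
theorem spn_eq_inf_perp {b : ℕ → Vec K} {A : ℕ} {c : Vec K} (h : ∀ i < A, c ⬝ᵥ b i = 0)
    (hA : c ⬝ᵥ b A = 1) : spn b A = spn b (A + 1) ⊓ perp [c] := by
  have h0 : spn b A ≤ perp [c] := spn_le fun i hi => by simpa [mem_perp] using h i hi
  apply le_antisymm
  · exact le_inf (spn_mono (by omega)) h0
  · rintro v ⟨hv, hc⟩
    rw [spn_succ] at hv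
    obtain ⟨u, hu, w, hw, rfl⟩ := Submodule.mem_sup.mp hv
    obtain ⟨r, rfl⟩ := Submodule.mem_span_singleton.mp hw
    have h1 := mem_perp.mp hc c (by simp)
    rw [dotProduct_add, h0 hu c (by simp), dotProduct_smul, hA] at h1
    have : r = 0 := by simpa using h1
    simpa [this] using hu

/-! ## Programs for vectors -/

/-- A row of an array holds a binary vector. -/
def Row (μ : Mem) (x i : ℕ) (v : Vec K) : Prop := ∀ j : Fin K, μ x i j = (v j).val

theorem Row.congr {μ μ' : Mem} {x i : ℕ} {v : Vec K} (h : Row μ x i v) (e : μ' x i = μ x i) :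
    Row μ' x i v := fun j => by rw [e, h j]

theorem Row.frame {μ μ' : Mem} {x i : ℕ} {v : Vec K} (h : Row μ x i v) {ws : List ℕ}
    (hF : Frame ws μ μ') (hx : x ∉ ws) : Row μ' x i v := h.congr (by rw [hF x hx])

/-- The exclusive or of two bits. -/
def Expr.xor (a b : Expr) : Expr := .add (.sub a b) (.sub b a)

/-- The conjunction of two bits. -/
def Expr.and (a b : Expr) : Expr := .sub (.add a b) (.lit 1)

/-- On bits, addition and truncated subtraction suffice for the field operations of F₂. -/
theorem val_add_two (a b : ZMod 2) : (a + b).val = (a.val - b.val) + (b.val - a.val) := by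
  revert a b; decide

theorem val_mul_two (a b : ZMod 2) : (a * b).val = a.val + b.val - 1 := by
  revert a b; decide

theorem zmod_two_cases (a : ZMod 2) : a = 0 ∨ a = 1 := by revert a; decide

theorem Expr.eval_xor {μ : Mem} {a b : Expr} {s t : ZMod 2} (ha : a.eval μ = s.val)
    (hb : b.eval μ = t.val) : (a.xor b).eval μ = (s + t).val := by
  simp only [Expr.xor, Expr.eval, ha, hb, val_add_two]

theorem Expr.eval_and {μ : Mem} {a b : Expr} {s t : ZMod 2} (ha : a.eval μ = s.val)
    (hb : b.eval μ = t.val) : (a.and b).eval μ = (s * t).val := by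
  simp only [Expr.and, Expr.eval, ha, hb, val_mul_two]

/-- A vector as a sequence. -/
def ext (v : Vec K) (j : ℕ) : ZMod 2 := if h : j < K then v ⟨j, h⟩ else 0

@[simp] theorem ext_fin (v : Vec K) (j : Fin K) : ext v j = v j := by simp [ext]

theorem Row.ext {μ : Mem} {x i : ℕ} {v : Vec K} (h : Row μ x i v) {j : ℕ} (hj : j < K) :
    μ x i j = (IQP.ext v j).val := by
  have := h ⟨j, hj⟩
  rwa [← ext_fin v] at this

theorem sum_ext (a b : Vec K) : ∑ j ∈ Finset.range K, ext a j * ext b j = a ⬝ᵥ b := by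
  simp [Finset.sum_range, dotProduct]

/-- Store the inner product of two vectors in the variable 14. -/
def Prog.dot (x : ℕ) (i : Expr) (y : ℕ) (j : Expr) : Prog :=
  .seq (.assign 14 (.lit 0)) (.forTo 13 (.var 10)
    (.assign 14 ((Expr.var 14).xor ((Expr.cell x i (.var 13)).and (.cell y j (.var 13))))))

@[simp] theorem Prog.writes_dot (x : ℕ) (i : Expr) (y : ℕ) (j : Expr) :
    (dot x i y j).writes = [14, 13, 14, 13] := rfl

variable {N : ℕ} {μ : Mem}

/-- Arrays below 30 are input, output, scalars and scratch space; `30 ≤ x` keeps the operands apart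
from what is overwritten here. -/
theorem Hoare.dot {x y : ℕ} {i j : Expr} {a b : Vec K} (hK : μ 10 0 0 = K) (hKN : K ≤ N)
    (hx : 30 ≤ x) (hy : 30 ≤ y) (hi : i.avoids [13, 14] = true) (hj : j.avoids [13, 14] = true)
    (ha : Row μ x (i.eval μ) a) (hb : Row μ y (j.eval μ) b) :
    Hoare N (.dot x i y j) μ fun μ' => μ' 14 0 0 = (a ⬝ᵥ b).val := by
  refine Hoare.set_seq ?_
  have hF : Frame [13, 14] μ (μ.write 14 0 0 0) := (Frame.write μ 14 0 0 0).mono (by simp)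
  refine Hoare.conseq (Hoare.forTo
    (fun t μ' => μ' 14 0 0 = (∑ j ∈ Finset.range t, IQP.ext a j * IQP.ext b j).val) K
    (by simp [Prog.writes]) rfl ?_ hKN ?_ ?_) ?_
  · simpa [Expr.eval] using hK
  · simp [Expr.eval]
  · intro t ht μ' hI hv hfr
    have hfr' : Frame [13, 14] μ μ' := hF.trans (hfr.mono (by simp [Prog.writes]))
    refine Hoare.set ?_
    have hx' : x ∉ [13, 14] := by simp; omega
    have hy' : y ∉ [13, 14] := by simp; omega
    have e1 : (Expr.cell x i (.var 13)).eval μ' = (IQP.ext a t).val := by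
      simp only [Expr.eval, hfr'.eval hi, hv, hfr' x hx', ha.ext ht]
    have e2 : (Expr.cell y j (.var 13)).eval μ' = (IQP.ext b t).val := by
      simp only [Expr.eval, hfr'.eval hj, hv, hfr' y hy', hb.ext ht]
    have e3 := Expr.eval_xor (a := .var 14) hI (Expr.eval_and e1 e2)
    rw [e3, Finset.sum_range_succ]
    simp [Expr.eval]
  · intro μ' h _
    simpa only [sum_ext] using h

/-- For all `k` below `n`, assign to the `k`-th cell of a row the value of an expression, where `k`
is in the variable 13. -/
def Prog.mapRow (x : ℕ) (i n e : Expr) : Prog :=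
  .forTo 13 n (.set x i (.var 13) e)

@[simp] theorem Prog.writes_mapRow (x : ℕ) (i n e : Expr) :
    (mapRow x i n e).writes = [13, x, 13] := rfl

/-- The hypothesis `he` sees the row in mid-update: its cells from the current index on, and all
other rows, are still the original ones. This makes in-place updates such as adding a row sound. -/
theorem Hoare.mapRow {x : ℕ} {i n e : Expr} (g : ℕ → ℕ) {cnt : ℕ} (hn : n.eval μ = cnt)
    (hcnt : cnt ≤ N) (hx : x ≠ 13) (hi : i.avoids [13, x] = true) (hn' : n.avoids [13, x] = true)
    (he : ∀ k < cnt, ∀ μ', Frame [13, x] μ μ' → μ' 13 0 0 = k →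
      (∀ i' j', i' ≠ i.eval μ ∨ k ≤ j' → μ' x i' j' = μ x i' j') → e.eval μ' = g k) :
    Hoare N (.mapRow x i n e) μ fun μ' => ∀ i' j',
      μ' x i' j' = if i' = i.eval μ ∧ j' < cnt then g j' else μ x i' j' := by
  refine Hoare.forTo (fun t μ' => ∀ i' j',
      μ' x i' j' = if i' = i.eval μ ∧ j' < t then g j' else μ x i' j') cnt
    (by simpa [Prog.writes] using hx.symm) hn' hn hcnt ?_ ?_
  · simp [hx]
  · intro t ht μ' hI hv hfr
    have hfr' : Frame [13, x] μ μ' := hfr.mono (by simp [Prog.writes])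
    refine Hoare.set ?_
    rw [he t ht μ' hfr' hv fun i' j' h => ?_]
    · intro i' j'
      simp only [Expr.eval, hv, hfr'.eval hi, Mem.write_apply, hx, false_and, if_false, true_and]
      rw [hI]
      by_cases h1 : i' = i.eval μ
      · by_cases h2 : j' = t
        · simp [h1, h2]
        · have : j' < t ↔ j' < t + 1 := by omega
          simp [h1, h2, this]
      · simp [h1]
    · rw [hI, if_neg]
      omega

/-- Copy the first cells of a row. -/
def Prog.copyRow (x : ℕ) (i : Expr) (y : ℕ) (j : Expr) : Prog :=
  .mapRow x i (.var 10) (.cell y j (.var 13))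

@[simp] theorem Prog.writes_copyRow (x : ℕ) (i : Expr) (y : ℕ) (j : Expr) :
    (copyRow x i y j).writes = [13, x, 13] := rfl

theorem Hoare.copyRow {x y : ℕ} {i j : Expr} {v : Vec K} (hK : μ 10 0 0 = K) (hKN : K ≤ N)
    (hx : x ≠ 10 ∧ x ≠ 13) (hy : y ≠ 13)
    (hi : i.avoids [13, x] = true) (hj : j.avoids [13, x] = true)
    (hv : Row μ y (j.eval μ) v) (hxy : x ≠ y ∨ i.eval μ ≠ j.eval μ) :
    Hoare N (.copyRow x i y j) μ fun μ' => Row μ' x (i.eval μ) v ∧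
      (∀ j', K ≤ j' → μ' x (i.eval μ) j' = μ x (i.eval μ) j') ∧
      ∀ i', i' ≠ i.eval μ → μ' x i' = μ x i' := by
  refine (Hoare.mapRow (fun k => (IQP.ext v k).val) (cnt := K) (by exact hK) hKN hx.2 hi ?_ ?_).conseq ?_
  · simpa [Expr.avoids] using Ne.symm hx.1
  · intro k hk μ' hF hk' h
    simp only [Expr.eval, hF.eval hj, hk']
    rw [← hv.ext hk]
    by_cases hxy' : y = x
    · subst hxy'
      exact h _ _ (Or.inl (by simpa [eq_comm] using hxy))
    · rw [hF y (by simp [hy, hxy'])]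
  · intro μ' h _
    refine ⟨fun k => ?_, fun j' hj' => ?_, fun i' hi' => ?_⟩
    · rw [h, if_pos ⟨rfl, k.2⟩, ext_fin]
    · rw [h, if_neg (by omega)]
    · funext j'
      rw [h, if_neg (by tauto)]

/-- Add a row to another one. -/
def Prog.xorRow (x : ℕ) (i : Expr) (y : ℕ) (j : Expr) : Prog :=
  .mapRow x i (.var 10) ((Expr.cell x i (.var 13)).xor (.cell y j (.var 13)))

@[simp] theorem Prog.writes_xorRow (x : ℕ) (i : Expr) (y : ℕ) (j : Expr) :
    (xorRow x i y j).writes = [13, x, 13] := rfl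

theorem Hoare.xorRow {x y : ℕ} {i j : Expr} {v w : Vec K} (hK : μ 10 0 0 = K) (hKN : K ≤ N)
    (hx : x ≠ 10 ∧ x ≠ 13) (hy : y ≠ 13)
    (hi : i.avoids [13, x] = true) (hj : j.avoids [13, x] = true)
    (hv : Row μ x (i.eval μ) v) (hw : Row μ y (j.eval μ) w) (hxy : x ≠ y) :
    Hoare N (.xorRow x i y j) μ fun μ' => Row μ' x (i.eval μ) (v + w) ∧
      ∀ i', i' ≠ i.eval μ → μ' x i' = μ x i' := by
  refine (Hoare.mapRow (fun k => (IQP.ext v k + IQP.ext w k).val) (cnt := K) (by exact hK) hKN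
    hx.2 hi ?_ ?_).conseq ?_
  · simpa [Expr.avoids] using Ne.symm hx.1
  · intro k hk μ' hF hk' h
    refine Expr.eval_xor ?_ ?_
    · simp only [Expr.eval, hF.eval hi, hk']
      rw [← hv.ext hk]
      exact h _ _ (Or.inr le_rfl)
    · simp only [Expr.eval, hF.eval hj, hk']
      rw [← hw.ext hk, hF y (by simp [hy, hxy.symm])]
  · intro μ' h _
    refine ⟨fun k => ?_, fun i' hi' => ?_⟩
    · rw [h, if_pos ⟨rfl, k.2⟩, ext_fin, ext_fin]
      rfl
    · funext j'
      rw [h, if_neg (by tauto)]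

end IQP
namespace IQP

/-! ## Elimination -/

variable {K N : ℕ} {μ : Mem}

/-- The first `P` rows of an array hold the vectors of a sequence. -/
def Rows (μ : Mem) (β P : ℕ) (b : ℕ → Vec K) : Prop := ∀ i < P, Row μ β i (b i)

/-- Replace the vectors `u`, `w` in the rows given by the variable 15 and its successor by
`w + y u`, `u`, where `y` is the bit in the variable 14. -/
def Prog.mix (β : ℕ) : Prog :=
  .seq (.copyRow 28 (.lit 0) β (.var 15)) (.seq
    (.mapRow β (.var 15) (.var 10) ((Expr.cell β (.add (.var 15) (.lit 1)) (.var 13)).xor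
      ((Expr.var 14).and (.cell 28 (.lit 0) (.var 13)))))
    (.copyRow β (.add (.var 15) (.lit 1)) 28 (.lit 0)))

@[simp] theorem Prog.writes_mix (β : ℕ) :
    (mix β).writes = [13, 28, 13, 13, β, 13, 13, β, 13] := rfl

/-- `u` is saved in array 28 because its row is overwritten before it is needed for the last time.
-/
theorem Hoare.mix {β j : ℕ} {u w : Vec K} {y : ZMod 2} (hβ : 30 ≤ β) (hK : μ 10 0 0 = K)
    (hKN : K ≤ N) (hj : μ 15 0 0 = j) (hy : μ 14 0 0 = y.val) (hu : Row μ β j u)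
    (hw : Row μ β (j + 1) w) :
    Hoare N (.mix β) μ fun μ' => Row μ' β j (w + y • u) ∧ Row μ' β (j + 1) u ∧
      ∀ i, i ≠ j → i ≠ j + 1 → μ' β i = μ β i := by
  have a1 : β ∉ [13, 28] := by simp; omega
  refine Hoare.seq (Hoare.copyRow (v := u) hK hKN (by omega) (by omega) rfl rfl
    (by simpa [Expr.eval, hj] using hu) (Or.inl (by omega))) fun μ₁ h₁ F₁ => ?_
  replace F₁ : Frame [13, 28] μ μ₁ := F₁.mono (by simp)
  have b1 : μ₁ β = μ β := F₁ β a1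
  have c10 : μ₁ 10 = μ 10 := F₁ 10 (by decide)
  have c14 : μ₁ 14 = μ 14 := F₁ 14 (by decide)
  have c15 : μ₁ 15 = μ 15 := F₁ 15 (by decide)
  have m10 : (10 : ℕ) ≠ β ∧ (13 : ℕ) ≠ β ∧ (14 : ℕ) ≠ β ∧ (15 : ℕ) ≠ β ∧ (28 : ℕ) ≠ β := by omega
  have av : ∀ x, x ≠ 13 → x ≠ β → (Expr.var x).avoids [13, β] = true := fun x h h' => by
    simp [Expr.avoids, h, h']
  have av' : (Expr.add (.var 15) (.lit 1)).avoids [13, β] = true := by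
    simp [Expr.avoids, m10]
  refine Hoare.seq (Hoare.mapRow (fun k => (IQP.ext w k + y * IQP.ext u k).val) (cnt := K)
    (by simpa [Expr.eval, c10] using hK) hKN (by omega) (av 15 (by omega) (by omega))
    (av 10 (by omega) (by omega)) ?_) fun μ₂ h₂ F₂ => ?_
  · intro k hk μ' F hk' h
    have e15 : μ' 15 0 0 = j := by rw [F 15 (by simp [m10]), c15, hj]
    refine Expr.eval_xor ?_ (Expr.eval_and ?_ ?_)
    · simp only [Expr.eval, e15, hk']
      rw [h _ _ (Or.inl (by simp only [Expr.eval, c15, hj]; omega)), b1, hw.ext hk]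
    · simp only [Expr.eval]
      rw [F 14 (by simp [m10]), c14, hy]
    · simp only [Expr.eval, hk']
      rw [F 28 (by simp [m10]), ← h₁.1.ext hk]
      rfl
  · replace F₂ : Frame [13, β] μ₁ μ₂ := F₂.mono (by simp)
    have d15 : μ₂ 15 0 0 = j := by rw [F₂ 15 (by simp [m10]), c15, hj]
    have d10 : μ₂ 10 0 0 = K := by rw [F₂ 10 (by simp [m10]), c10, hK]
    simp only [Expr.eval, c15, hj] at h₂
    refine (Hoare.copyRow (v := u) d10 hKN (by omega) (by omega) av' rfl ?_
      (Or.inl (by omega))).conseq fun μ₃ h₃ F₃ => ?_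
    · exact h₁.1.frame F₂ (by simp [m10])
    · simp only [Expr.eval, d15] at h₃
      refine ⟨fun k => ?_, h₃.1, fun i hi hi' => ?_⟩
      · rw [h₃.2.2 j (by omega), h₂, if_pos ⟨rfl, k.2⟩, ext_fin, ext_fin]
        rfl
      · rw [h₃.2.2 i hi', ← b1]
        funext j'
        rw [h₂, if_neg (by tauto)]

/-- One elimination step: among the vectors in the rows of an array up to the number in the variable
11, restrict to those orthogonal to a given vector. -/
def Prog.reduce (x : ℕ) (i : Expr) (β : ℕ) : Prog :=
  .seq (.forTo 15 (.sub (.var 11) (.lit 1)) (.seq (.dot x i β (.var 15)) (.cond (.var 14)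
    (.seq (.dot x i β (.add (.var 15) (.lit 1))) (.mix β)) .skip)))
  (.cond (.var 11) (.seq (.dot x i β (.sub (.var 11) (.lit 1)))
    (.assign 11 (.sub (.var 11) (.var 14)))) .skip)

/-- The arrays and variables used by the elimination. -/
abbrev elimVars (β : ℕ) : List ℕ := [11, 13, 14, 15, 28, β]

theorem Expr.avoids_mono {ws ws' : List ℕ} (h : ws' ⊆ ws) {e : Expr} (he : e.avoids ws = true) :
    e.avoids ws' = true := by
  induction e with
  | lit k => rfl
  | cell x i j hi hj =>
    simp only [Expr.avoids, Bool.and_eq_true, Bool.not_eq_true', List.contains_eq_mem,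
      decide_eq_false_iff_not] at he ⊢
    exact ⟨⟨fun h' => he.1.1 (h h'), hi he.1.2⟩, hj he.2⟩
  | add a b ha hb =>
    simp only [Expr.avoids, Bool.and_eq_true] at he ⊢
    exact ⟨ha he.1, hb he.2⟩
  | sub a b ha hb =>
    simp only [Expr.avoids, Bool.and_eq_true] at he ⊢
    exact ⟨ha he.1, hb he.2⟩

theorem Prog.writes_reduce (x : ℕ) (i : Expr) (β : ℕ) : (reduce x i β).writes ⊆ elimVars β := by
  simp [reduce]

theorem Rows.mixAt {μ' : Mem} {β P j : ℕ} {b : ℕ → Vec K} {y : ZMod 2} (h : Rows μ β P b)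
    (h₁ : Row μ' β j (b (j + 1) + y • b j)) (h₂ : Row μ' β (j + 1) (b j))
    (h₃ : ∀ i, i ≠ j → i ≠ j + 1 → μ' β i = μ β i) : Rows μ' β P (mixAt b j y) := by
  intro i hi
  by_cases e1 : i = j
  · subst e1
    simpa [IQP.mixAt] using h₁
  by_cases e2 : i = j + 1
  · subst e2
    simpa [IQP.mixAt] using h₂
  · simpa [IQP.mixAt, e1, e2] using (h i hi).congr (h₃ i e1 e2)

theorem Rows.frame {μ' : Mem} {β P : ℕ} {b : ℕ → Vec K} (h : Rows μ β P b) {ws : List ℕ}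
    (hF : Frame ws μ μ') (hβ : β ∉ ws) : Rows μ' β P b := fun i hi => (h i hi).frame hF hβ

/-- A sweep from left to right keeps the vectors already passed orthogonal to `c`: a vector that is
not gets exchanged with its successor, which it corrects on the way. At the end only the last of the
`A` vectors can fail to be orthogonal, and then it is dropped by decreasing the length. It stays in
the array, so the old span is kept. -/
theorem Hoare.reduce {x β P A : ℕ} {i : Expr} {c : Vec K} {b : ℕ → Vec K} (hβ : 30 ≤ β)
    (hx : 30 ≤ x) (hxβ : x ≠ β) (hK : μ 10 0 0 = K) (hKN : K ≤ N) (hi : i.avoids (elimVars β) = true)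
    (hA : μ 11 0 0 = A) (hAP : A ≤ P) (hPN : P ≤ N) (hc : Row μ x (i.eval μ) c)
    (hb : Rows μ β P b) :
    Hoare N (.reduce x i β) μ fun μ' => ∃ b' : ℕ → Vec K, Rows μ' β P b' ∧
      (∀ i, A ≤ i → b' i = b i) ∧ spn b' A = spn b A ∧ ∃ A' ≤ A, μ' 11 0 0 = A' ∧
      spn b' A' = spn b A ⊓ perp [c] := by
  have m : (10 : ℕ) ≠ β ∧ (11 : ℕ) ≠ β ∧ (13 : ℕ) ≠ β ∧ (14 : ℕ) ≠ β ∧ (15 : ℕ) ≠ β ∧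
    (28 : ℕ) ≠ β := by omega
  have m' : x ≠ 11 ∧ x ≠ 13 ∧ x ≠ 14 ∧ x ≠ 15 ∧ x ≠ 28 := by omega
  have n' : β ≠ 11 ∧ β ≠ 13 ∧ β ≠ 14 ∧ β ≠ 15 ∧ β ≠ 28 := by omega
  have hi2 : i.avoids [13, 14] = true := Expr.avoids_mono (by simp) hi
  refine Hoare.seq (Hoare.forTo (fun t μ' => ∃ b' : ℕ → Vec K, Rows μ' β P b' ∧
      (∀ i, A ≤ i → b' i = b i) ∧ spn b' A = spn b A ∧ ∀ i < t, c ⬝ᵥ b' i = 0) (A - 1)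
      ?_ ?_ ?_ (by omega) ?_ ?_) ?_
  · simp [m]
  · simp [Expr.avoids, m]
  · simp [Expr.eval, hA]
  · exact ⟨b, hb.frame (Frame.write μ 15 0 0 0) (by simp [n']), fun _ _ => rfl, rfl, by simp⟩
  · rintro t ht μ₁ ⟨b₁, r₁, s₁, p₁, o₁⟩ hv F₁
    replace F₁ : Frame [13, 14, 15, 28, β] μ μ₁ := F₁.mono (by
      simp)
    have hiμ₁ : i.eval μ₁ = i.eval μ := F₁.eval (Expr.avoids_mono (by simp) hi)
    have c10 : μ₁ 10 0 0 = K := by rw [F₁ 10 (by simp [m]), hK]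
    have cx : μ₁ x = μ x := F₁ x (by simp [m', hxβ])
    refine Hoare.seq (Hoare.dot c10 hKN hx hβ hi2 rfl (by rw [hiμ₁]; exact hc.congr (by rw [cx]))
      (by simpa [Expr.eval, hv] using r₁ t (by omega))) fun μ₂ h₂ F₂ => ?_
    replace F₂ : Frame [13, 14] μ₁ μ₂ := F₂.mono (by simp)
    have r₂ : Rows μ₂ β P b₁ := r₁.frame F₂ (by simp [n'])
    have d15 : μ₂ 15 0 0 = t := by rw [F₂ 15 (by decide), hv]
    have wr : ∀ (μ' : Mem) v, μ'.write 15 0 0 v β = μ' β := fun μ' v => Mem.write_of_ne _ n'.2.2.2.1 _ _ _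
    refine Sim.cond (fun h14 => ?_) fun h14 => Hoare.skip ?_
    · have d10 : μ₂ 10 0 0 = K := by rw [F₂ 10 (by decide), c10]
      have one : c ⬝ᵥ b₁ t = 1 := by
        rcases zmod_two_cases (c ⬝ᵥ b₁ t) with h | h
        · simp [Expr.eval, h₂, h] at h14
        · exact h
      refine Hoare.seq (Hoare.dot d10 hKN hx hβ hi2 rfl (a := c) (b := b₁ (t + 1)) ?_ ?_)
        fun μ₃ h₃ F₃ => ?_
      · rw [F₂.eval hi2, hiμ₁]
        exact hc.congr (by rw [F₂ x (by simp [m']), cx])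
      · simpa [Expr.eval, d15] using r₂ (t + 1) (by omega)
      replace F₃ : Frame [13, 14] μ₂ μ₃ := F₃.mono (by simp)
      have r₃ : Rows μ₃ β P b₁ := r₂.frame F₃ (by simp [n'])
      refine (Hoare.mix hβ (by rw [F₃ 10 (by decide), d10]) hKN
        (by rw [F₃ 15 (by decide), d15]) h₃ (r₃ t (by omega)) (r₃ (t + 1) (by omega))).conseq ?_
      rintro μ₄ ⟨q₁, q₂, q₃⟩ _
      -- As c·b_t = 1, the coefficient y = c·b_{t+1} makes b_{t+1} + y b_t orthogonal to c: the two
      -- contributions are equal and cancel.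
      refine ⟨IQP.mixAt b₁ t (c ⬝ᵥ b₁ (t + 1)), ?_, ?_, ?_, ?_⟩
      · exact fun i hi => (r₃.mixAt q₁ q₂ q₃ i hi).congr (by rw [wr])
      · intro i hi
        rw [← s₁ i hi]
        simp [IQP.mixAt, show i ≠ t by omega, show i ≠ t + 1 by omega]
      · rw [spn_mixAt _ (by omega), p₁]
      · intro i hi
        by_cases e : i = t
        · subst e
          simp only [IQP.mixAt, ne_eq, left_eq_add, one_ne_zero, not_false_eq_true,
            Function.update_of_ne, Function.update_self, dotProduct_add, dotProduct_smul, one]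
          rw [smul_eq_mul, mul_one, CharTwo.add_self_eq_zero]
        · simpa [IQP.mixAt, e, show i ≠ t + 1 by omega] using o₁ i (by omega)
    · have zero : c ⬝ᵥ b₁ t = 0 := by
        rcases zmod_two_cases (c ⬝ᵥ b₁ t) with h | h
        · exact h
        · simp [Expr.eval, h₂, h, ZMod.val_one] at h14
      refine ⟨b₁, fun i hi => (r₂ i hi).congr (by rw [wr]), s₁, p₁, fun i hi => ?_⟩
      rcases Nat.lt_succ_iff_lt_or_eq.mp hi with h | rfl
      · exact o₁ i h
      · exact zero
  · rintro μ₁ ⟨b₁, r₁, s₁, p₁, o₁⟩ F₁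
    replace F₁ : Frame [13, 14, 15, 28, β] μ μ₁ := F₁.mono (by
      simp)
    have c11 : μ₁ 11 0 0 = A := by rw [F₁ 11 (by simp [m]), hA]
    -- For A = 0 there is no last vector; the guard keeps `A - 1` from being truncated.
    refine Sim.cond (fun h11 => ?_) fun h11 => Hoare.skip ?_
    · have hA0 : A ≠ 0 := by simpa [Expr.eval, c11] using h11
      have hiμ₁ : i.eval μ₁ = i.eval μ := F₁.eval (Expr.avoids_mono (by simp) hi)
      have cx : μ₁ x = μ x := F₁ x (by simp [m', hxβ])
      refine Hoare.seq (Hoare.dot (b := b₁ (A - 1)) (by rw [F₁ 10 (by simp [m]), hK]) hKN hx hβ hi2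
        rfl (by rw [hiμ₁]; exact hc.congr (by rw [cx])) (by simpa [Expr.eval, c11] using r₁ (A - 1) (by omega)))
        fun μ₂ h₂ F₂ => Hoare.set ?_
      replace F₂ : Frame [13, 14] μ₁ μ₂ := F₂.mono (by simp)
      have d11 : μ₂ 11 0 0 = A := by rw [F₂ 11 (by decide), c11]
      refine ⟨b₁, ?_, s₁, p₁, ?_⟩
      · exact (r₁.frame F₂ (by simp [n'])).frame (Frame.write _ _ _ _ _) (by simp [n'])
      · simp only [Expr.eval, d11, h₂]
        rcases zmod_two_cases (c ⬝ᵥ b₁ (A - 1)) with h | h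
        · refine ⟨A, le_rfl, by simp [h], ?_⟩
          rw [p₁, eq_comm, inf_eq_left, ← p₁]
          refine spn_le fun i hi => ?_
          rcases Nat.lt_or_ge i (A - 1) with h' | h'
          · simpa [mem_perp] using o₁ i h'
          · obtain rfl : i = A - 1 := by omega
            simpa [mem_perp] using h
        · refine ⟨A - 1, by omega, by simp [h, ZMod.val_one], ?_⟩
          rw [← p₁]
          have := spn_eq_inf_perp o₁ h
          rwa [show A - 1 + 1 = A by omega] at this
    · have hA0 : A = 0 := by simpa [Expr.eval, c11] using h11
      subst hA0
      refine ⟨b₁, r₁, s₁, p₁, 0, le_rfl, c11, ?_⟩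
      have e : ∀ b : ℕ → Vec K, spn b 0 = ⊥ := fun b => by simp [spn]
      rw [e, e, bot_inf_eq]

end IQP
namespace IQP

/-! ## Uniform distributions -/

theorem draw_eq_uniformOfFinset {α : Type} [Inhabited α] {S : Set α} {s : Finset α}
    (h : (s : Set α) = S) (hs : s.Nonempty) : draw S = PMF.uniformOfFinset s hs := by
  subst h
  have hc : (s : Set α).Finite ∧ (s : Set α).Nonempty := ⟨s.finite_toSet, hs⟩
  rw [draw, dif_pos hc]
  congr 1
  simp

theorem draw_univ {α : Type} [Inhabited α] [Fintype α] [Nonempty α] :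
    draw (Set.univ : Set α) = PMF.uniformOfFintype α :=
  draw_eq_uniformOfFinset (by simp) Finset.univ_nonempty

theorem draw_empty {α : Type} [Inhabited α] {S : Set α} (h : ¬ S.Nonempty) :
    draw S = PMF.pure default := by
  rw [draw, dif_neg fun h' => h h'.2]
  rfl

theorem support_draw {α : Type} [Inhabited α] {S : Set α} (hf : S.Finite) (h : S.Nonempty) :
    (draw S).support = S := by
  rw [draw, dif_pos ⟨hf, h⟩, PMF.support_uniformOfFinset]
  simp

theorem draw_map {α γ : Type} [Inhabited α] [Inhabited γ] {S : Set α} (hfin : S.Finite)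
    (hne : S.Nonempty) {f : α → γ} (hf : S.InjOn f) : (draw S).map f = draw (f '' S) := by
  classical
  lift S to Finset α using hfin
  have hne' : S.Nonempty := hne
  rw [draw_eq_uniformOfFinset rfl hne',
    draw_eq_uniformOfFinset (s := S.image f) (by simp) (hne'.image f)]
  ext c
  rw [PMF.map_apply, PMF.uniformOfFinset_apply, Finset.card_image_of_injOn hf]
  by_cases hc : c ∈ S.image f
  · obtain ⟨a, ha, rfl⟩ := Finset.mem_image.mp hc
    rw [if_pos hc, tsum_eq_single a]
    · rw [if_pos rfl, PMF.uniformOfFinset_apply, if_pos ha]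
    · intro b hb
      split_ifs with h
      · rw [PMF.uniformOfFinset_apply, if_neg]
        exact fun hb' => hb (hf hb' ha h.symm)
      · rfl
  · rw [if_neg hc, ENNReal.tsum_eq_zero]
    intro b
    split_ifs with h
    · rw [PMF.uniformOfFinset_apply, if_neg]
      exact fun hb' => hc (Finset.mem_image.mpr ⟨b, hb', h.symm⟩)
    · rfl

/-- The machine only produces uniform integers; an injective decoding turns them into uniform draws.
-/
theorem uniform_map_eq_draw {γ : Type} [Inhabited γ] {M : ℕ} {f : Fin (M + 1) → γ} {S : Set γ}
    (hf : Function.Injective f) (hS : Set.range f = S) :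
    (PMF.uniformOfFintype (Fin (M + 1))).map f = draw S := by
  rw [← draw_univ, draw_map Set.finite_univ Set.univ_nonempty hf.injOn, Set.image_univ, hS]

/-! ## Uniform elements of a subspace outside of another one -/

variable {K N : ℕ} {μ : Mem}

/-- The combination of the first `A` vectors of a sequence given by the binary digits of a
number. -/
def comb (b : ℕ → Vec K) : ℕ → ℕ → Vec K
  | 0, _ => 0
  | A + 1, r => if 2 ^ A ≤ r then b A + comb b A (r - 2 ^ A) else comb b A r

theorem comb_zero (b : ℕ → Vec K) (A : ℕ) : comb b A 0 = 0 := by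
  induction A with
  | zero => rfl
  | succ A ih => rw [comb, if_neg (by simp), ih]

theorem comb_mem (b : ℕ → Vec K) (A r : ℕ) : comb b A r ∈ spn b A := by
  induction A generalizing r with
  | zero => exact zero_mem _
  | succ A ih =>
    rw [comb]
    split_ifs
    · exact add_mem (mem_spn (by omega)) (spn_mono (by omega) (ih _))
    · exact spn_mono (by omega) (ih _)

/-- Leading digits of small numbers are zero, so the span of the first `a` vectors corresponds to an
initial segment of the numbers. -/
theorem comb_of_lt (b : ℕ → Vec K) {a A r : ℕ} (h : a ≤ A) (hr : r < 2 ^ a) :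
    comb b A r = comb b a r := by
  induction A, h using Nat.le_induction with
  | base => rfl
  | succ A hA ih =>
    have := Nat.pow_le_pow_right (n := 2) (by omega) hA
    rw [comb, if_neg (by omega), ih]

theorem Indep.notMem {b : ℕ → Vec K} {A : ℕ} (h : Indep b (A + 1)) : b A ∉ spn b A := by
  intro hmem
  have h1 := (indep_iff b (A + 1)).mp h
  have h2 := (indep_iff b A).mp (h.mono (by omega))
  rw [spn_succ, sup_eq_left.mpr (by simpa using hmem), h2] at h1
  omega

/-- If the top digits differed, equal combinations would put the last vector into the span of the
earlier ones. -/
theorem comb_injOn {b : ℕ → Vec K} {A : ℕ} (h : Indep b A) :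
    Set.InjOn (comb b A) (Set.Iio (2 ^ A)) := by
  induction A with
  | zero =>
    intro r hr s hs _
    simp only [pow_zero, Set.mem_Iio] at hr hs
    omega
  | succ A ih =>
    replace ih := ih (h.mono (by omega))
    have key : ∀ r s, comb b A r ≠ b A + comb b A s := fun r s hrs => h.notMem (by
      rw [← sub_eq_iff_eq_add] at hrs
      rw [← hrs]
      exact sub_mem (comb_mem _ _ _) (comb_mem _ _ _))
    intro r hr s hs hrs
    simp only [Set.mem_Iio, pow_succ] at hr hs
    simp only [comb] at hrs
    split_ifs at hrs with h1 h2 h2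
    · have := ih (show r - 2 ^ A < 2 ^ A by omega) (show s - 2 ^ A < 2 ^ A by omega)
        (add_left_cancel hrs)
      omega
    · exact absurd hrs.symm (key _ _)
    · exact absurd hrs (key _ _)
    · exact ih (show r < 2 ^ A by omega) (show s < 2 ^ A by omega) hrs

theorem exists_comb {b : ℕ → Vec K} {A : ℕ} {v : Vec K} (hv : v ∈ spn b A) :
    ∃ r < 2 ^ A, comb b A r = v := by
  induction A generalizing v with
  | zero => exact ⟨0, by simp, by simpa [spn, comb, eq_comm] using hv⟩
  | succ A ih =>
    rw [spn_succ] at hv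
    obtain ⟨u, hu, w, hw, rfl⟩ := Submodule.mem_sup.mp hv
    obtain ⟨c, rfl⟩ := Submodule.mem_span_singleton.mp hw
    obtain ⟨r, hr, rfl⟩ := ih hu
    rcases zmod_two_cases c with rfl | rfl
    · exact ⟨r, by rw [pow_succ]; omega, by rw [comb, if_neg (by omega)]; simp⟩
    · refine ⟨r + 2 ^ A, by rw [pow_succ]; omega, ?_⟩
      rw [comb, if_pos (by omega), Nat.add_sub_cancel, one_smul, add_comm]

/-- In the digit encoding the larger span is [0, 2^A) and the smaller one [0, 2^a). Their difference
is an interval, so one uniform integer suffices and no rejection is needed. -/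
theorem comb_uniform {b : ℕ → Vec K} {a A : ℕ} (h : Indep b A) (ha : a < A) :
    (PMF.uniformOfFintype (Fin (2 ^ A - 2 ^ a - 1 + 1))).map
      (fun r : Fin _ => comb b A (r + 2 ^ a)) =
      draw {v | v ∈ spn b A ∧ v ∉ spn b a} := by
  have hlt : 2 ^ a < 2 ^ A := Nat.pow_lt_pow_right (by omega) ha
  have hr : ∀ r : Fin (2 ^ A - 2 ^ a - 1 + 1), (r : ℕ) + 2 ^ a < 2 ^ A := fun r => by
    have := r.2
    omega
  refine uniform_map_eq_draw (M := 2 ^ A - 2 ^ a - 1)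
    (f := fun r => comb b A (r + 2 ^ a)) ?_ ?_
  · intro r s hrs
    have := comb_injOn h (hr r) (hr s) hrs
    exact Fin.ext (by omega)
  · ext v
    simp only [Set.mem_range, Set.mem_ofPred_eq]
    constructor
    · rintro ⟨r, rfl⟩
      refine ⟨comb_mem _ _ _, fun hmem => ?_⟩
      obtain ⟨s, hs, hs'⟩ := exists_comb hmem
      rw [← comb_of_lt b ha.le hs] at hs'
      have := comb_injOn h (show s < 2 ^ A by omega) (hr r) hs'
      omega
    · rintro ⟨hv, hv'⟩
      obtain ⟨r, hr, rfl⟩ := exists_comb hv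
      have : 2 ^ a ≤ r := by
        by_contra hlt'
        exact hv' (by rw [comb_of_lt b ha.le (by omega)]; exact comb_mem _ _ _)
      exact ⟨⟨r - 2 ^ a, by omega⟩, by simp [Nat.sub_add_cancel this]⟩

/-- The state of an elimination: the array `β` holds a basis of the whole space that starts with
a basis of `W`, the number in the variable 11 being its length, and with a basis of length `A`
of `V`. -/
def Elim (K : ℕ) (μ : Mem) (β A : ℕ) (V W : Submodule (ZMod 2) (Vec K)) : Prop :=
  ∃ (b : ℕ → Vec K) (a : ℕ), a ≤ A ∧ A ≤ K ∧ Rows μ β K b ∧ Indep b K ∧ μ 11 0 0 = a ∧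
    spn b A = V ∧ spn b a = W

theorem Elim.frame {β A : ℕ} {V W : Submodule (ZMod 2) (Vec K)} (h : Elim K μ β A V W)
    {μ' : Mem} {ws : List ℕ} (hF : Frame ws μ μ') (hβ : β ∉ ws) (h11 : 11 ∉ ws) :
    Elim K μ' β A V W := by
  obtain ⟨b, a, h1, h2, h3, h4, h5, h6, h7⟩ := h
  exact ⟨b, a, h1, h2, h3.frame hF hβ, h4, by rw [hF 11 h11, h5], h6, h7⟩

/-- Both subspaces are spanned by initial segments of one basis, so comparing lengths decides
emptiness; programs branch on this difference. -/
theorem Elim.nonempty_iff {β A : ℕ} {V W : Submodule (ZMod 2) (Vec K)} (h : Elim K μ β A V W) :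
    {v | v ∈ V ∧ v ∉ W}.Nonempty ↔ A - μ 11 0 0 ≠ 0 := by
  obtain ⟨b, a, h1, h2, h3, h4, h5, rfl, rfl⟩ := h
  rw [h5]
  constructor
  · rintro ⟨v, hv, hv'⟩ h0
    obtain rfl : a = A := by omega
    exact hv' hv
  · intro h0
    have ha : a < A := by omega
    exact ⟨b a, mem_spn ha, Indep.notMem (h4.mono (by omega))⟩

/-- Store the standard basis in an array. -/
def Prog.init (β : ℕ) : Prog :=
  .seq (.forTo 17 (.var 10) (.seq (.mapRow β (.var 17) (.var 10) (.lit 0))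
    (.set β (.var 17) (.var 17) (.lit 1)))) (.assign 11 (.var 10))

@[simp] theorem Prog.writes_init (β : ℕ) :
    (init β).writes = [17, 13, β, 13, β, 17, 11] := rfl

/-- The standard basis, as a sequence. -/
def unitVec (K i : ℕ) : Vec K := fun j => if (j : ℕ) = i then 1 else 0

theorem spn_unitVec : spn (unitVec K) K = ⊤ := by
  refine eq_top_iff.mpr fun v _ => ?_
  have : v = ∑ j : Fin K, v j • unitVec K j := by
    ext k
    simp [unitVec, Finset.sum_apply, Fin.val_inj]
  rw [this]
  exact sum_mem fun j _ => Submodule.smul_mem _ _ (mem_spn j.2)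

theorem indep_unitVec : Indep (unitVec K) K := by
  rw [indep_iff, spn_unitVec, finrank_top]
  simp

theorem Hoare.init {β : ℕ} (hβ : 30 ≤ β) (hK : μ 10 0 0 = K) (hKN : K ≤ N) :
    Hoare N (.init β) μ fun μ' => Elim K μ' β K ⊤ ⊤ := by
  have m : (10 : ℕ) ≠ β ∧ (11 : ℕ) ≠ β ∧ (13 : ℕ) ≠ β ∧ (17 : ℕ) ≠ β := by omega
  have n' : β ≠ 11 ∧ β ≠ 13 ∧ β ≠ 17 := by omega
  refine Hoare.seq (Hoare.forTo (fun t μ' => Rows μ' β t (unitVec K)) K (by simp [m])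
    (by simp [Expr.avoids, m]) hK hKN (fun i hi => by omega) ?_) ?_
  · intro t ht μ₁ r₁ hv F₁
    replace F₁ : Frame [13, 17, β] μ μ₁ := F₁.mono (by simp)
    refine Hoare.seq (Hoare.mapRow (fun _ => 0) (cnt := K) (by
      simp only [Expr.eval]; rw [F₁ 10 (by simp [m]), hK]) hKN n'.2.1
      (by simp [Expr.avoids, m]) (by simp [Expr.avoids, m]) (fun k _ μ' _ _ _ => rfl))
      fun μ₂ h₂ F₂ => Hoare.set ?_
    replace F₂ : Frame [13, β] μ₁ μ₂ := F₂.mono (by simp)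
    have e17 : μ₂ 17 0 0 = t := by rw [F₂ 17 (by simp [m]), hv]
    simp only [Expr.eval, hv] at h₂
    simp only [Expr.eval, e17]
    intro i hi j
    simp only [Mem.write_apply, n', false_and, if_false, true_and, h₂, unitVec]
    by_cases h1 : i = t
    · subst h1
      by_cases h3 : (j : ℕ) = i
      · simp [h3, ZMod.val_one]
      · simp [h3]
    · rw [if_neg (by omega), if_neg (by omega), r₁ i (by omega) j]
      rfl
  · intro μ₁ h₁ F₁
    replace F₁ : Frame [13, 17, β] μ μ₁ := F₁.mono (by simp)
    refine Hoare.set ?_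
    refine ⟨unitVec K, K, le_rfl, le_rfl, h₁.frame (Frame.write _ _ _ _ _) (by simp [n']),
      indep_unitVec, ?_, spn_unitVec, spn_unitVec⟩
    simp only [Expr.eval, Mem.write_apply, and_self, if_true]
    rw [F₁ 10 (by simp [m]), hK]

/-- Consecutive rows of an array hold the vectors of a list. -/
def RowList (μ : Mem) (x lo : ℕ) (L : List (Vec K)) : Prop :=
  ∀ (i : ℕ) (h : i < L.length), Row μ x (lo + i) L[i]

theorem RowList.frame {μ' : Mem} {x lo : ℕ} {L : List (Vec K)} (h : RowList μ x lo L) {ws : List ℕ}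
    (hF : Frame ws μ μ') (hx : x ∉ ws) : RowList μ' x lo L := fun i hi => (h i hi).frame hF hx

/-- Consecutive elimination steps for several rows of an array. -/
def Prog.reduceRange (x : ℕ) (lo n : Expr) (β : ℕ) : Prog :=
  .forTo 17 n (.reduce x (.add lo (.var 17)) β)

theorem Prog.writes_reduceRange (x : ℕ) (lo n : Expr) (β : ℕ) :
    (reduceRange x lo n β).writes ⊆ 17 :: elimVars β := by
  have := writes_reduce x (.add lo (.var 17)) β
  intro y hy
  simp only [reduceRange, writes_forTo, List.mem_cons, List.mem_append, List.not_mem_nil,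
    or_false] at hy
  rcases hy with h | h | h
  · simp [h]
  · exact List.mem_cons_of_mem _ (this h)
  · simp [h]

theorem Hoare.reduceRange {x β A : ℕ} {lo n : Expr} {L : List (Vec K)}
    {V W : Submodule (ZMod 2) (Vec K)} (hβ : 30 ≤ β)
    (hx : 30 ≤ x) (hxβ : x ≠ β) (hK : μ 10 0 0 = K) (hKN : K ≤ N)
    (hlo : lo.avoids (17 :: elimVars β) = true) (hn : n.avoids (17 :: elimVars β) = true)
    (hnL : n.eval μ = L.length) (hLN : L.length ≤ N) (hL : RowList μ x (lo.eval μ) L)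
    (hE : Elim K μ β A V W) :
    Hoare N (.reduceRange x lo n β) μ fun μ' => Elim K μ' β A V (W ⊓ perp L) := by
  have m : (10 : ℕ) ≠ β ∧ (11 : ℕ) ≠ β ∧ (13 : ℕ) ≠ β ∧ (14 : ℕ) ≠ β ∧ (15 : ℕ) ≠ β ∧
    (17 : ℕ) ≠ β ∧ (28 : ℕ) ≠ β := by omega
  have m' : x ≠ 11 ∧ x ≠ 13 ∧ x ≠ 14 ∧ x ≠ 15 ∧ x ≠ 17 ∧ x ≠ 28 := by omega
  have hw := Prog.writes_reduce x (.add lo (.var 17)) β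
  have hw' : (17 :: (Prog.reduce x (.add lo (.var 17)) β).writes) ⊆ 17 :: elimVars β :=
    List.cons_subset_cons _ hw
  refine (Hoare.forTo (fun t μ' => Elim K μ' β A V (W ⊓ perp (L.take t))) L.length ?_
    (Expr.avoids_mono hw' hn) hnL hLN ?_ ?_).conseq ?_
  · exact fun h => absurd (hw h) (by simp [m])
  · simpa using hE.frame (Frame.write μ 17 0 0 0) (by simp; omega) (by simp)
  · intro t ht μ₁ hE₁ hv F₁
    replace F₁ : Frame (17 :: elimVars β) μ μ₁ := F₁.mono hw'
    have e1 : lo.eval μ₁ = lo.eval μ := F₁.eval hlo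
    obtain ⟨b, a, h1, h2, h3, h4, h5, h6, h7⟩ := hE₁
    refine (Hoare.reduce (P := K) (A := a) (c := L[t]) hβ hx hxβ (by rw [F₁ 10 (by simp [m]), hK])
      hKN ?_ h5 (h1.trans h2) hKN ?_ h3).conseq ?_
    · simp [Expr.avoids, Expr.avoids_mono (List.subset_cons_self _ _) hlo, m]
    · simp only [Expr.eval, e1, hv]
      exact (hL t ht).frame F₁ (by simp [m', hxβ])
    · rintro μ₂ ⟨b', r', s', p', A', hA', e11, q'⟩ _
      refine ⟨b', A', hA'.trans h1, h2, ?_, ?_, ?_, ?_, ?_⟩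
      · exact r'.frame (Frame.write _ _ _ _ _) (by simp; omega)
      -- The first `a` vectors keep their span and the others are untouched, so the array still
      -- holds a basis of the whole space.
      · exact h4.congr (spn_congr (h1.trans h2) p' s')
      · simpa using e11
      · rw [← h6]
        exact spn_congr h1 p' s'
      · rw [q', h7, inf_assoc, ← perp_append, List.take_concat_get' L t ht]
  · intro μ' h _
    simpa using h

end IQP
namespace IQP

/-! ### Drawing from a difference of subspaces by binary digits. -/

variable {K N : ℕ} {μ : Mem}

/-- Sample a combination of the vectors in an array: of the first ones, up to the number in the
variable 12, but not only of those up to the number in the variable 11. The result is stored in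
array 33; it is zero if there is no such combination. -/
def Prog.pick (β : ℕ) : Prog :=
  .seq (.set 29 (.lit 0) (.lit 0) (.lit 1)) (.seq
  (.forTo 18 (.var 12) (.set 29 (.lit 0) (.add (.var 18) (.lit 1))
    (.add (.cell 29 (.lit 0) (.var 18)) (.cell 29 (.lit 0) (.var 18))))) (.seq
  (.mapRow 33 (.lit 0) (.var 10) (.lit 0)) (.seq
  (.cond (.sub (.var 12) (.var 11))
    (.seq
      (.rand 19 (.lit 0) (.lit 0) (.sub (.sub (.cell 29 (.lit 0) (.var 12))
        (.cell 29 (.lit 0) (.var 11))) (.lit 1)))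
      (.assign 19 (.add (.var 19) (.cell 29 (.lit 0) (.var 11)))))
    (.assign 19 (.lit 0)))
  (.forTo 18 (.var 12)
    (.cond (.sub (.add (.var 19) (.lit 1))
        (.cell 29 (.lit 0) (.sub (.sub (.var 12) (.lit 1)) (.var 18))))
      (.seq
        (.assign 19 (.sub (.var 19) (.cell 29 (.lit 0) (.sub (.sub (.var 12) (.lit 1)) (.var 18)))))
        (.xorRow 33 (.lit 0) β (.sub (.sub (.var 12) (.lit 1)) (.var 18))))
      .skip)))))

theorem Prog.writes_pick (β : ℕ) : (pick β).writes ⊆ [13, 18, 19, 29, 33] := by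
  simp [pick]

/-- Powers of two are produced by doubling, as expressions contain no multiplication. -/
theorem Hoare.powers {A : ℕ} (hA : μ 12 0 0 = A) (hAN : A ≤ N) (h29 : μ 29 0 0 = 1) :
    Hoare N (.forTo 18 (.var 12) (.set 29 (.lit 0) (.add (.var 18) (.lit 1))
      (.add (.cell 29 (.lit 0) (.var 18)) (.cell 29 (.lit 0) (.var 18))))) μ
      fun μ' => ∀ i ≤ A, μ' 29 0 i = 2 ^ i := by
  refine Hoare.forTo (fun t μ' => ∀ i ≤ t, μ' 29 0 i = 2 ^ i) A (by simp) rfl hA hAN ?_ ?_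
  · simp [h29]
  · intro t ht μ₁ h₁ hv F₁
    refine Hoare.set fun i hi => ?_
    simp only [Expr.eval, hv, Mem.write_apply, h₁ t le_rfl]
    by_cases h : i = t + 1
    · simp [h, pow_succ]; omega
    · simpa [h] using h₁ i (by omega)

/-- Digits are read from the top. Throughout, the partial sum plus the combination encoded by the
remaining number equals the target. -/
theorem Hoare.digits {β A r : ℕ} {b : ℕ → Vec K} (hβ : 30 ≤ β) (hβ' : β ≠ 33)
    (hK : μ 10 0 0 = K) (hKN : K ≤ N)
    (hA : μ 12 0 0 = A) (hAK : A ≤ K) (hpow : ∀ i ≤ A, μ 29 0 i = 2 ^ i) (hr : μ 19 0 0 = r)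
    (h0 : Row μ 33 0 (0 : Vec K)) (hb : Rows μ β K b) :
    Hoare N (.forTo 18 (.var 12)
    (.cond (.sub (.add (.var 19) (.lit 1))
        (.cell 29 (.lit 0) (.sub (.sub (.var 12) (.lit 1)) (.var 18))))
      (.seq
        (.assign 19 (.sub (.var 19) (.cell 29 (.lit 0) (.sub (.sub (.var 12) (.lit 1)) (.var 18)))))
        (.xorRow 33 (.lit 0) β (.sub (.sub (.var 12) (.lit 1)) (.var 18))))
      .skip)) μ fun μ' => Row μ' 33 0 (comb b A r) := by
  have n' : β ≠ 13 ∧ β ≠ 18 ∧ β ≠ 19 := by omega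
  refine (Hoare.forTo (fun t μ' => ∃ (v : Vec K) (s : ℕ), Row μ' 33 0 v ∧ μ' 19 0 0 = s ∧
    v + comb b (A - t) s = comb b A r) A (by simp) rfl (by exact hA) (hAK.trans hKN) ?_ ?_).conseq ?_
  · refine ⟨0, r, ?_, ?_, by simp⟩
    · exact h0.frame (Frame.write μ 18 0 0 0) (by simp)
    · simp [hr]
  · rintro t ht μ₁ ⟨v, s, hv, hs, hvs⟩ h18 F₁
    replace F₁ : Frame [13, 18, 19, 33] μ μ₁ := F₁.mono (by simp)
    have c12 : μ₁ 12 0 0 = A := by rw [F₁ 12 (by simp), hA]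
    have c10 : μ₁ 10 0 0 = K := by rw [F₁ 10 (by simp), hK]
    have c29 : μ₁ 29 0 (A - 1 - t) = 2 ^ (A - 1 - t) := by
      rw [F₁ 29 (by simp), hpow _ (by omega)]
    have e : A - t = (A - 1 - t) + 1 := by omega
    have e' : A - (t + 1) = A - 1 - t := by omega
    rw [e, comb] at hvs
    have hrow : Row μ₁ β (A - 1 - t) (b (A - 1 - t)) :=
      (hb _ (by omega)).frame F₁ (by simp [n', hβ'])
    -- With j = A - 1 - t, the truncated difference (s + 1) - 2^j is nonzero iff 2^j ≤ s, that is,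
    -- iff digit j is set.
    refine Sim.cond (fun h => ?_) fun h => Hoare.skip ?_
    · simp only [Expr.eval, hs, c12, h18, c29] at h
      rw [if_pos (by omega)] at hvs
      refine Hoare.set_seq ?_
      refine (Hoare.xorRow (v := v) (w := b (A - 1 - t)) ?_ hKN (by simp) n'.1 rfl rfl ?_ ?_
        (by omega)).conseq ?_
      · simpa using c10
      · exact hv.frame (Frame.write _ _ _ _ _) (by simp)
      · simp only [Expr.eval, Mem.write_apply, hs, c12, h18, c29]
        simpa using hrow.frame (Frame.write _ _ _ _ _) (by simp [n'])
      · intro μ₂ h₂ F₂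
        refine ⟨v + b (A - 1 - t), s - 2 ^ (A - 1 - t), ?_, ?_, ?_⟩
        · exact Row.frame h₂.1 (Frame.write _ _ _ _ _) (by simp)
        · simp only [Mem.write_apply]
          rw [if_neg (by simp), F₂ 19 (by simp)]
          simp [Expr.eval, hs, c12, h18, c29]
        · rw [e', ← hvs]
          abel
    · simp only [Expr.eval, hs, c12, h18, c29] at h
      rw [if_neg (by omega)] at hvs
      refine ⟨v, s, ?_, ?_, ?_⟩
      · exact hv.frame (Frame.write _ _ _ _ _) (by simp)
      · simpa using hs
      · rw [e', hvs]
  · rintro μ' ⟨v, s, hv, _, hvs⟩ _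
    rw [← hvs]
    simpa [comb] using hv

theorem Sim.pick {β A : ℕ} {V W : Submodule (ZMod 2) (Vec K)} (hβ : 30 ≤ β) (hβ' : β ≠ 33)
    (hK : μ 10 0 0 = K) (hKN : K ≤ N) (hA : μ 12 0 0 = A) (hE : Elim K μ β A V W) :
    Sim N (.pick β) μ (draw {v | v ∈ V ∧ v ∉ W}) fun v μ' => Row μ' 33 0 v := by
  have hE' := hE.nonempty_iff
  obtain ⟨b, a, h1, h2, h3, h4, h5, rfl, rfl⟩ := hE
  rw [h5] at hE'
  have n' : β ≠ 13 ∧ β ≠ 18 ∧ β ≠ 19 ∧ β ≠ 29 := by omega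
  refine Hoare.set_seq ?_
  refine Hoare.seq_sim (Hoare.powers (A := A) (by simpa using hA) (h2.trans hKN) (by simp [Expr.eval]))
    fun μ₁ h₁ F₁ => ?_
  replace F₁ : Frame [13, 18, 19, 29] μ μ₁ :=
    ((Frame.write μ 29 0 0 1).mono (by simp)).trans (F₁.mono (by simp))
  refine Hoare.seq_sim (Hoare.mapRow (fun _ => 0) (cnt := K)
    (by simp only [Expr.eval]; rw [F₁ 10 (by simp), hK]) hKN
    (by simp) rfl rfl (fun k _ μ' _ _ _ => rfl)) fun μ₂ h₂ F₂ => ?_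
  have G₂ : Frame [13, 33] μ₁ μ₂ := F₂.mono (by simp)
  replace F₂ : Frame [13, 18, 19, 29, 33] μ μ₂ := (F₁.mono (by simp)).trans (F₂.mono (by simp))
  have z₂ : Row μ₂ 33 0 (0 : Vec K) := fun k => by simp [h₂, Expr.eval]
  have p₂ : ∀ i ≤ A, μ₂ 29 0 i = 2 ^ i := fun i hi => by rw [G₂ 29 (by simp), h₁ i hi]
  have fin : ∀ (r : ℕ) (μ' : Mem), μ' 19 0 0 = r → Frame [19] μ₂ μ' →
      Hoare N _ μ' fun μ'' => Row μ'' 33 0 (comb b A r) := fun r μ' hr F => by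
    have F' : Frame [13, 18, 19, 29, 33] μ μ' := F₂.trans (F.mono (by simp))
    exact Hoare.digits hβ hβ' (by rw [F' 10 (by simp), hK]) hKN (by rw [F' 12 (by simp), hA]) h2
      (fun i hi => by rw [F 29 (by simp), p₂ i hi]) hr (z₂.frame F (by simp))
      (h3.frame F' (by simp [n', hβ']))
  by_cases ha : a < A
  · have hc : (Expr.sub (.sub (.cell 29 (.lit 0) (.var 12)) (.cell 29 (.lit 0) (.var 11)))
        (.lit 1)).eval μ₂ = 2 ^ A - 2 ^ a - 1 := by
      simp only [Expr.eval]
      rw [F₂ 12 (by simp), hA, F₂ 11 (by simp), h5, p₂ A le_rfl, p₂ a ha.le]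
    have hd := comb_uniform (Indep.mono h4 h2) ha
    -- The sample type of `Sim.rand` mentions the evaluated bound, so the uniform law is restated
    -- over that expression.
    rw [← hc] at hd
    rw [← hd]
    refine Sim.map (Q := fun (r : Fin _) μ' => Row μ' 33 0 (comb b A (r + 2 ^ a)))
      (fun r : Fin _ => comb b A (r + 2 ^ a)) ?_ fun r _ μ' h _ => h
    refine Sim.seq_hoare (Q := fun (r : Fin _) μ' => μ' 19 0 0 = r + 2 ^ a ∧ Frame [19] μ₂ μ')
      (Sim.cond (fun _ => ?_) fun h => ?_) ?_
    · refine Sim.seq_hoare (Q := fun (r : Fin _) μ' => μ' 19 0 0 = r) (Sim.rand fun r => ?_) ?_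
      · simp [Expr.eval]
      · intro r _ μ' hr F
        replace F : Frame [19] μ₂ μ' := F.mono (by simp)
        refine Hoare.set ⟨?_, F.trans (Frame.write _ _ _ _ _)⟩
        simp only [Expr.eval, hr, Mem.write_apply, and_self, if_true]
        rw [F 11 (by simp), F 29 (by simp)]
        have e : μ₂ 29 0 (μ₂ 11 0 0) = 2 ^ a := by rw [F₂ 11 (by simp), h5, p₂ a ha.le]
        exact congrArg (_ + ·) e
    · simp only [Expr.eval] at h
      rw [F₂ 12 (by simp), hA, F₂ 11 (by simp), h5] at h
      omega
    · exact fun r _ μ' h _ => fin _ μ' h.1 h.2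
  -- A draw from the empty set returns the default vector 0; the program agrees by decoding the
  -- number 0.
  · rw [draw_empty (by rw [hE']; omega)]
    refine Hoare.sim_pure (Q := fun v μ' => Row μ' 33 0 v) default ?_
    refine Hoare.seq (Q := fun μ' => μ' 19 0 0 = 0 ∧ Frame [19] μ₂ μ')
      (Sim.cond (fun h => ?_) fun _ => Hoare.set ⟨?_, Frame.write _ _ _ _ _⟩) ?_
    · simp only [Expr.eval] at h
      rw [F₂ 12 (by simp), hA, F₂ 11 (by simp), h5] at h
      omega
    · simp [Expr.eval]
    · intro μ' h _
      have := fin 0 μ' h.1 h.2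
      rwa [comb_zero] at this

end IQP
namespace IQP

/-! ## Sampling vectors that satisfy linear constraints -/

variable {K N : ℕ} {μ : Mem}

/-- A range of rows of an array. -/
structure Rng where
  arr : ℕ
  lo : Expr
  cnt : Expr

/-- A range of rows that is not affected by writing to some arrays. -/
def Rng.ok (ws : List ℕ) (r : Rng) : Bool :=
  decide (31 ≤ r.arr) && !ws.contains r.arr && r.lo.avoids ws && r.cnt.avoids ws

theorem Rng.ok_iff {ws : List ℕ} {r : Rng} : r.ok ws = true ↔
    31 ≤ r.arr ∧ r.arr ∉ ws ∧ r.lo.avoids ws = true ∧ r.cnt.avoids ws = true := by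
  simp [Rng.ok, and_assoc]

theorem Rng.ok_mono {ws ws' : List ℕ} (h : ws' ⊆ ws) {r : Rng} (hr : r.ok ws = true) :
    r.ok ws' = true := by
  rw [ok_iff] at *
  exact ⟨hr.1, fun h' => hr.2.1 (h h'), Expr.avoids_mono h hr.2.2.1, Expr.avoids_mono h hr.2.2.2⟩

/-- A range of rows holds the vectors of a list. -/
def Rng.Holds (N : ℕ) (μ : Mem) (r : Rng) (L : List (Vec K)) : Prop :=
  r.cnt.eval μ = L.length ∧ RowList μ r.arr (r.lo.eval μ) L ∧ L.length ≤ N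

theorem Rng.Holds.frame {r : Rng} {L : List (Vec K)} (h : r.Holds N μ L) {ws : List ℕ}
    (hr : r.ok ws = true) {μ' : Mem} (hF : Frame ws μ μ') : r.Holds N μ' L := by
  rw [ok_iff] at hr
  refine ⟨by rw [hF.eval hr.2.2.2, h.1], ?_, h.2.2⟩
  rw [hF.eval hr.2.2.1]
  exact h.2.1.frame hF hr.2.1

/-- Elimination steps for all rows of a range. -/
def Prog.reduceRng (r : Rng) (β : ℕ) : Prog := .reduceRange r.arr r.lo r.cnt β

/-- The arrays and variables written to by `Prog.prep`. -/
abbrev prepVars (β : ℕ) : List ℕ := [11, 12, 13, 14, 15, 17, 28, β]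

theorem Prog.writes_reduceRng (r : Rng) (β : ℕ) : (reduceRng r β).writes ⊆ prepVars β := by
  refine List.Subset.trans (writes_reduceRange _ _ _ _) ?_
  simp

theorem Hoare.reduceRng {β A : ℕ} {r : Rng} {L : List (Vec K)}
    {V W : Submodule (ZMod 2) (Vec K)} (hβ : 30 ≤ β) (hr : r.ok (prepVars β) = true)
    (hK : μ 10 0 0 = K) (hKN : K ≤ N) (hL : r.Holds N μ L) (hE : Elim K μ β A V W) :
    Hoare N (.reduceRng r β) μ fun μ' => Elim K μ' β A V (W ⊓ perp L) := by
  have h := Rng.ok_iff.mp hr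
  have hs : 17 :: elimVars β ⊆ prepVars β := by simp
  refine Hoare.reduceRange hβ (by omega) (fun e => h.2.1 (by simp [e])) hK hKN
    (Expr.avoids_mono hs h.2.2.1) (Expr.avoids_mono hs h.2.2.2) hL.1 hL.2.2 hL.2.1 hE

/-- Elimination for the vectors orthogonal to the rows of two ranges. -/
def Prog.basis (r₁ r₂ : Rng) (β : ℕ) : Prog :=
  .seq (.init β) (.seq (.reduceRng r₁ β) (.reduceRng r₂ β))

theorem Prog.writes_basis (r₁ r₂ : Rng) (β : ℕ) : (basis r₁ r₂ β).writes ⊆ prepVars β := by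
  have h1 := writes_reduceRng r₁ β
  have h2 := writes_reduceRng r₂ β
  intro x
  simp only [basis, writes, List.mem_append]
  rintro (h | h | h)
  · revert h
    simp
    omega
  · exact h1 h
  · exact h2 h

/-- The surviving span becomes the new outer space, so that later constraints cut out a subspace of
it. -/
theorem Elim.shrink {β A : ℕ} {V W : Submodule (ZMod 2) (Vec K)} (h : Elim K μ β A V W) :
    Elim K μ β (μ 11 0 0) W W := by
  obtain ⟨b, a, h1, h2, h3, h4, h5, h6, h7⟩ := h
  rw [h5]
  exact ⟨b, a, le_rfl, h1.trans h2, h3, h4, h5, h7, h7⟩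

theorem Hoare.basis {β : ℕ} {r₁ r₂ : Rng} {L₁ L₂ : List (Vec K)} (hβ : 30 ≤ β)
    (hr₁ : r₁.ok (prepVars β) = true) (hr₂ : r₂.ok (prepVars β) = true)
    (hK : μ 10 0 0 = K) (hKN : K ≤ N) (h₁ : r₁.Holds N μ L₁) (h₂ : r₂.Holds N μ L₂) :
    Hoare N (.basis r₁ r₂ β) μ fun μ' =>
      Elim K μ' β (μ' 11 0 0) (perp L₁ ⊓ perp L₂) (perp L₁ ⊓ perp L₂) := by
  have m : 10 ∉ prepVars β := by simp; omega
  refine Hoare.seq (Hoare.init hβ hK hKN) fun μ₁ e₁ F₁ => ?_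
  replace F₁ : Frame (prepVars β) μ μ₁ := F₁.mono (by simp)
  refine Hoare.seq (Hoare.reduceRng hβ hr₁ (by rw [F₁ 10 m, hK]) hKN (h₁.frame hr₁ F₁) e₁)
    fun μ₂ e₂ F₂ => ?_
  replace F₂ : Frame (prepVars β) μ μ₂ := F₁.trans (F₂.mono (Prog.writes_reduceRng _ _))
  refine (Hoare.reduceRng hβ hr₂ (by rw [F₂ 10 m, hK]) hKN (h₂.frame hr₂ F₂) e₂).conseq
    fun μ₃ e₃ F₃ => ?_
  rw [top_inf_eq] at e₃
  exact e₃.shrink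

/-- Prepare the sampling of a vector that is orthogonal to the rows of two ranges but not to those
of a third one. -/
def Prog.prep (r₁ r₂ r₃ : Rng) : Prog :=
  .seq (.basis r₁ r₂ 30) (.seq (.assign 12 (.var 11)) (.reduceRng r₃ 30))

theorem Prog.writes_prep (r₁ r₂ r₃ : Rng) : (prep r₁ r₂ r₃).writes ⊆ prepVars 30 := by
  have h1 := writes_basis r₁ r₂ 30
  have h2 := writes_reduceRng r₃ 30
  intro x
  simp only [prep, writes, List.mem_append, List.mem_singleton]
  rintro (h | rfl | h)
  · exact h1 h
  · simp
  · exact h2 h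

/-- The memory is ready for sampling elements of `V` outside of `W`. -/
def Ready (K : ℕ) (μ : Mem) (V W : Submodule (ZMod 2) (Vec K)) : Prop :=
  Elim K μ 30 (μ 12 0 0) V W

theorem Ready.nonempty_iff {V W : Submodule (ZMod 2) (Vec K)} (h : Ready K μ V W) :
    (Expr.sub (.var 12) (.var 11)).eval μ ≠ 0 ↔ {v | v ∈ V ∧ v ∉ W}.Nonempty :=
  (Elim.nonempty_iff h).symm

/-- Copying the length to the variable 12 freezes V; the remaining eliminations only shorten the
segment that spans W. -/
theorem Hoare.prep {r₁ r₂ r₃ : Rng} {L₁ L₂ L₃ : List (Vec K)}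
    (hr₁ : r₁.ok (prepVars 30) = true) (hr₂ : r₂.ok (prepVars 30) = true)
    (hr₃ : r₃.ok (prepVars 30) = true)
    (hK : μ 10 0 0 = K) (hKN : K ≤ N) (h₁ : r₁.Holds N μ L₁) (h₂ : r₂.Holds N μ L₂)
    (h₃ : r₃.Holds N μ L₃) :
    Hoare N (.prep r₁ r₂ r₃) μ fun μ' =>
      Ready K μ' (perp L₁ ⊓ perp L₂) (perp L₁ ⊓ perp L₂ ⊓ perp L₃) := by
  refine Hoare.seq (Hoare.basis (by omega) hr₁ hr₂ hK hKN h₁ h₂) fun μ₁ e₁ F₁ => ?_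
  replace F₁ : Frame (prepVars 30) μ μ₁ := F₁.mono (Prog.writes_basis _ _ _)
  have G : Frame [12] μ₁ (μ₁.write 12 0 0 (μ₁ 11 0 0)) := Frame.write _ _ _ _ _
  have F₂ := F₁.trans (G.mono (by simp))
  refine Hoare.set_seq ((Hoare.reduceRng (by omega) hr₃ ((congrFun₂ (F₂ 10 (by simp)) 0 0).trans hK) hKN
    (h₃.frame hr₃ F₂) (e₁.frame G (by simp) (by simp))).conseq fun μ₃ e₃ F₃ => ?_)
  have : μ₃ 12 0 0 = μ₁ 11 0 0 := by
    rw [F₃.mono (Prog.writes_reduceRange _ _ _ _) 12 (by simp)]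
    simp
  rwa [Ready, this]

/-- Prepare the sampling of a vector that is orthogonal to the rows of two ranges but outside of
the span of those of a third one. -/
def Prog.prepNot (r₁ r₂ r₃ : Rng) : Prog :=
  .seq (.init 31) (.seq (.reduceRng r₃ 31) (.seq (.assign 20 (.var 11))
    (.prep r₁ r₂ ⟨31, .lit 0, .var 20⟩)))

/-- The arrays and variables written to by the sampling programs. -/
abbrev drawVars : List ℕ := [11, 12, 13, 14, 15, 17, 18, 19, 20, 28, 29, 30, 31, 33]

theorem Prog.writes_prepNot (r₁ r₂ r₃ : Rng) :
    (prepNot r₁ r₂ r₃).writes ⊆ [11, 12, 13, 14, 15, 17, 20, 28, 30, 31] := by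
  have h1 := writes_prep r₁ r₂ ⟨31, .lit 0, .var 20⟩
  have h2 := writes_reduceRng r₃ 31
  intro x
  simp only [prepNot, writes, List.mem_append, List.mem_singleton]
  rintro (h | h | rfl | h)
  · revert h; simp; omega
  · have := h2 h; revert this; simp; omega
  · simp
  · have := h1 h; revert this; simp; omega

/-- Some functional kills the span but not `v`; it is the inner product with the vector of its
values on the standard basis. -/
theorem exists_perp {L : List (Vec K)} {v : Vec K} (hv : v ∉ spanOf L) :
    ∃ c ∈ perp L, c ⬝ᵥ v = 1 := by
  obtain ⟨f, hf, hL⟩ := Submodule.exists_le_ker_of_notMem hv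
  have key : ∀ w : Vec K, (fun i => f (Pi.single i 1)) ⬝ᵥ w = f w := fun w => by
    conv_rhs => rw [← Finset.univ_sum_single w, map_sum]
    refine Finset.sum_congr rfl fun i _ => ?_
    have : Pi.single i (w i) = w i • (Pi.single i 1 : Vec K) := by
      rw [← Pi.single_smul, smul_eq_mul, mul_one]
    rw [this, map_smul, smul_eq_mul, mul_comm]
  refine ⟨fun i => f (Pi.single i 1), fun c hc => ?_, ?_⟩
  · rw [dotProduct_comm, key]
    exact hL (Submodule.subset_span hc)
  · rw [key]
    exact (zmod_two_cases _).resolve_left hf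

/-- Double orthogonality. It turns membership in a span into linear equations, which elimination can
handle. -/
theorem perp_map_range {b : ℕ → Vec K} {a : ℕ} {L : List (Vec K)} (h : spn b a = perp L) :
    perp ((List.range a).map b) = spanOf L := by
  ext v
  have h1 : v ∈ perp ((List.range a).map b) ↔ ∀ c ∈ perp L, c ⬝ᵥ v = 0 := by
    rw [← h]
    constructor
    · intro hv c hc
      have : spn b a ≤ perp [v] := spn_le fun i hi => by
        simpa [mem_perp, dotProduct_comm v] using hv (b i) (by simpa using ⟨i, hi, rfl⟩)
      simpa [mem_perp, dotProduct_comm v] using this hc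
    · intro hv c hc
      obtain ⟨i, hi, rfl⟩ := List.mem_map.mp hc
      exact hv _ (mem_spn (by simpa using hi))
  rw [h1]
  constructor
  · intro hv
    by_contra hn
    obtain ⟨c, hc, hc'⟩ := exists_perp hn
    rw [hv c hc] at hc'
    exact zero_ne_one hc'
  · intro hv c hc
    have : spanOf L ≤ perp [c] := Submodule.span_le.mpr fun w hw => by
      simpa [mem_perp, dotProduct_comm c] using hc w hw
    simpa [mem_perp] using this hv

theorem Hoare.prepNot {r₁ r₂ r₃ : Rng} {L₁ L₂ L₃ : List (Vec K)}
    (hr₁ : r₁.ok drawVars = true) (hr₂ : r₂.ok drawVars = true) (hr₃ : r₃.ok drawVars = true)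
    (hK : μ 10 0 0 = K) (hKN : K ≤ N) (h₁ : r₁.Holds N μ L₁) (h₂ : r₂.Holds N μ L₂)
    (h₃ : r₃.Holds N μ L₃) :
    Hoare N (.prepNot r₁ r₂ r₃) μ fun μ' =>
      Ready K μ' (perp L₁ ⊓ perp L₂) (perp L₁ ⊓ perp L₂ ⊓ spanOf L₃) := by
  refine Hoare.seq (Hoare.init (by omega) hK hKN) fun μ₁ e₁ F₁ => ?_
  replace F₁ : Frame drawVars μ μ₁ := F₁.mono (by simp)
  refine Hoare.seq (Hoare.reduceRng (by omega) (Rng.ok_mono (by simp) hr₃)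
    (by rw [F₁ 10 (by simp), hK]) hKN (h₃.frame hr₃ F₁) e₁) fun μ₂ e₂ F₂ => ?_
  replace F₂ : Frame drawVars μ μ₂ := F₁.trans (F₂.mono
    (List.Subset.trans (Prog.writes_reduceRng _ _) (by simp)))
  have G : Frame [20] μ₂ (μ₂.write 20 0 0 (μ₂ 11 0 0)) := Frame.write _ _ _ _ _
  have F₃ := F₂.trans (G.mono (by simp))
  obtain ⟨b, a, ha, -, hb, -, h11, -, hW⟩ := e₂.frame G (by simp) (by simp)
  rw [top_inf_eq] at hW
  -- The first rows of array 31 are a basis of the orthogonal space of `L₃` and serve as the third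
  -- range of constraints.
  rw [← perp_map_range hW]
  have haK : a ≤ K := by assumption
  have h11' : μ₂ 11 0 0 = a := by simpa using h11
  refine Hoare.set_seq (Hoare.prep (Rng.ok_mono (by simp) hr₁) (Rng.ok_mono (by simp) hr₂) rfl
    ?_ hKN (h₁.frame hr₁ F₃) (h₂.frame hr₂ F₃) ⟨?_, ?_, ?_⟩)
  · exact (congrFun₂ (F₃ 10 (by simp)) 0 0).trans hK
  · simp [Expr.eval, h11']
  · intro i hi
    simp only [List.length_map, List.length_range] at hi
    simpa [Expr.eval] using hb i (by omega)
  · simpa using haK.trans hKN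

/-- Sample a vector that is orthogonal to the rows of two ranges but not to those of a third
one. -/
def Prog.drawTest (r₁ r₂ r₃ : Rng) : Prog := .seq (.prep r₁ r₂ r₃) (.pick 30)

/-- Sample a vector that is orthogonal to the rows of two ranges but outside of the span of those
of a third one. -/
def Prog.drawNot (r₁ r₂ r₃ : Rng) : Prog := .seq (.prepNot r₁ r₂ r₃) (.pick 30)

theorem Prog.writes_drawTest (r₁ r₂ r₃ : Rng) : (drawTest r₁ r₂ r₃).writes ⊆ drawVars := by
  have h1 := writes_prep r₁ r₂ r₃
  have h2 := writes_pick 30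
  intro x
  simp only [drawTest, writes, List.mem_append]
  rintro (h | h)
  · have := h1 h; revert this; simp; omega
  · have := h2 h; revert this; simp; omega

theorem Prog.writes_drawNot (r₁ r₂ r₃ : Rng) : (drawNot r₁ r₂ r₃).writes ⊆ drawVars := by
  have h1 := writes_prepNot r₁ r₂ r₃
  have h2 := writes_pick 30
  intro x
  simp only [drawNot, writes, List.mem_append]
  rintro (h | h)
  · have := h1 h; revert this; simp; omega
  · have := h2 h; revert this; simp; omega

theorem Ready.sim_pick {V W : Submodule (ZMod 2) (Vec K)} (h : Ready K μ V W)
    (hK : μ 10 0 0 = K) (hKN : K ≤ N) {S : Set (Vec K)} (hS : ∀ v, v ∈ S ↔ v ∈ V ∧ v ∉ W) :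
    Sim N (.pick 30) μ (draw S) fun v μ' => Row μ' 33 0 v := by
  obtain rfl : S = {v | v ∈ V ∧ v ∉ W} := Set.ext hS
  exact Sim.pick (by omega) (by omega) hK hKN rfl h

theorem Sim.drawTest {r₁ r₂ r₃ : Rng} {L₁ L₂ L₃ : List (Vec K)}
    (hr₁ : r₁.ok drawVars = true) (hr₂ : r₂.ok drawVars = true) (hr₃ : r₃.ok drawVars = true)
    (hK : μ 10 0 0 = K) (hKN : K ≤ N) (h₁ : r₁.Holds N μ L₁) (h₂ : r₂.Holds N μ L₂)
    (h₃ : r₃.Holds N μ L₃) {S : Set (Vec K)}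
    (hS : ∀ v, v ∈ S ↔ v ∈ orthTo (L₁ ++ L₂) ∧ v ∉ orthTo L₃) :
    Sim N (.drawTest r₁ r₂ r₃) μ (draw S) fun v μ' => Row μ' 33 0 v := by
  refine Hoare.seq_sim (Hoare.prep (Rng.ok_mono (by simp) hr₁) (Rng.ok_mono (by simp) hr₂)
    (Rng.ok_mono (by simp) hr₃) hK hKN h₁ h₂ h₃) fun μ₁ e₁ F₁ => ?_
  refine e₁.sim_pick (by rw [F₁.mono (Prog.writes_prep _ _ _) 10 (by simp), hK]) hKN fun v => ?_
  rw [← perp_append, hS]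
  change v ∈ perp (L₁ ++ L₂) ∧ v ∉ perp L₃ ↔ _
  simp only [Submodule.mem_inf]
  tauto

theorem Sim.drawNot {r₁ r₂ r₃ : Rng} {L₁ L₂ L₃ : List (Vec K)}
    (hr₁ : r₁.ok drawVars = true) (hr₂ : r₂.ok drawVars = true) (hr₃ : r₃.ok drawVars = true)
    (hK : μ 10 0 0 = K) (hKN : K ≤ N) (h₁ : r₁.Holds N μ L₁) (h₂ : r₂.Holds N μ L₂)
    (h₃ : r₃.Holds N μ L₃) {S : Set (Vec K)}
    (hS : ∀ v, v ∈ S ↔ v ∈ orthTo (L₁ ++ L₂) ∧ v ∉ spanOf L₃) :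
    Sim N (.drawNot r₁ r₂ r₃) μ (draw S) fun v μ' => Row μ' 33 0 v := by
  refine Hoare.seq_sim (Hoare.prepNot hr₁ hr₂ hr₃ hK hKN h₁ h₂ h₃) fun μ₁ e₁ F₁ => ?_
  refine e₁.sim_pick (by rw [F₁.mono (Prog.writes_prepNot _ _ _) 10 (by simp), hK]) hKN fun v => ?_
  rw [← perp_append, hS]
  change v ∈ perp (L₁ ++ L₂) ∧ _ ↔ _
  simp only [Submodule.mem_inf]
  tauto

/-! ### Inhomogeneous systems. -/

/-- The first coordinates of a vector. -/
def dropLast {n : ℕ} (v : Vec (n + 1)) : Vec n := fun j => v j.castSucc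

/-- Sample a vector `v` such that `(v, 1)` is orthogonal to the rows of a range. -/
def Prog.drawAff (r : Rng) : Prog :=
  .seq (.assign 10 (.add (.var 10) (.lit 1))) (.seq
  (.mapRow 40 (.lit 0) (.var 10) (.lit 0)) (.seq
  (.set 40 (.lit 0) (.sub (.var 10) (.lit 1)) (.lit 1)) (.seq
  (.drawTest r ⟨40, .lit 0, .lit 0⟩ ⟨40, .lit 0, .lit 1⟩)
  (.assign 10 (.sub (.var 10) (.lit 1))))))

theorem Prog.writes_drawAff (r : Rng) : (drawAff r).writes ⊆ 10 :: 40 :: drawVars := by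
  have h1 := writes_drawTest r ⟨40, .lit 0, .lit 0⟩ ⟨40, .lit 0, .lit 1⟩
  intro x
  simp only [drawAff, writes, List.mem_append]
  rintro (h | h | h | h | h)
  · simp_all
  · revert h; simp; omega
  · simp_all
  · exact List.mem_cons_of_mem _ (List.mem_cons_of_mem _ (h1 h))
  · simp_all

theorem dotProduct_succ {n : ℕ} (c v : Vec (n + 1)) :
    c ⬝ᵥ v = dropLast c ⬝ᵥ dropLast v + c (Fin.last n) * v (Fin.last n) := by
  simp only [dotProduct, Fin.sum_univ_castSucc]
  rfl

/-- Over F₂, v solves the system iff (v, 1) is orthogonal to the extended rows. So the solutions are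
the points of a subspace off the hyperplane where the last coordinate vanishes. -/
theorem Sim.drawAff {n : ℕ} {r : Rng} {L : List (Vec (n + 1))}
    (hr : r.ok (10 :: 40 :: drawVars) = true) (hn : μ 10 0 0 = n) (hnN : n + 1 ≤ N)
    (h : r.Holds N μ L) {S : Set (Vec n)}
    (hS : ∀ v, v ∈ S ↔ ∀ c ∈ L, dropLast c ⬝ᵥ v = c (Fin.last n)) :
    Sim N (.drawAff r) μ (draw S) fun v μ' => Row μ' 33 0 v ∧ μ' 10 0 0 = n := by
  have F₁ : Frame (10 :: 40 :: drawVars) μ (μ.write 10 0 0 (n + 1)) :=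
    (Frame.write μ 10 0 0 (n + 1)).mono (by simp)
  refine Hoare.set_seq ?_
  simp only [Expr.eval, hn]
  refine Hoare.seq_sim (Hoare.mapRow (fun _ => 0) (cnt := n + 1) (by simp [Expr.eval]) hnN
    (by omega) rfl rfl fun k _ μ' _ _ _ => rfl) fun μ₂ h₂ F₂ => ?_
  simp only [Expr.eval] at h₂
  have e10 : μ₂ 10 0 0 = n + 1 := by rw [F₂ 10 (by simp)]; simp
  replace F₂ := F₁.trans (F₂.mono (by simp))
  have F₃ := F₂.trans ((Frame.write μ₂ 40 0 n 1).mono (by simp))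
  refine Hoare.set_seq ?_
  simp only [Expr.eval, e10, Nat.add_sub_cancel]
  let T : Set (Vec (n + 1)) := {w | (∀ c ∈ L, c ⬝ᵥ w = 0) ∧ w (Fin.last n) = 1}
  have hrow : Row (μ₂.write 40 0 n 1) 40 0 (unitVec (n + 1) n) := fun j => by
    simp only [Mem.write_apply, true_and, unitVec, h₂, j.2, and_true, if_true]
    split_ifs <;> simp [ZMod.val_one]
  have hdot : ∀ v : Vec (n + 1), unitVec (n + 1) n ⬝ᵥ v = v (Fin.last n) := fun v => by
    have : unitVec (n + 1) n = Pi.single (Fin.last n) 1 := by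
      ext j
      simp [unitVec, Pi.single_apply, Fin.ext_iff]
    rw [this, single_one_dotProduct]
  have hd : draw S = (draw T).map dropLast := by
    have himg : dropLast '' T = S := by
      ext v
      rw [hS]
      constructor
      · rintro ⟨w, hw, rfl⟩ c hc
        have := hw.1 c hc
        rw [dotProduct_succ, hw.2, mul_one] at this
        exact CharTwo.add_eq_zero.mp this
      · intro hv
        refine ⟨Fin.snoc (α := fun _ => ZMod 2) v 1, ⟨fun c hc => ?_, by simp⟩, ?_⟩
        · rw [dotProduct_succ, Fin.snoc_last, mul_one, CharTwo.add_eq_zero, ← hv c hc]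
          congr 1
          ext j
          simp [dropLast]
        · ext j
          simp [dropLast]
    by_cases hT : T.Nonempty
    · rw [draw_map (Set.toFinite T) hT, himg]
      intro w hw w' hw' he
      ext j
      refine Fin.lastCases ?_ (fun j => congrFun he j) j
      rw [hw.2, hw'.2]
    -- For an unsolvable system both sides are the default 0, since truncating the zero vector gives
    -- zero.
    · rw [draw_empty hT, PMF.pure_map, ← himg, draw_empty (by simpa using hT)]
      rfl
  rw [hd]
  refine Sim.seq_hoare (Q := fun v μ' => Row μ' 33 0 v ∧ μ' 10 0 0 = n + 1) (Sim.map
    (Q := fun w μ' => Row μ' 33 0 w) dropLast (Sim.drawTest (K := n + 1) (L₁ := L) (L₂ := [])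
    (L₃ := [unitVec (n + 1) n])
    (Rng.ok_mono (fun x hx => List.mem_cons_of_mem _ (List.mem_cons_of_mem _ hx)) hr) rfl rfl ?_
    hnN (h.frame hr F₃) ⟨rfl, ?_, ?_⟩ ⟨rfl, ?_, ?_⟩ ?_) fun w _ μ' hw F => ⟨?_, ?_⟩)
    fun v _ μ' hv F => ?_
  · simpa using e10
  · intro i hi; simp at hi
  · simp
  · intro i hi
    obtain rfl : i = 0 := by simpa using hi
    exact hrow
  · simp only [List.length_singleton]; omega
  · intro w
    change (∀ c ∈ L, c ⬝ᵥ w = 0) ∧ w (Fin.last n) = 1 ↔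
      (∀ c ∈ L ++ [], c ⬝ᵥ w = 0) ∧ ¬ ∀ c ∈ [unitVec (n + 1) n], c ⬝ᵥ w = 0
    simp only [List.append_nil, List.mem_singleton, forall_eq, hdot]
    rcases zmod_two_cases (w (Fin.last n)) with h0 | h0 <;> simp [h0]
  · exact fun j => hw j.castSucc
  · rw [F.mono (Prog.writes_drawTest _ _ _) 10 (by simp)]
    simpa using e10
  · refine Hoare.set ⟨hv.1.frame (Frame.write _ _ _ _ _) (by simp), ?_⟩
    simp [Expr.eval, hv.2]

end IQP
namespace IQP

/-! ## Binary linear codes -/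

section Codes

variable {ι : Type} [Fintype ι]

theorem mem_dualCode {C : Submodule (ZMod 2) (ι → ZMod 2)} {v : ι → ZMod 2} :
    v ∈ dualCode C ↔ ∀ w ∈ C, v ⬝ᵥ w = 0 := Iff.rfl

/-- The inner product identifies the dual code with the dual annihilator. -/
theorem finrank_add_finrank_dualCode (C : Submodule (ZMod 2) (ι → ZMod 2)) :
    Module.finrank (ZMod 2) C + Module.finrank (ZMod 2) (dualCode C) = Fintype.card ι := by
  classical
  have e : (dualCode C).map (dotProductEquiv (ZMod 2) ι).toLinearMap = C.dualAnnihilator := by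
    ext f
    rw [Submodule.mem_map, Submodule.mem_dualAnnihilator]
    constructor
    · rintro ⟨v, hv, rfl⟩ w hw
      exact hv w hw
    · intro hf
      refine ⟨(dotProductEquiv (ZMod 2) ι).symm f, fun w hw => ?_, by simp⟩
      rw [← hf w hw]
      conv_rhs => rw [← (dotProductEquiv (ZMod 2) ι).apply_symm_apply f]
      rfl
  have h := Subspace.finrank_add_finrank_dualAnnihilator_eq C
  rw [← e, LinearEquiv.finrank_map_eq, Module.finrank_fintype_fun_eq_card] at h
  exact h

theorem finrank_sup_singleton {C : Submodule (ZMod 2) (ι → ZMod 2)} {v : ι → ZMod 2} (hv : v ∉ C) :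
    Module.finrank (ZMod 2) (C ⊔ Submodule.span (ZMod 2) {v} : Submodule _ _) =
      Module.finrank (ZMod 2) C + 1 := by
  have h0 : v ≠ 0 := fun h => hv (h ▸ zero_mem C)
  have h := Submodule.finrank_sup_add_finrank_inf_eq C (Submodule.span (ZMod 2) {v})
  have hinf : C ⊓ Submodule.span (ZMod 2) {v} = ⊥ := by
    refine (Submodule.eq_bot_iff _).mpr ?_
    rintro _ ⟨hw, hw'⟩
    obtain ⟨c, rfl⟩ := Submodule.mem_span_singleton.mp hw'
    rcases zmod_two_cases c with rfl | rfl
    · simp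
    · exact absurd (by simpa using hw) hv
  rw [hinf, finrank_bot, finrank_span_singleton h0] at h
  exact h

/-- The vectors of a code orthogonal to a given vector. -/
def orthPart (C : Submodule (ZMod 2) (ι → ZMod 2)) (c : ι → ZMod 2) :
    Submodule (ZMod 2) (ι → ZMod 2) := C ⊓ dualCode (Submodule.span (ZMod 2) {c})

theorem mem_orthPart {C : Submodule (ZMod 2) (ι → ZMod 2)} {c v : ι → ZMod 2} :
    v ∈ orthPart C c ↔ v ∈ C ∧ c ⬝ᵥ v = 0 := by
  rw [orthPart, Submodule.mem_inf, mem_dualCode]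
  refine and_congr_right fun _ => ⟨fun h => ?_, fun h w hw => ?_⟩
  · rw [dotProduct_comm]
    exact h c (Submodule.mem_span_singleton_self c)
  · obtain ⟨r, rfl⟩ := Submodule.mem_span_singleton.mp hw
    rw [dotProduct_smul, dotProduct_comm, h, smul_zero]

theorem finrank_orthPart {C : Submodule (ZMod 2) (ι → ZMod 2)} {c w : ι → ZMod 2} (hw : w ∈ C)
    (hcw : c ⬝ᵥ w = 1) :
    Module.finrank (ZMod 2) (orthPart C c) + 1 = Module.finrank (ZMod 2) C := by
  have hn : w ∉ orthPart C c := fun h => by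
    rw [mem_orthPart, hcw] at h
    exact one_ne_zero h.2
  suffices e : orthPart C c ⊔ Submodule.span (ZMod 2) {w} = C by
    rw [← finrank_sup_singleton hn, e]
  apply le_antisymm
  · refine sup_le inf_le_left ?_
    simpa using hw
  · intro v hv
    rcases zmod_two_cases (c ⬝ᵥ v) with h | h
    · exact Submodule.mem_sup_left (mem_orthPart.mpr ⟨hv, h⟩)
    · have : v = (v - w) + w := by abel
      rw [this]
      refine add_mem (Submodule.mem_sup_left (mem_orthPart.mpr ⟨sub_mem hv hw, ?_⟩))
        (Submodule.mem_sup_right (Submodule.mem_span_singleton_self w))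
      rw [dotProduct_sub, h, hcw, sub_self]

/-- An alternating form has even rank. -/
theorem even_finrank_of_alternating (C : Submodule (ZMod 2) (ι → ZMod 2))
    (h : ∀ v ∈ C, v ⬝ᵥ v = 0) :
    Even (Module.finrank (ZMod 2) C + Module.finrank (ZMod 2) (C ⊓ dualCode C : Submodule _ _)) := by
  induction hr : Module.finrank (ZMod 2) C using Nat.strong_induction_on generalizing C with
  | _ r ih =>
    subst hr
    by_cases hC : C ≤ dualCode C
    · rw [inf_eq_left.mpr hC]
      exact ⟨_, rfl⟩
    · obtain ⟨a, ha, hna⟩ := Set.not_subset.mp hC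
      have : ∃ b ∈ C, a ⬝ᵥ b = 1 := by
        by_contra hn
        push Not at hn
        exact hna fun w hw => (zmod_two_cases _).resolve_right (hn w hw)
      obtain ⟨b, hb, hab⟩ := this
      have hba : b ⬝ᵥ a = 1 := by rw [dotProduct_comm, hab]
      have e1 := finrank_orthPart hb hab
      have e2 := finrank_orthPart (mem_orthPart.mpr ⟨ha, h a ha⟩) hba
      -- Split off the hyperbolic plane spanned by `a` and `b`: the dimension drops by two and the
      -- radical stays the same.
      set C' := orthPart (orthPart C a) b with hC'
      have mem : ∀ v, v ∈ C' ↔ v ∈ C ∧ a ⬝ᵥ v = 0 ∧ b ⬝ᵥ v = 0 := fun v => by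
        rw [hC', mem_orthPart, mem_orthPart, and_assoc]
      have hrad : C' ⊓ dualCode C' = C ⊓ dualCode C := by
        ext v
        simp only [Submodule.mem_inf, mem_dualCode, mem]
        constructor
        · rintro ⟨⟨hv, hav, hbv⟩, hd⟩
          refine ⟨hv, fun w hw => ?_⟩
          -- The projection of `w` along the plane lies in its complement and has the same product
          -- with `v`.
          have := hd (w - (b ⬝ᵥ w) • a - (a ⬝ᵥ w) • b) ⟨sub_mem (sub_mem hw
            (Submodule.smul_mem _ _ ha)) (Submodule.smul_mem _ _ hb), ?_, ?_⟩
          · rw [dotProduct_sub, dotProduct_sub, dotProduct_smul, dotProduct_smul,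
              dotProduct_comm v a, dotProduct_comm v b, hav, hbv] at this
            simpa using this
          · simp [dotProduct_sub, h a ha, hab]
          · simp [dotProduct_sub, h b hb, hba]
        · rintro ⟨hv, hd⟩
          refine ⟨⟨hv, ?_, ?_⟩, fun w hw => hd w hw.1⟩
          · rw [dotProduct_comm, hd a ha]
          · rw [dotProduct_comm, hd b hb]
      have := ih _ (by omega) C' (fun v hv => h v ((mem v).mp hv).1) rfl
      rw [hrad] at this
      rw [← e1, ← e2]
      rw [Nat.even_add] at this ⊢
      rw [← this]
      simp only [add_assoc, Nat.even_add]
      simp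

theorem dotProduct_self_eq (v : ι → ZMod 2) : v ⬝ᵥ v = 1 ⬝ᵥ v := by
  simp only [dotProduct, Pi.one_apply, one_mul]
  refine Finset.sum_congr rfl fun i _ => ?_
  rcases zmod_two_cases (v i) with h | h <;> simp [h]

theorem one_dotProduct_one : (1 : ι → ZMod 2) ⬝ᵥ 1 = (Fintype.card ι : ZMod 2) := by
  simp [dotProduct]

/-- The form of a code that contains the all-ones vector has the parity of the length as the parity
of its rank. -/
theorem even_finrank_add_card (C : Submodule (ZMod 2) (ι → ZMod 2)) (h1 : (1 : ι → ZMod 2) ∈ C) :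
    Even (Module.finrank (ZMod 2) C + Module.finrank (ZMod 2) (C ⊓ dualCode C : Submodule _ _) +
      Fintype.card ι) := by
  by_cases halt : ∀ v ∈ C, v ⬝ᵥ v = 0
  · have h2 : Even (Fintype.card ι) := by
      rw [← ZMod.natCast_eq_zero_iff_even, ← one_dotProduct_one]
      exact halt 1 h1
    exact (even_finrank_of_alternating C halt).add h2
  · push Not at halt
    obtain ⟨w, hw, hw1⟩ := halt
    replace hw1 : (1 : ι → ZMod 2) ⬝ᵥ w = 1 := by
      rw [← dotProduct_self_eq]
      exact (zmod_two_cases _).resolve_left hw1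
    have e := finrank_orthPart hw hw1
    -- On the even-weight part v·v = 1·v = 0, so the form is alternating there.
    have hE := even_finrank_of_alternating (orthPart C 1) fun v hv => by
      rw [dotProduct_self_eq, (mem_orthPart.mp hv).2]
    rcases Nat.even_or_odd (Fintype.card ι) with hc | hc
    · have h11 : (1 : ι → ZMod 2) ⬝ᵥ 1 = 0 := by
        rw [one_dotProduct_one, ZMod.natCast_eq_zero_iff_even]
        exact hc
      -- Even length: the vector 1 is even and joins the radical of the even part, which makes up
      -- for the lost dimension.
      have hrad : orthPart C 1 ⊓ dualCode (orthPart C 1) =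
          (C ⊓ dualCode C) ⊔ Submodule.span (ZMod 2) {1} := by
        apply le_antisymm
        · rintro v ⟨hv, hd⟩
          have key : ∀ v ∈ orthPart C 1, v ∈ dualCode (orthPart C 1) → v ⬝ᵥ w = 0 →
              v ∈ C ⊓ dualCode C := by
            intro v hv hd hvw
            refine ⟨(mem_orthPart.mp hv).1, fun x hx => ?_⟩
            rcases zmod_two_cases (1 ⬝ᵥ x) with h | h
            · exact hd x (mem_orthPart.mpr ⟨hx, h⟩)
            · have := hd (x - w) (mem_orthPart.mpr ⟨sub_mem hx hw, by
                rw [dotProduct_sub, h, hw1, sub_self]⟩)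
              rwa [dotProduct_sub, hvw, sub_zero] at this
          rcases zmod_two_cases (v ⬝ᵥ w) with h | h
          · exact Submodule.mem_sup_left (key v hv hd h)
          · have : v = (v - 1) + 1 := by abel
            rw [this]
            refine add_mem (Submodule.mem_sup_left (key _ ?_ ?_ ?_))
              (Submodule.mem_sup_right (Submodule.mem_span_singleton_self _))
            · exact sub_mem hv (mem_orthPart.mpr ⟨h1, h11⟩)
            · exact sub_mem hd fun x hx => (mem_orthPart.mp hx).2
            · rw [sub_dotProduct, h, hw1, sub_self]
        · refine sup_le ?_ ?_
          · rintro v ⟨hv, hd⟩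
            refine ⟨mem_orthPart.mpr ⟨hv, ?_⟩, fun x hx => hd x (mem_orthPart.mp hx).1⟩
            rw [dotProduct_comm]
            exact hd 1 h1
          · rw [Submodule.span_singleton_le_iff_mem]
            exact ⟨mem_orthPart.mpr ⟨h1, h11⟩, fun x hx => (mem_orthPart.mp hx).2⟩
      have hn : (1 : ι → ZMod 2) ∉ C ⊓ dualCode C := fun h => by
        have := h.2 w hw
        rw [hw1] at this
        exact one_ne_zero this
      rw [hrad, finrank_sup_singleton hn] at hE
      refine Even.add ?_ hc
      rw [← e]
      rwa [add_right_comm, add_assoc]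
    · have h11 : (1 : ι → ZMod 2) ⬝ᵥ 1 = 1 := by
        rw [one_dotProduct_one]
        exact ZMod.natCast_eq_one_iff_odd.mpr hc
      -- Odd length: C is the orthogonal sum of its even part and ⟨1⟩, so the radical is unchanged
      -- and the parity flips.
      have hrad : orthPart C 1 ⊓ dualCode (orthPart C 1) = C ⊓ dualCode C := by
        ext v
        constructor
        · rintro ⟨hv, hd⟩
          refine ⟨(mem_orthPart.mp hv).1, fun x hx => ?_⟩
          rcases zmod_two_cases (1 ⬝ᵥ x) with h | h
          · exact hd x (mem_orthPart.mpr ⟨hx, h⟩)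
          · have := hd (x - 1) (mem_orthPart.mpr ⟨sub_mem hx h1, by
              rw [dotProduct_sub, h, h11, sub_self]⟩)
            rwa [dotProduct_sub, dotProduct_comm v 1, (mem_orthPart.mp hv).2, sub_zero] at this
        · rintro ⟨hv, hd⟩
          refine ⟨mem_orthPart.mpr ⟨hv, ?_⟩, fun x hx => hd x (mem_orthPart.mp hx).1⟩
          rw [dotProduct_comm]
          exact hd 1 h1
      rw [hrad] at hE
      rw [← e]
      obtain ⟨x, hx⟩ := hE
      obtain ⟨y, hy⟩ := hc
      exact ⟨x + y + 1, by omega⟩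

/-! ### Hamming weights -/

theorem hammingNorm_eq_sum (v : ι → ZMod 2) : hammingNorm v = ∑ i, (v i).val := by
  rw [hammingNorm, Finset.card_filter]
  refine Finset.sum_congr rfl fun i _ => ?_
  rcases zmod_two_cases (v i) with h | h <;> simp [h, ZMod.val_one]

theorem one_dotProduct_eq (v : ι → ZMod 2) : 1 ⬝ᵥ v = (hammingNorm v : ZMod 2) := by
  rw [hammingNorm_eq_sum, Nat.cast_sum]
  simp [dotProduct]

theorem even_hammingNorm_iff (v : ι → ZMod 2) : Even (hammingNorm v) ↔ 1 ⬝ᵥ v = 0 := by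
  rw [one_dotProduct_eq, ZMod.natCast_eq_zero_iff_even]

theorem hammingNorm_add (u v : ι → ZMod 2) :
    hammingNorm (u + v) + 2 * hammingNorm (u * v) = hammingNorm u + hammingNorm v := by
  simp only [hammingNorm_eq_sum, Finset.mul_sum, ← Finset.sum_add_distrib]
  refine Finset.sum_congr rfl fun i _ => ?_
  simp only [Pi.add_apply, Pi.mul_apply]
  generalize u i = a
  generalize v i = b
  revert a b
  decide

theorem dotProduct_eq_hammingNorm_mul (u v : ι → ZMod 2) :
    u ⬝ᵥ v = (hammingNorm (u * v) : ZMod 2) := by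
  rw [← one_dotProduct_eq]
  simp [dotProduct]

/-- Twice the overlap matters only through its parity, which is the inner product: on even vectors,
half the weight is a quadratic refinement of the form. -/
theorem hammingNorm_add_mod (u v : ι → ZMod 2) :
    hammingNorm (u + v) % 4 = (hammingNorm u + hammingNorm v + 2 * (u ⬝ᵥ v).val) % 4 := by
  have h := hammingNorm_add u v
  rw [dotProduct_eq_hammingNorm_mul, ZMod.val_natCast]
  omega

/-- An odd overlap of two codewords would contribute 2 modulo 4 to the weight of their sum. -/
theorem IsDoublyEven.le_dualCode {C : Submodule (ZMod 2) (ι → ZMod 2)} (h : IsDoublyEven C) :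
    C ≤ dualCode C := by
  intro u hu v hv
  have := hammingNorm_add_mod u v
  have h1 := h u hu
  have h2 := h v hv
  have h3 := h _ (add_mem hu hv)
  rcases zmod_two_cases (u ⬝ᵥ v) with h' | h'
  · exact h'
  · rw [h', ZMod.val_one] at this
    omega

theorem four_dvd_hammingNorm_add {u v : ι → ZMod 2} (hu : 4 ∣ hammingNorm u) (huv : u ⬝ᵥ v = 0) :
    4 ∣ hammingNorm (u + v) ↔ 4 ∣ hammingNorm v := by
  have := hammingNorm_add_mod u v
  rw [huv, ZMod.val_zero] at this
  omega

/-! ### A Gauss sum -/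

/-- The nontrivial character of the field with two elements. -/
noncomputable def sgn (a : ZMod 2) : ℂ := if a = 0 then 1 else -1

theorem sgn_add (a b : ZMod 2) : sgn (a + b) = sgn a * sgn b := by
  rcases zmod_two_cases a with rfl | rfl <;> rcases zmod_two_cases b with rfl | rfl <;>
    simp [sgn, CharTwo.add_self_eq_zero]

open Classical in
-- Orthogonality of characters: translating by a codeword with product 1 flips all signs, so the sum
-- equals its negative.
theorem sum_sgn (C : Submodule (ZMod 2) (ι → ZMod 2)) (v : ι → ZMod 2) :
    ∑ u : C, sgn (v ⬝ᵥ u) = if v ∈ dualCode C then (Fintype.card C : ℂ) else 0 := by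
  split_ifs with h
  · rw [Finset.sum_congr rfl fun (u : C) _ => by rw [h u u.2]]
    simp [sgn]
  · have : ∃ w ∈ C, v ⬝ᵥ w = 1 := by
      by_contra hn
      push Not at hn
      exact h fun w hw => (zmod_two_cases _).resolve_right (hn w hw)
    obtain ⟨w, hw, hvw⟩ := this
    have e : ∑ u : C, sgn (v ⬝ᵥ u) = ∑ u : C, -sgn (v ⬝ᵥ u) := by
      refine Fintype.sum_equiv (Equiv.addRight (⟨w, hw⟩ : C)) _ _ fun u => ?_
      simp [dotProduct_add, hvw, sgn_add]
      simp [sgn]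
    rw [Finset.sum_neg_distrib] at e
    exact self_eq_neg.mp e

open Classical in
-- The sum factors over coordinates, into 1 + i where u vanishes and 1 - i = -i(1 + i) elsewhere.
-- The extra factors multiply to (-i)^|u| = 1.
theorem sum_sgn_mul_I_pow {u : ι → ZMod 2} (hu : 4 ∣ hammingNorm u) :
    ∑ v : ι → ZMod 2, sgn (v ⬝ᵥ u) * Complex.I ^ hammingNorm v =
      (1 + Complex.I) ^ Fintype.card ι := by
  have sgn_sum : ∀ (s : Finset ι) (f : ι → ZMod 2), sgn (∑ i ∈ s, f i) = ∏ i ∈ s, sgn (f i) := by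
    intro s f
    induction s using Finset.induction_on with
    | empty => simp [sgn]
    | insert a s ha ih => rw [Finset.sum_insert ha, Finset.prod_insert ha, sgn_add, ih]
  have h1 : ∀ v : ι → ZMod 2, sgn (v ⬝ᵥ u) * Complex.I ^ hammingNorm v =
      ∏ i, (sgn (v i * u i) * Complex.I ^ (v i).val) := fun v => by
    rw [hammingNorm_eq_sum, ← Finset.prod_pow_eq_pow_sum, dotProduct, sgn_sum,
      Finset.prod_mul_distrib]
  simp only [h1]
  have h2 := (Finset.prod_univ_sum (fun _ : ι => (Finset.univ : Finset (ZMod 2)))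
    (fun i a => sgn (a * u i) * Complex.I ^ a.val)).symm
  rw [Fintype.piFinset_univ] at h2
  rw [h2]
  have h3 : ∀ i, ∑ a : ZMod 2, sgn (a * u i) * Complex.I ^ a.val =
      (if u i ≠ 0 then -Complex.I else 1) * (1 + Complex.I) := fun i => by
    have : (Finset.univ : Finset (ZMod 2)) = {0, 1} := rfl
    rw [this, Finset.sum_pair zero_ne_one]
    rcases zmod_two_cases (u i) with h | h
    · simp [h, sgn, ZMod.val_one]
    · simp [h, sgn, ZMod.val_one, mul_add]
      ring
  simp only [h3, Finset.prod_mul_distrib, Finset.prod_const, Finset.card_univ]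
  rw [Finset.prod_ite, Finset.prod_const, Finset.prod_const_one, mul_one]
  change (-Complex.I) ^ hammingNorm u * _ = _
  obtain ⟨t, ht⟩ := hu
  rw [ht, pow_mul]
  have : (-Complex.I) ^ 4 = 1 := by
    rw [neg_pow, Complex.I_pow_four]; norm_num
  rw [this, one_pow, one_mul]

open Classical in
-- Poisson summation: the indicator of the dual code is an average of characters over `C`, and each
-- of them contributes the same Gauss sum because `C` is doubly even.
theorem sum_dualCode_I_pow {C : Submodule (ZMod 2) (ι → ZMod 2)} (hC : IsDoublyEven C) :
    ∑ v : ι → ZMod 2, (if v ∈ dualCode C then Complex.I ^ hammingNorm v else 0) =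
      (1 + Complex.I) ^ Fintype.card ι := by
  have hc : (Fintype.card C : ℂ) ≠ 0 := Nat.cast_ne_zero.mpr Fintype.card_ne_zero
  apply mul_left_cancel₀ hc
  calc (Fintype.card C : ℂ) * ∑ v : ι → ZMod 2,
        (if v ∈ dualCode C then Complex.I ^ hammingNorm v else 0)
      = ∑ v : ι → ZMod 2, ∑ u : C, sgn (v ⬝ᵥ u) * Complex.I ^ hammingNorm v := by
        rw [Finset.mul_sum]
        refine Finset.sum_congr rfl fun v _ => ?_
        rw [← Finset.sum_mul, sum_sgn]
        split_ifs <;> simp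
    _ = ∑ u : C, ∑ v : ι → ZMod 2, sgn (v ⬝ᵥ u) * Complex.I ^ hammingNorm v := Finset.sum_comm
    _ = ∑ _u : C, (1 + Complex.I) ^ Fintype.card ι :=
        Finset.sum_congr rfl fun u _ => sum_sgn_mul_I_pow (hC u u.2)
    _ = _ := by simp

end Codes

end IQP
namespace IQP

/-! ### Consequences for the length of a doubly even code -/

theorem vec_add_self {ι : Type} (v : ι → ZMod 2) : v + v = 0 := by
  funext i
  exact CharTwo.add_self_eq_zero _

section Codes

variable {ι : Type} [Fintype ι]

theorem one_add_I_sq : (1 + Complex.I) ^ 2 = 2 * Complex.I := by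
  ring_nf
  rw [Complex.I_sq]
  ring

theorem one_add_I_pow_eight : (1 + Complex.I) ^ 8 = 16 := by
  rw [show 8 = 2 * 4 by rfl, pow_mul, one_add_I_sq, mul_pow, Complex.I_pow_four]
  norm_num

/-- As (1 + i)^8 = 16, only the powers 1, 1 + i and (1 + i)^7 = 8(1 - i) have to be checked. -/
theorem one_add_I_pow_re_pos {n : ℕ} (hn : n % 8 = 0 ∨ n % 8 = 1 ∨ n % 8 = 7) :
    0 < ((1 + Complex.I) ^ n).re := by
  have key : ∀ z : ℂ, ((16 : ℂ) ^ (n / 8) * z).re = 16 ^ (n / 8) * z.re := fun z => by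
    have : ((16 : ℂ) ^ (n / 8)) = ((16 ^ (n / 8) : ℝ) : ℂ) := by push_cast; rfl
    rw [this, Complex.re_ofReal_mul]
  rw [← Nat.div_add_mod n 8, pow_add, pow_mul, one_add_I_pow_eight, key]
  refine mul_pos (by positivity) ?_
  rcases hn with h | h | h
  · rw [h]; simp
  · rw [h]; simp
  · have : (1 + Complex.I) ^ 7 = 8 * (1 - Complex.I) := by
      have : (1 + Complex.I) ^ 7 = ((1 + Complex.I) ^ 2) ^ 3 * (1 + Complex.I) := by ring
      rw [this, one_add_I_sq]
      have h3 : Complex.I ^ 3 = -Complex.I := Complex.I_pow_three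
      have h4 : Complex.I ^ 4 = 1 := Complex.I_pow_four
      linear_combination (8 : ℂ) * h4 + (8 : ℂ) * h3
    rw [h, this]
    simp

open Classical in
theorem sum_ite_mem (C : Submodule (ZMod 2) (ι → ZMod 2)) (z : ℂ) :
    ∑ v : ι → ZMod 2, (if v ∈ C then z else 0) = 2 ^ Module.finrank (ZMod 2) C * z := by
  rw [← Finset.sum_filter, Finset.sum_const, nsmul_eq_mul]
  congr 1
  have := Module.card_eq_pow_finrank (K := ZMod 2) (V := C)
  rw [ZMod.card] at this
  rw [← Fintype.card_subtype]
  exact_mod_cast this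

open Classical in
theorem sum_ite_add_mem (C : Submodule (ZMod 2) (ι → ZMod 2)) (w : ι → ZMod 2) (z : ℂ) :
    ∑ v : ι → ZMod 2, (if v + w ∈ C then z else 0) = 2 ^ Module.finrank (ZMod 2) C * z := by
  rw [← sum_ite_mem C]
  exact Fintype.sum_equiv (Equiv.addRight w) _ _ fun v => rfl

theorem I_pow_mod_four (n : ℕ) : Complex.I ^ n = Complex.I ^ (n % 4) := by
  conv_lhs => rw [← Nat.div_add_mod n 4, pow_add, pow_mul, Complex.I_pow_four, one_pow, one_mul]

/-- A doubly even code whose dimension is about half of its length exists only for lengths congruent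
to 0, 1 or 7 modulo 8. -/
theorem IsDoublyEven.card_mod_eight {C : Submodule (ZMod 2) (ι → ZMod 2)} (hC : IsDoublyEven C)
    (h : Fintype.card ι ≤ 2 * Module.finrank (ZMod 2) C + 1) :
    Fintype.card ι % 8 = 0 ∨ Fintype.card ι % 8 = 1 ∨ Fintype.card ι % 8 = 7 := by
  classical
  have hle := hC.le_dualCode
  have hsum := finrank_add_finrank_dualCode C
  have hmono := Submodule.finrank_mono hle
  have hG := sum_dualCode_I_pow hC
  set d := Module.finrank (ZMod 2) C with hd
  have two_ne : (2 : ℂ) ^ d ≠ 0 := pow_ne_zero _ two_ne_zero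
  have hI3 : Complex.I ^ 3 = -Complex.I := Complex.I_pow_three
  rcases (by omega : Fintype.card ι = 2 * d ∨ Fintype.card ι = 2 * d + 1) with hn | hn
  -- Length 2d: C is self-dual, so the sum counts codewords. Then 2^d = (2i)^d forces 4 ∣ d.
  · have e : dualCode C = C := (Submodule.eq_of_le_of_finrank_eq hle (by omega)).symm
    rw [e, hn, pow_mul, one_add_I_sq, mul_pow] at hG
    have h1 : ∀ v : ι → ZMod 2, (if v ∈ C then Complex.I ^ hammingNorm v else 0) =
        if v ∈ C then 1 else 0 := fun v => by
      split_ifs with hv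
      · obtain ⟨t, ht⟩ := hC v hv
        rw [ht, pow_mul, Complex.I_pow_four, one_pow]
      · rfl
    simp only [h1] at hG
    rw [sum_ite_mem] at hG
    have h2 := mul_left_cancel₀ two_ne hG
    rw [I_pow_mod_four] at h2
    have h4 : d % 4 < 4 := Nat.mod_lt _ (by omega)
    have h5 : d % 4 = 0 := by
      interval_cases d % 4
      · rfl
      · have := congrArg Complex.re h2; simp at this
      · have := congrArg Complex.re h2; norm_num at this
      · rw [hI3] at h2; have := congrArg Complex.re h2; simp at this
    omega
  -- Length 2d + 1: the odd vector 1 is orthogonal to C but outside it, so the dual code is the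
  -- union of C and 1 + C.
  · have h1n : (1 : ι → ZMod 2) ∉ C := fun hmem => by
      have := hC 1 hmem
      have h2 : hammingNorm (1 : ι → ZMod 2) = Fintype.card ι := by
        simp [hammingNorm_eq_sum, ZMod.val_one]
      omega
    have e : dualCode C = C ⊔ Submodule.span (ZMod 2) {1} := by
      symm
      refine Submodule.eq_of_le_of_finrank_eq (sup_le hle ?_) ?_
      · rw [Submodule.span_singleton_le_iff_mem]
        intro w hw
        rw [← even_hammingNorm_iff]
        have := hC w hw
        exact even_iff_two_dvd.mpr (dvd_trans (by norm_num) this)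
      · rw [finrank_sup_singleton h1n]
        omega
    have mem : ∀ v, v ∈ dualCode C ↔ v ∈ C ∨ v + 1 ∈ C := fun v => by
      rw [e]
      constructor
      · intro hv
        obtain ⟨u, hu, w, hw, rfl⟩ := Submodule.mem_sup.mp hv
        obtain ⟨c, rfl⟩ := Submodule.mem_span_singleton.mp hw
        rcases zmod_two_cases c with rfl | rfl
        · left; simpa using hu
        · right
          have : u + (1 : ZMod 2) • (1 : ι → ZMod 2) + 1 = u := by
            rw [one_smul, add_assoc, vec_add_self, add_zero]
          rwa [this]
      · rintro (hv | hv)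
        · exact Submodule.mem_sup_left hv
        · have : v = (v + 1) + 1 := by rw [add_assoc, vec_add_self, add_zero]
          rw [this]
          exact add_mem (Submodule.mem_sup_left hv)
            (Submodule.mem_sup_right (Submodule.mem_span_singleton_self _))
    -- Complements of codewords have weight congruent to the length modulo 4, so all terms of the
    -- coset are equal.
    have h1 : ∀ v : ι → ZMod 2, (if v ∈ dualCode C then Complex.I ^ hammingNorm v else 0) =
        (if v ∈ C then 1 else 0) + (if v + 1 ∈ C then Complex.I ^ Fintype.card ι else 0) :=
        fun v => by
      by_cases hv : v ∈ C
      · have hv' : v + 1 ∉ C := fun h' => h1n (by simpa using sub_mem h' hv)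
        obtain ⟨t, ht⟩ := hC v hv
        rw [if_pos ((mem v).mpr (Or.inl hv)), if_pos hv, if_neg hv', ht, pow_mul,
          Complex.I_pow_four, one_pow, add_zero]
      · by_cases hv' : v + 1 ∈ C
        · rw [if_pos ((mem v).mpr (Or.inr hv')), if_neg hv, if_pos hv', zero_add, I_pow_mod_four,
            I_pow_mod_four (Fintype.card ι)]
          congr 1
          have e2 := hammingNorm_add_mod (v + 1) 1
          have e3 : v + 1 + 1 = v := by rw [add_assoc, vec_add_self, add_zero]
          have e4 : hammingNorm (1 : ι → ZMod 2) = Fintype.card ι := by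
            simp [hammingNorm_eq_sum, ZMod.val_one]
          have e5 : (v + 1) ⬝ᵥ (1 : ι → ZMod 2) = 0 := by
            rw [dotProduct_comm, ← even_hammingNorm_iff]
            exact even_iff_two_dvd.mpr (dvd_trans (by norm_num) (hC _ hv'))
          have e6 := hC _ hv'
          rw [e3, e4, e5, ZMod.val_zero] at e2
          omega
        · rw [if_neg (fun h' => ((mem v).mp h').elim hv hv'), if_neg hv, if_neg hv', add_zero]
    simp only [h1] at hG
    have e1 : (1 + Complex.I) ^ (2 * d + 1) = 2 ^ d * (Complex.I ^ d * (1 + Complex.I)) := by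
      rw [pow_succ, pow_mul, one_add_I_sq, mul_pow, mul_assoc]
    rw [Finset.sum_add_distrib, sum_ite_mem, sum_ite_add_mem, hn, e1, ← hd, ← mul_add] at hG
    have h2 := mul_left_cancel₀ two_ne hG
    have h4 : d % 4 < 4 := Nat.mod_lt _ (by omega)
    rw [pow_succ, pow_mul, Complex.I_sq, I_pow_mod_four d] at h2
    have h6 : ((-1 : ℂ)) ^ d = (-1) ^ (d % 4) := by
      conv_lhs => rw [← Nat.div_add_mod d 4, pow_add, pow_mul]
      norm_num
    rw [h6] at h2
    -- Of the four residues only these satisfy 1 + i^(2d+1) = i^d(1 + i); they give lengths 1 and 7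
    -- modulo 8.
    have h5 : d % 4 = 0 ∨ d % 4 = 3 := by
      interval_cases d % 4
      · left; rfl
      · have := congrArg Complex.re h2; norm_num at this
      · have := congrArg Complex.re h2; norm_num at this
      · right; rfl
    omega

/-- If the length of a doubly even code `C` is congruent to 0, 1 or 7 modulo 8 and there are vectors
of even weight in the dual code outside of `C`, then there are such vectors of weight divisible
by four. -/
theorem IsDoublyEven.exists_four_dvd {C : Submodule (ZMod 2) (ι → ZMod 2)} (hC : IsDoublyEven C)
    (hn : Fintype.card ι % 8 = 0 ∨ Fintype.card ι % 8 = 1 ∨ Fintype.card ι % 8 = 7)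
    {w : ι → ZMod 2} (hw : w ∈ dualCode C) (hwe : Even (hammingNorm w)) (hwC : w ∉ C) :
    ∃ v ∈ dualCode C, v ∉ C ∧ 4 ∣ hammingNorm v := by
  classical
  by_contra hcon
  push Not at hcon
  have hG := congrArg Complex.re (sum_dualCode_I_pow hC)
  have hpos := one_add_I_pow_re_pos hn
  rw [← hG, Complex.re_sum] at hpos
  -- Under the negated claim, codewords contribute 1, the coset w + C has weights 2 mod 4 and
  -- contributes -1, odd vectors contribute 0 and the other even ones -1. Summing bounds the real
  -- part by |C| - |C| = 0.
  have hle : ∀ v : ι → ZMod 2, (if v ∈ dualCode C then Complex.I ^ hammingNorm v else 0).re ≤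
      (if v ∈ C then (1 : ℂ) else 0).re - (if v + w ∈ C then (1 : ℂ) else 0).re := fun v => by
    have hCd := hC.le_dualCode
    by_cases h1 : v ∈ C
    · have h2 : v + w ∉ C := fun h' => hwC (by simpa using sub_mem h' h1)
      obtain ⟨t, ht⟩ := hC v h1
      rw [if_pos (hCd h1), if_pos h1, if_neg h2, ht, pow_mul, Complex.I_pow_four]
      simp
    · rw [if_neg h1]
      by_cases h2 : v + w ∈ C
      · have hvd : v ∈ dualCode C := by simpa using sub_mem (hCd h2) hw
        have hev : Even (hammingNorm v) := by
          rw [even_hammingNorm_iff] at hwe ⊢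
          have h3 : Even (hammingNorm (v + w)) :=
            even_iff_two_dvd.mpr (dvd_trans (by norm_num) (hC _ h2))
          rw [even_hammingNorm_iff, dotProduct_add, hwe, add_zero] at h3
          exact h3
        have h4 := hcon v hvd h1
        have h5 : hammingNorm v % 4 = 2 := by
          obtain ⟨t, ht⟩ := hev
          omega
        rw [if_pos hvd, if_pos h2, I_pow_mod_four, h5]
        simp
      · rw [if_neg h2]
        by_cases h3 : v ∈ dualCode C
        · have h4 := hcon v h3 h1
          rw [if_pos h3, I_pow_mod_four]
          have : hammingNorm v % 4 < 4 := Nat.mod_lt _ (by omega)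
          have h5 : hammingNorm v % 4 ≠ 0 := by omega
          interval_cases hammingNorm v % 4
          · exact absurd rfl h5
          · simp
          · simp
          · rw [Complex.I_pow_three]; simp
        · rw [if_neg h3]; simp
  have h6 := Finset.sum_le_sum fun v (_ : v ∈ Finset.univ) => hle v
  simp only [Finset.sum_sub_distrib, ← Complex.re_sum] at h6 hpos
  rw [sum_ite_mem, sum_ite_add_mem, sub_self] at h6
  exact absurd hpos (not_lt.mpr h6)

end Codes

end IQP
namespace IQP

/-! ## The stabilizer construction: the columns of `D` -/

variable {k : ℕ}

theorem perp_eq_dualCode (L : List (Vec k)) : perp L = dualCode (spanOf L) := by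
  ext v
  rw [mem_perp, mem_dualCode]
  constructor
  · intro h
    have : spanOf L ≤ perp [v] := Submodule.span_le.mpr fun w hw => by
      simpa [mem_perp, dotProduct_comm v] using h w hw
    intro w hw
    simpa [mem_perp] using this hw
  · intro h c hc
    rw [dotProduct_comm]
    exact h c (Submodule.subset_span hc)

theorem mem_orthTo {L : List (Vec k)} {v : Vec k} : v ∈ orthTo L ↔ v ∈ dualCode (spanOf L) := by
  rw [← perp_eq_dualCode]
  rfl

theorem finrank_spanOf_add_finrank_perp (L : List (Vec k)) :
    Module.finrank (ZMod 2) (spanOf L) + Module.finrank (ZMod 2) (perp L) = k := by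
  rw [perp_eq_dualCode, finrank_add_finrank_dualCode, Fintype.card_fin]

theorem spanOf_append (L L' : List (Vec k)) : spanOf (L ++ L') = spanOf L ⊔ spanOf L' := by
  rw [spanOf, spanOf, spanOf, ← Submodule.span_union]
  congr 1
  ext v
  simp

theorem spanOf_singleton (v : Vec k) : spanOf [v] = Submodule.span (ZMod 2) {v} := by
  rw [spanOf]
  congr 1
  ext w
  simp

@[simp] theorem spanOf_nil : spanOf ([] : List (Vec k)) = ⊥ := by
  simp [spanOf]

theorem mem_spanOf {L : List (Vec k)} {v : Vec k} (h : v ∈ L) : v ∈ spanOf L :=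
  Submodule.subset_span h

theorem spanOf_le {L : List (Vec k)} {W : Submodule (ZMod 2) (Vec k)} (h : ∀ v ∈ L, v ∈ W) :
    spanOf L ≤ W := Submodule.span_le.mpr h

theorem spanOf_mono {L L' : List (Vec k)} (h : L ⊆ L') : spanOf L ≤ spanOf L' :=
  Submodule.span_mono fun _ hv => h hv

theorem finrank_spanOf_concat {L : List (Vec k)} {v : Vec k} (h : v ∉ spanOf L) :
    Module.finrank (ZMod 2) (spanOf (L ++ [v])) = Module.finrank (ZMod 2) (spanOf L) + 1 := by
  rw [spanOf_append, spanOf_singleton, finrank_sup_singleton h]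

theorem finrank_spanOf_le (L : List (Vec k)) :
    Module.finrank (ZMod 2) (spanOf L) ≤ L.length := by
  classical
  have e : {v | v ∈ L} = (L.toFinset : Set (Vec k)) := by ext v; simp
  rw [spanOf, e]
  exact (finrank_span_finset_le_card _).trans (List.toFinset_card_le L)

theorem mem_sup_singleton {C : Submodule (ZMod 2) (Vec k)} {v x : Vec k} :
    x ∈ C ⊔ Submodule.span (ZMod 2) {v} ↔ x ∈ C ∨ x + v ∈ C := by
  constructor
  · intro hx
    obtain ⟨u, hu, w, hw, rfl⟩ := Submodule.mem_sup.mp hx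
    obtain ⟨c, rfl⟩ := Submodule.mem_span_singleton.mp hw
    rcases zmod_two_cases c with rfl | rfl
    · left; simpa using hu
    · right
      rwa [one_smul, add_assoc, vec_add_self, add_zero]
  · rintro (hx | hx)
    · exact Submodule.mem_sup_left hx
    · have : x = (x + v) + v := by rw [add_assoc, vec_add_self, add_zero]
      rw [this]
      exact add_mem (Submodule.mem_sup_left hx)
        (Submodule.mem_sup_right (Submodule.mem_span_singleton_self _))

/-- The state of the construction of `D`: independent columns that span a doubly even code. -/
structure DInv (D : List (Vec k)) : Prop where
  even : IsDoublyEven (spanOf D)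
  rank : Module.finrank (ZMod 2) (spanOf D) = D.length

theorem DInv.nil : DInv ([] : List (Vec k)) where
  even := by
    intro v hv
    rw [spanOf_nil, Submodule.mem_bot] at hv
    simp [hv]
  rank := by simp

theorem DInv.concat {D : List (Vec k)} (h : DInv D) {v : Vec k} (hv : 4 ∣ hammingNorm v)
    (hv' : v ∈ orthTo D) (hn : v ∉ spanOf D) : DInv (D ++ [v]) where
  even := by
    rw [mem_orthTo] at hv'
    intro x hx
    rw [spanOf_append, spanOf_singleton, mem_sup_singleton] at hx
    rcases hx with hx | hx
    · exact h.even x hx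
    · have e : x = (x + v) + v := by rw [add_assoc, vec_add_self, add_zero]
      rw [e, four_dvd_hammingNorm_add (h.even _ hx)]
      · exact hv
      · rw [dotProduct_comm]
        exact hv' _ hx
  rank := by rw [finrank_spanOf_concat hn, h.rank, List.length_append, List.length_singleton]

/-- There is room for a further column of `D`. -/
structure HasRoom (D : List (Vec k)) : Prop where
  two_mul_le : 2 * (D.length + 1) ≤ k
  mod_eight : k ≤ 2 * D.length + 3 → k % 8 = 0 ∨ k % 8 = 1 ∨ k % 8 = 7

/-- Otherwise the orthogonal space of L and 1, of dimension at least k - |L| - 1, would fit into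
dimension |L'|. -/
theorem exists_even_perp (L L' : List (Vec k)) (h : L.length + L'.length + 1 < k) :
    ∃ v ∈ orthTo L, Even (hammingNorm v) ∧ v ∉ spanOf L' := by
  by_contra hcon
  push Not at hcon
  have hle : perp (L ++ [1]) ≤ spanOf L' := fun v hv =>
    hcon v (fun c hc => hv c (by simp [hc]))
      ((even_hammingNorm_iff v).mpr (hv 1 (by simp)))
  have h1 := finrank_spanOf_add_finrank_perp (L ++ [1])
  have h2 := finrank_spanOf_le (L ++ [1])
  have h3 := Submodule.finrank_mono hle
  have h4 := finrank_spanOf_le L'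
  simp only [List.length_append, List.length_singleton] at h2
  omega

theorem orthTo_concat {L : List (Vec k)} {a v : Vec k} :
    v ∈ orthTo (L ++ [a]) ↔ v ∈ orthTo L ∧ a ⬝ᵥ v = 0 := by
  change (∀ c ∈ L ++ [a], c ⬝ᵥ v = 0) ↔ (∀ c ∈ L, c ⬝ᵥ v = 0) ∧ _
  simp [or_imp, forall_and]

theorem four_dvd_even {n : ℕ} (h : 4 ∣ n) : Even n :=
  even_iff_two_dvd.mpr (dvd_trans (by norm_num) h)

/-- A plain count fills the set in `hemp` when k > 2|D| + 3, so its emptiness puts the length in the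
range of the condition modulo 8. There the Gauss sum supplies the vector. -/
theorem DInv.exists_next {D : List (Vec k)} (h : DInv D) (hr : HasRoom D) {a : Vec k}
    (ha : Even (hammingNorm a)) (ha' : a ∈ orthTo D) (han : a ∉ spanOf D)
    (hemp : ¬ {v : Vec k | Even (hammingNorm v) ∧ v ∈ orthTo (D ++ [a]) ∧
      v ∉ spanOf (D ++ [a])}.Nonempty) :
    {v : Vec k | 4 ∣ hammingNorm v ∧ v ∈ orthTo D ∧ v ∉ spanOf D}.Nonempty := by
  have hk : k ≤ 2 * D.length + 3 := by
    by_contra hlt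
    obtain ⟨v, h1, h2, h3⟩ := exists_even_perp (D ++ [a]) (D ++ [a]) (by simp; omega)
    exact hemp ⟨v, h2, h1, h3⟩
  obtain ⟨v, h1, h2, h3⟩ := h.even.exists_four_dvd (by simpa using hr.mod_eight hk)
    (mem_orthTo.mp ha') ha han
  exact ⟨v, h3, mem_orthTo.mpr h1, h2⟩

/-- By `hemp`, even vectors orthogonal to D and a lie in span D or in a + span D, and the latter
have weight 2 mod 4. So a vector t of the left-hand set has a·t = 1, and any other even v orthogonal
to D with a·v = 1 differs from t by an element of one of these two cosets. In both cases its weight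
is divisible by 4. A nonlinear draw thereby becomes a linear one. -/
theorem DInv.set_eq {D : List (Vec k)} (h : DInv D) {a : Vec k}
    (ha : Even (hammingNorm a)) (ha' : a ∈ orthTo D) (ha4 : ¬ 4 ∣ hammingNorm a)
    (hemp : ¬ {v : Vec k | Even (hammingNorm v) ∧ v ∈ orthTo (D ++ [a]) ∧
      v ∉ spanOf (D ++ [a])}.Nonempty)
    (hne : {v : Vec k | 4 ∣ hammingNorm v ∧ v ∈ orthTo D ∧ v ∉ spanOf D}.Nonempty) :
    {v : Vec k | 4 ∣ hammingNorm v ∧ v ∈ orthTo D ∧ v ∉ spanOf D} =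
      {v | v ∈ orthTo D ∧ Even (hammingNorm v) ∧ a ⬝ᵥ v = 1} := by
  rw [mem_orthTo] at ha'
  have hmem : ∀ v, Even (hammingNorm v) → v ∈ orthTo D → a ⬝ᵥ v = 0 →
      v ∈ spanOf D ∨ v + a ∈ spanOf D := by
    intro v h1 h2 h3
    rw [← mem_sup_singleton, ← spanOf_singleton, ← spanOf_append]
    by_contra hn
    exact hemp ⟨v, h1, orthTo_concat.mpr ⟨h2, h3⟩, hn⟩
  have ha2 : hammingNorm a % 4 = 2 := by
    obtain ⟨t, ht⟩ := ha
    omega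
  have hsub : ∀ v, 4 ∣ hammingNorm v → v ∈ orthTo D → v ∉ spanOf D → a ⬝ᵥ v = 1 := by
    intro v h1 h2 h3
    by_contra h4
    rcases hmem v (four_dvd_even h1) h2 ((zmod_two_cases _).resolve_right h4) with h5 | h5
    · exact h3 h5
    · have e : v = (v + a) + a := by rw [add_assoc, vec_add_self, add_zero]
      rw [e, four_dvd_hammingNorm_add (h.even _ h5)] at h1
      · exact ha4 h1
      · rw [dotProduct_comm]
        exact ha' _ h5
  obtain ⟨t, ht1, ht2, ht3⟩ := hne
  have hat := hsub t ht1 ht2 ht3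
  have ht2' := mem_orthTo.mp ht2
  ext v
  constructor
  · rintro ⟨h1, h2, h3⟩
    exact ⟨h2, four_dvd_even h1, hsub v h1 h2 h3⟩
  · rintro ⟨h1, h2, h3⟩
    refine ⟨?_, h1, fun h4 => ?_⟩
    · have e0 : v + t ∈ spanOf D ∨ v + t + a ∈ spanOf D := by
        refine hmem _ ?_ ?_ ?_
        · have := four_dvd_even ht1
          rw [even_hammingNorm_iff] at *
          rw [dotProduct_add, h2, this, add_zero]
        · rw [mem_orthTo] at *
          exact add_mem h1 ht2
        · rw [dotProduct_add, h3, hat, CharTwo.add_self_eq_zero]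
      rcases e0 with h5 | h5
      · have e : v = (v + t) + t := by rw [add_assoc, vec_add_self, add_zero]
        rw [e, four_dvd_hammingNorm_add (h.even _ h5)]
        · exact ht1
        · rw [dotProduct_comm]
          exact ht2' _ h5
      · have e : v = (v + t + a) + (a + t) := by
          have : (v + t + a) + (a + t) = v + (t + t) + (a + a) := by abel
          rw [this, vec_add_self, vec_add_self, add_zero, add_zero]
        rw [e, four_dvd_hammingNorm_add (h.even _ h5)]
        -- Here |a + t| ≡ 2 + 0 + 2(a·t) ≡ 0 modulo 4.
        · have := hammingNorm_add_mod a t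
          rw [hat, ZMod.val_one] at this
          omega
        · rw [dotProduct_comm, add_dotProduct, ha' _ h5, ht2' _ h5, add_zero]
    · rw [dotProduct_comm, dotProduct_comm v a, ← dotProduct_comm v a, dotProduct_comm v a,
        ha' v h4] at h3
      exact zero_ne_one h3

theorem support_draw_subset {α : Type} [Inhabited α] [Finite α] {S : Set α} (h : S.Nonempty) {a : α}
    (ha : a ∈ (draw S).support) : a ∈ S := by
  rwa [support_draw (Set.toFinite S) h] at ha

theorem DInv.exists_first {D : List (Vec k)} (hr : HasRoom D) :
    {v : Vec k | Even (hammingNorm v) ∧ v ∈ orthTo D ∧ v ∉ spanOf D}.Nonempty := by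
  obtain ⟨v, h1, h2, h3⟩ := exists_even_perp D D (by have := hr.two_mul_le; omega)
  exact ⟨v, h2, h1, h3⟩

theorem DInv.extendD_support {D : List (Vec k)} (h : DInv D) (hr : HasRoom D) {v : Vec k}
    (hv : v ∈ (extendD D).support) : 4 ∣ hammingNorm v ∧ v ∈ orthTo D ∧ v ∉ spanOf D := by
  obtain ⟨a, ha, hv⟩ := (PMF.mem_support_bind_iff _ _ _).mp hv
  obtain ⟨h1, h2, h3⟩ := support_draw_subset (DInv.exists_first hr) ha
  have hpure : ∀ x y : Vec k, x ∈ (pure y : PMF (Vec k)).support → x = y := fun x y hx =>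
    (PMF.mem_support_pure_iff _ _).mp hx
  split_ifs at hv with h4 h5
  · rw [hpure _ _ hv]
    exact ⟨h4, h2, h3⟩
  · obtain ⟨a₂, ha₂, hv⟩ := (PMF.mem_support_bind_iff _ _ _).mp hv
    obtain ⟨e1, e2, e3⟩ := support_draw_subset h5 ha₂
    rw [orthTo_concat] at e2
    rw [spanOf_append, spanOf_singleton, mem_sup_singleton] at e3
    push Not at e3
    split_ifs at hv with h6
    · rw [hpure _ _ hv]
      exact ⟨h6, e2.1, e3.1⟩
    · rw [hpure _ _ hv]
      refine ⟨?_, ?_, by rw [add_comm]; exact e3.2⟩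
      -- Both weights are 2 modulo 4 and the vectors are orthogonal, so the weight of the sum is
      -- divisible by 4.
      · have := hammingNorm_add_mod a a₂
        rw [e2.2, ZMod.val_zero] at this
        obtain ⟨s, hs⟩ := h1
        obtain ⟨t, ht⟩ := e1
        omega
      · rw [mem_orthTo] at *
        exact add_mem h2 e2.1
  · exact support_draw_subset (h.exists_next hr h1 h2 h3 h5) hv

theorem DInv.concat_of_support {D : List (Vec k)} (h : DInv D) (hr : HasRoom D) {v : Vec k}
    (hv : v ∈ (extendD D).support) : DInv (D ++ [v]) :=
  let ⟨h1, h2, h3⟩ := h.extendD_support hr hv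
  h.concat h1 h2 h3

/-- `HasRoom` for all lists shorter than `d`. -/
theorem hasRoom_of_lt {d : ℕ} {D : List (Vec k)} (h1 : 2 * d ≤ k)
    (h2 : k ≤ 2 * d + 1 → k % 8 = 0 ∨ k % 8 = 1 ∨ k % 8 = 7) (h : D.length < d) : HasRoom D where
  two_mul_le := by omega
  mod_eight := fun h' => h2 (by omega)

theorem DInv.growD_support {d : ℕ} (h1 : 2 * d ≤ k)
    (h2 : k ≤ 2 * d + 1 → k % 8 = 0 ∨ k % 8 = 1 ∨ k % 8 = 7) (t : ℕ) {D D' : List (Vec k)}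
    (h : DInv D) (ht : D.length + t ≤ d) (hD' : D' ∈ (growD t D).support) :
    DInv D' ∧ D'.length = D.length + t ∧ D ⊆ D' := by
  induction t generalizing D with
  | zero =>
    rw [(PMF.mem_support_pure_iff _ _).mp hD']
    exact ⟨h, rfl, fun _ => id⟩
  | succ t ih =>
    obtain ⟨c, hc, hD'⟩ := (PMF.mem_support_bind_iff _ _ _).mp hD'
    obtain ⟨e1, e2, e3⟩ := ih (h.concat_of_support (hasRoom_of_lt h1 h2 (by omega)) hc)
      (by simp; omega) hD'
    refine ⟨e1, ?_, fun x hx => e3 (by simp [hx])⟩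
    rw [e2]
    simp
    omega

theorem DInv.one (hk : 4 ∣ k) (hk' : 0 < k) : DInv [(1 : Vec k)] := by
  have := DInv.nil.concat (v := (1 : Vec k)) (k := k)
    (by simpa [hammingNorm_eq_sum, ZMod.val_one] using hk)
    (fun c hc => absurd hc (by simp)) (by
      rw [spanOf_nil, Submodule.mem_bot]
      intro h
      simpa using congrFun h ⟨0, hk'⟩)
  simpa using this

end IQP
namespace IQP

/-! ## The stabilizer construction: the columns of `F` -/

variable {k : ℕ}

theorem DInv.sampleD_support {n m g d : ℕ} (hq : (k, d) ∈ admissible n m g) {D : List (Vec k)}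
    (hD : D ∈ (sampleD k g d).support) :
    DInv D ∧ D.length = d ∧ (g = 0 → (1 : Vec k) ∈ spanOf D) := by
  obtain ⟨-, h2, -, -, h5, -, h7, h8⟩ := hq
  simp only at h2 h5 h7 h8
  rw [sampleD] at hD
  split_ifs at hD with hg
  · obtain ⟨e1, e2⟩ := h7 hg
    obtain ⟨i1, i2, i3⟩ := (DInv.one e1 h2).growD_support (d := d) (by omega) h8 (d - 1)
      (by simp; omega) hD
    refine ⟨i1, by rw [i2]; simp; omega, fun _ => mem_spanOf (i3 (by simp))⟩
  · obtain ⟨i1, i2, i3⟩ := DInv.nil.growD_support (d := d) (by omega) h8 d (by simp) hD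
    exact ⟨i1, by rw [i2]; simp, fun h => absurd h hg⟩

theorem dotProduct_eq_zero_of_mem {L : List (Vec k)} {u v : Vec k} (hu : u ∈ spanOf L)
    (hv : v ∈ orthTo L) : u ⬝ᵥ v = 0 := by
  rw [dotProduct_comm]
  exact mem_orthTo.mp hv u hu

theorem mem_orthTo_append {L L' : List (Vec k)} {v : Vec k} :
    v ∈ orthTo (L ++ L') ↔ v ∈ orthTo L ∧ v ∈ orthTo L' := by
  change v ∈ perp (L ++ L') ↔ v ∈ perp L ∧ v ∈ perp L'
  rw [perp_append, Submodule.mem_inf]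

theorem mem_orthTo_pair {a b v : Vec k} : v ∈ orthTo [a, b] ↔ a ⬝ᵥ v = 0 ∧ b ⬝ᵥ v = 0 := by
  change (∀ c ∈ [a, b], c ⬝ᵥ v = 0) ↔ _
  simp

/-- Adding two vectors with a nondegenerate Gram matrix. -/
theorem append_pair {L : List (Vec k)} {a b : Vec k} (ha : a ∈ orthTo L) (hb : b ∈ orthTo L)
    (hnd : ∀ r s : ZMod 2, a ⬝ᵥ (r • a + s • b) = 0 → b ⬝ᵥ (r • a + s • b) = 0 → r = 0 ∧ s = 0) :
    (∀ x ∈ spanOf (L ++ [a, b]), x ∈ orthTo (L ++ [a, b]) → x ∈ spanOf L) ∧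
      Module.finrank (ZMod 2) (spanOf (L ++ [a, b])) = Module.finrank (ZMod 2) (spanOf L) + 2 := by
  have key : ∀ r s : ZMod 2, r • a + s • b ∈ spanOf L → r = 0 ∧ s = 0 := fun r s h =>
    hnd r s (by rw [dotProduct_comm]; exact dotProduct_eq_zero_of_mem h ha)
      (by rw [dotProduct_comm]; exact dotProduct_eq_zero_of_mem h hb)
  have e : L ++ [a, b] = L ++ [a] ++ [b] := by simp
  constructor
  · intro x hx hx'
    rw [mem_orthTo_append, mem_orthTo_pair] at hx'
    rw [e, spanOf_append, spanOf_append, spanOf_singleton, spanOf_singleton] at hx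
    obtain ⟨y, hy, z, hz, rfl⟩ := Submodule.mem_sup.mp hx
    obtain ⟨u, hu, w, hw, rfl⟩ := Submodule.mem_sup.mp hy
    obtain ⟨r, rfl⟩ := Submodule.mem_span_singleton.mp hw
    obtain ⟨s, rfl⟩ := Submodule.mem_span_singleton.mp hz
    have h1 := hx'.2.1
    have h2 := hx'.2.2
    rw [add_assoc, dotProduct_add, dotProduct_comm a u, dotProduct_eq_zero_of_mem hu ha,
      zero_add] at h1
    rw [add_assoc, dotProduct_add, dotProduct_comm b u, dotProduct_eq_zero_of_mem hu hb,
      zero_add] at h2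
    obtain ⟨rfl, rfl⟩ := hnd r s h1 h2
    simpa using hu
  · rw [e, finrank_spanOf_concat, finrank_spanOf_concat]
    · intro h
      exact one_ne_zero (key 1 0 (by simpa using h)).1
    · intro h
      rw [spanOf_append, spanOf_singleton, mem_sup_singleton] at h
      rcases h with h | h
      · exact one_ne_zero (key 0 1 (by simpa using h)).2
      · exact one_ne_zero (key 1 1 (by simpa [add_comm] using h)).2

/-- The state of the construction of `F`: the span of the columns of `D` and `F` has the span of the
columns of `D` as radical, and contains the all-ones vector. -/
structure FInv (D F : List (Vec k)) : Prop where
  rad : ∀ v ∈ spanOf (D ++ F), v ∈ orthTo (D ++ F) → v ∈ spanOf D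
  orth : ∀ v ∈ spanOf D, v ∈ orthTo (D ++ F)
  rank : Module.finrank (ZMod 2) (spanOf (D ++ F)) = D.length + F.length
  one : (1 : Vec k) ∈ spanOf (D ++ F)

theorem DInv.orthTo {D : List (Vec k)} (h : DInv D) {v : Vec k} (hv : v ∈ spanOf D) :
    v ∈ orthTo D := mem_orthTo.mpr (h.even.le_dualCode hv)

theorem DInv.one_dotProduct {D : List (Vec k)} (h : DInv D) {v : Vec k} (hv : v ∈ spanOf D) :
    1 ⬝ᵥ v = 0 := (even_hammingNorm_iff v).mp (four_dvd_even (h.even v hv))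

theorem FInv.nil {D : List (Vec k)} (h : DInv D) (h1 : (1 : Vec k) ∈ spanOf D) : FInv D [] where
  rad := fun v hv _ => by simpa using hv
  orth := fun v hv => by simpa using h.orthTo hv
  rank := by rw [List.append_nil, h.rank]; rfl
  one := by simpa using h1

theorem FInv.singleton {D : List (Vec k)} (h : DInv D) (hk : Odd k) : FInv D [(1 : Vec k)] := by
  have h11 : (1 : Vec k) ⬝ᵥ 1 = 1 := by
    rw [one_dotProduct_one, Fintype.card_fin]
    exact ZMod.natCast_eq_one_iff_odd.mpr hk
  refine ⟨fun v hv hv' => ?_, fun v hv => ?_, ?_, mem_spanOf (by simp)⟩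
  · rw [spanOf_append, spanOf_singleton, mem_sup_singleton] at hv
    rcases hv with hv | hv
    · exact hv
    · have h2 := (orthTo_concat.mp hv').2
      have h3 := h.one_dotProduct hv
      rw [dotProduct_add, h2, h11] at h3
      simp at h3
  · exact orthTo_concat.mpr ⟨h.orthTo hv, h.one_dotProduct hv⟩
  · rw [finrank_spanOf_concat, h.rank, List.length_singleton]
    intro h1
    rw [h.one_dotProduct h1] at h11
    exact zero_ne_one h11

/-- For even k one has 1·1 = 0, while c·c = 1·c = 1, so the Gram matrix of (1 + c, c) is the
identity. The sum of the two columns is 1. -/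
theorem FInv.pair {D : List (Vec k)} (h : DInv D) (hk : ¬ Odd k) {c : Vec k} (hc : c ∈ orthTo D)
    (hc' : Odd (hammingNorm c)) : FInv D [1 + c, c] := by
  have h11 : (1 : Vec k) ⬝ᵥ 1 = 0 := by
    rw [one_dotProduct_one, Fintype.card_fin, ZMod.natCast_eq_zero_iff_even]
    exact Nat.not_odd_iff_even.mp hk
  have h1c : (1 : Vec k) ⬝ᵥ c = 1 := by
    rw [one_dotProduct_eq]
    exact ZMod.natCast_eq_one_iff_odd.mpr hc'
  have hcc : c ⬝ᵥ c = 1 := by rw [dotProduct_self_eq, h1c]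
  have hc1 : c ⬝ᵥ 1 = 1 := by rw [dotProduct_comm, h1c]
  have hone : (1 : Vec k) ∈ orthTo D := mem_orthTo.mpr fun w hw => h.one_dotProduct hw
  have hac : 1 + c ∈ IQP.orthTo D := by
    rw [mem_orthTo] at *
    exact add_mem hone hc
  obtain ⟨p1, p2⟩ := append_pair hac hc (by
    intro r s h1 h2
    simp only [dotProduct_add, add_dotProduct, dotProduct_smul, h11, h1c, hc1, hcc] at h1 h2
    revert h1 h2
    revert r s
    decide)
  refine ⟨p1, fun v hv => ?_, by rw [p2, h.rank]; rfl, ?_⟩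
  · rw [mem_orthTo_append, mem_orthTo_pair]
    refine ⟨h.orthTo hv, ?_, ?_⟩
    · rw [dotProduct_comm]
      exact dotProduct_eq_zero_of_mem hv hac
    · rw [dotProduct_comm]
      exact dotProduct_eq_zero_of_mem hv hc
  · have h2 : 1 + c + c ∈ spanOf (D ++ [1 + c, c]) :=
      add_mem (mem_spanOf (List.mem_append_right _ List.mem_cons_self)) (mem_spanOf (by simp))
    rwa [add_assoc, vec_add_self, add_zero] at h2

/-- The vector 1 is already in the span, so a·a = 1·a = 0 and the Gram matrix of (a, b) is
invertible whatever b·b is. -/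
theorem FInv.append {D F : List (Vec k)} (h : FInv D F) {a b : Vec k} (ha : a ∈ orthTo (D ++ F))
    (hb : b ∈ orthTo (D ++ F)) (hab : a ⬝ᵥ b = 1) : FInv D (F ++ [a, b]) := by
  have haa : a ⬝ᵥ a = 0 := by
    rw [dotProduct_self_eq]
    exact dotProduct_eq_zero_of_mem h.one ha
  have hba : b ⬝ᵥ a = 1 := by rw [dotProduct_comm, hab]
  obtain ⟨p1, p2⟩ := append_pair ha hb (by
    intro r s h1 h2
    simp only [dotProduct_add, dotProduct_smul, haa, hab, hba] at h1 h2
    generalize b ⬝ᵥ b = t at h1 h2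
    revert h1 h2
    revert r s t
    decide)
  have hD : ∀ v ∈ spanOf D, v ∈ spanOf (D ++ F) := fun v hv => spanOf_mono (by simp) hv
  refine ⟨?_, ?_, ?_, ?_⟩
  · intro v hv hv'
    rw [← List.append_assoc] at hv hv'
    exact h.rad v (p1 v hv hv') (mem_orthTo_append.mp hv').1
  · intro v hv
    rw [← List.append_assoc, mem_orthTo_append, mem_orthTo_pair]
    refine ⟨h.orth v hv, ?_, ?_⟩
    · rw [dotProduct_comm]
      exact dotProduct_eq_zero_of_mem (hD v hv) ha
    · rw [dotProduct_comm]
      exact dotProduct_eq_zero_of_mem (hD v hv) hb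
  · rw [← List.append_assoc, p2, h.rank]
    simp [add_assoc]
  · rw [← List.append_assoc]
    exact spanOf_mono (by simp) h.one

/-- The orthogonal space has dimension k - |D| - |F|, which exceeds |D|. -/
theorem FInv.exists_first {D F : List (Vec k)} (h : FInv D F)
    (hlt : 2 * D.length + F.length < k) :
    {v | v ∈ orthTo (D ++ F) ∧ v ∉ spanOf D}.Nonempty := by
  by_contra hcon
  have hle : perp (D ++ F) ≤ spanOf D := fun v hv => by
    by_contra hn
    exact hcon ⟨v, hv, hn⟩
  have h1 := finrank_spanOf_add_finrank_perp (D ++ F)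
  have h2 := h.rank
  have h3 := Submodule.finrank_mono hle
  have h4 := finrank_spanOf_le D
  omega

/-- The radical is span D, so `a` lies outside the whole span and can be separated from it. -/
theorem FInv.exists_second {D F : List (Vec k)} (h : FInv D F) {a : Vec k}
    (ha : a ∈ orthTo (D ++ F)) (ha' : a ∉ spanOf D) :
    {v | v ∈ orthTo (D ++ F) ∧ a ⬝ᵥ v = 1}.Nonempty := by
  obtain ⟨c, hc, hca⟩ := exists_perp fun h' => ha' (h.rad a h' ha)
  exact ⟨c, hc, by rw [dotProduct_comm, hca]⟩

theorem FInv.growF_support {D : List (Vec k)} (t : ℕ) {F F' : List (Vec k)} (h : FInv D F)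
    (ht : 2 * D.length + F.length + 2 * t ≤ k) (hF' : F' ∈ (growF D t F).support) :
    FInv D F' ∧ F'.length = F.length + 2 * t := by
  induction t generalizing F with
  | zero =>
    rw [(PMF.mem_support_pure_iff _ _).mp hF']
    exact ⟨h, rfl⟩
  | succ t ih =>
    obtain ⟨a, ha, hF'⟩ := (PMF.mem_support_bind_iff _ _ _).mp hF'
    obtain ⟨b, hb, hF'⟩ := (PMF.mem_support_bind_iff _ _ _).mp hF'
    obtain ⟨a1, a2⟩ := support_draw_subset (h.exists_first (by omega)) ha
    obtain ⟨b1, b2⟩ := support_draw_subset (h.exists_second a1 a2) hb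
    obtain ⟨e1, e2⟩ := ih (h.append a1 b1 b2) (by simp; omega) hF'
    refine ⟨e1, ?_⟩
    rw [e2]
    simp
    omega

/-- When 1 is already in span D, the first pair is an ordinary growth step from the empty list. -/
theorem sampleF_of_one_mem {g : ℕ} {D : List (Vec k)} (hg : 2 ≤ g) :
    (do
      let c₁ ← draw {v | v ∈ orthTo D ∧ v ∉ spanOf D}
      let c₂ ← draw {v | v ∈ orthTo D ∧ c₁ ⬝ᵥ v = 1}
      growF D ((g - 2) / 2) [c₁, c₂]) = growF D (g / 2) [] := by
  have : g / 2 = (g - 2) / 2 + 1 := by omega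
  rw [this, growF]
  simp only [List.append_nil, List.nil_append]

theorem FInv.sampleF_support {n m g d : ℕ} (hq : (k, d) ∈ admissible n m g) {D F : List (Vec k)}
    (h : DInv D) (hd : D.length = d) (hg : g = 0 → (1 : Vec k) ∈ spanOf D)
    (hF : F ∈ (sampleF g D).support) : FInv D F ∧ F.length = g := by
  obtain ⟨-, -, -, -, h5, h6, -, -⟩ := hq
  simp only at h5 h6
  rw [sampleF] at hF
  split_ifs at hF with h1 h2 h3
  · rw [(PMF.mem_support_pure_iff _ _).mp hF]
    exact ⟨FInv.nil h (hg h1), h1.symm⟩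
  · obtain ⟨t, ht⟩ := id h2
    obtain ⟨e1, e2⟩ := (FInv.singleton h h2).growF_support _ (by simp; omega) hF
    refine ⟨e1, ?_⟩
    rw [e2]
    simp
    omega
  · rw [Nat.not_odd_iff_even] at h2
    obtain ⟨t, ht⟩ := h2
    rw [sampleF_of_one_mem (by omega)] at hF
    obtain ⟨e1, e2⟩ := (FInv.nil h h3).growF_support _ (by simp; omega) hF
    refine ⟨e1, ?_⟩
    rw [e2]
    simp
    omega
  · obtain ⟨t, ht⟩ := Nat.not_odd_iff_even.mp h2
    obtain ⟨c, hc, hF⟩ := (PMF.mem_support_bind_iff _ _ _).mp hF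
    have hne : {v | v ∈ orthTo D ∧ Odd (hammingNorm v)}.Nonempty := by
      obtain ⟨c, hc, hc1⟩ := exists_perp h3
      refine ⟨c, hc, ZMod.natCast_eq_one_iff_odd.mp ?_⟩
      rw [← one_dotProduct_eq, dotProduct_comm, hc1]
    obtain ⟨c1, c2⟩ := support_draw_subset hne hc
    obtain ⟨e1, e2⟩ := (FInv.pair h h2 c1 c2).growF_support _ (by simp; omega) hF
    refine ⟨e1, ?_⟩
    rw [e2]
    simp
    omega

end IQP
namespace IQP

/-! ## Membership in the family -/

theorem span_range_col {ι : Type} [Fintype ι] {n : ℕ} (M : Matrix ι (Fin n) (ZMod 2)) :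
    Submodule.span (ZMod 2) (Set.range M.col) = LinearMap.range M.mulVecLin :=
  (Matrix.range_mulVecLin M).symm

/-- Restricted to the column space C, the matrix Mᵀ has kernel C ∩ C^⊥ and the image of MᵀM; then
apply rank–nullity. -/
theorem rank_gram {ι : Type} [Fintype ι] {n : ℕ} (M : Matrix ι (Fin n) (ZMod 2)) :
    (Mᵀ * M).rank + Module.finrank (ZMod 2) (Submodule.span (ZMod 2) (Set.range M.col) ⊓
      dualCode (Submodule.span (ZMod 2) (Set.range M.col)) : Submodule _ _) =
    Module.finrank (ZMod 2) (Submodule.span (ZMod 2) (Set.range M.col)) := by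
  set C := Submodule.span (ZMod 2) (Set.range M.col) with hC
  have hker : LinearMap.ker Mᵀ.mulVecLin = dualCode C := by
    ext v
    rw [LinearMap.mem_ker, Matrix.mulVecLin_apply, mem_dualCode]
    constructor
    · intro h w hw
      rw [hC, span_range_col] at hw
      obtain ⟨x, rfl⟩ := hw
      rw [Matrix.mulVecLin_apply, Matrix.dotProduct_mulVec, ← Matrix.mulVec_transpose, h,
        zero_dotProduct]
    · intro h
      ext j
      have := h (M.col j) (Submodule.subset_span ⟨j, rfl⟩)
      rw [dotProduct_comm] at this
      exact this
  have h1 := LinearMap.finrank_range_add_finrank_ker (Mᵀ.mulVecLin.domRestrict C)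
  have h2 : LinearMap.range (Mᵀ.mulVecLin.domRestrict C) = LinearMap.range (Mᵀ * M).mulVecLin := by
    rw [Matrix.mulVecLin_mul, LinearMap.range_comp, LinearMap.range_domRestrict, hC,
      span_range_col]
  have h3 : Module.finrank (ZMod 2) (LinearMap.ker (Mᵀ.mulVecLin.domRestrict C)) =
      Module.finrank (ZMod 2) (C ⊓ dualCode C : Submodule _ _) := by
    rw [← hker, ← Submodule.map_comap_subtype, Submodule.finrank_map_subtype_eq]
    rfl
  rw [h2, h3] at h1
  exact h1

/-- The number of rows of H_s and dim D_s of any member will do. The inequalities are dimension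
counts; the parity and the residues modulo 8 come from the form on the code and the Gauss sum. -/
theorem admissible_nonempty {n m g : ℕ} (h : (family n m g).Nonempty) :
    (admissible n m g).Nonempty := by
  classical
  obtain ⟨⟨H, s⟩, hne, hD, hg, hr⟩ := h
  simp only at hne hD hg hr
  set C := secretCode H s with hC
  have hgram := rank_gram (secretRows H s)
  change _ + Module.finrank (ZMod 2) (C ⊓ dualCode C : Submodule _ _) =
    Module.finrank (ZMod 2) C at hgram
  rw [hg] at hgram
  have hCr : Module.finrank (ZMod 2) C = (secretRows H s).rank := by
    rw [Matrix.rank_eq_finrank_span_cols]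
    rfl
  -- By the choice of rows, H_s s = 1.
  have h1 : (1 : {i : Fin m // (H *ᵥ s) i = 1} → ZMod 2) ∈ C := by
    rw [hC, secretCode, span_range_col]
    exact ⟨s, funext fun i => i.2⟩
  have hdual := finrank_add_finrank_dualCode C
  have hpar := even_finrank_add_card C h1
  have hDle : Module.finrank (ZMod 2) (C ⊓ dualCode C : Submodule _ _) ≤
      Module.finrank (ZMod 2) (dualCode C) := Submodule.finrank_mono inf_le_right
  have hmod := hD.card_mod_eight
  change Fintype.card _ ≤ 2 * Module.finrank (ZMod 2) (C ⊓ dualCode C : Submodule _ _) + 1 →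
    _ at hmod
  have hone : 4 ∣ hammingNorm (1 : {i : Fin m // (H *ᵥ s) i = 1} → ZMod 2) →
      4 ∣ Fintype.card {i : Fin m // (H *ᵥ s) i = 1} := by
    simp [hammingNorm_eq_sum, ZMod.val_one]
  have hcard : Fintype.card {i : Fin m // (H *ᵥ s) i = 1} ≤ m := by
    simpa using Fintype.card_subtype_le fun i : Fin m => (H *ᵥ s) i = 1
  have hwidth : (secretRows H s).rank ≤ n := by
    simpa using (secretRows H s).rank_le_card_width
  -- The rows orthogonal to s have to supply the rank that H_s lacks.
  have hrows : H.rank ≤ (secretRows H s).rank +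
      (m - Fintype.card {i : Fin m // (H *ᵥ s) i = 1}) := by
    rw [Matrix.rank_eq_finrank_span_row, Matrix.rank_eq_finrank_span_row]
    have e : Set.range H.row = Set.range (secretRows H s).row ∪
        Set.range (fun i : {i : Fin m // ¬ (H *ᵥ s) i = 1} => H.row i) := by
      ext v
      constructor
      · rintro ⟨i, rfl⟩
        by_cases hi : (H *ᵥ s) i = 1
        · exact Or.inl ⟨⟨i, hi⟩, rfl⟩
        · exact Or.inr ⟨⟨i, hi⟩, rfl⟩
      · rintro (⟨i, rfl⟩ | ⟨i, rfl⟩)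
        · exact ⟨i, rfl⟩
        · exact ⟨i, rfl⟩
    rw [e, Submodule.span_union]
    refine (Submodule.finrank_add_le_finrank_add_finrank _ _).trans
      (Nat.add_le_add_left ((finrank_range_le_card _).trans_eq ?_) _)
    rw [Fintype.card_subtype_compl, Fintype.card_fin]
  have hpos : 0 < Fintype.card {i : Fin m // (H *ᵥ s) i = 1} := Fintype.card_pos_iff.mpr hne
  rw [hr] at hrows
  set d := Module.finrank (ZMod 2) (C ⊓ dualCode C : Submodule _ _) with hd
  set k := Fintype.card {i : Fin m // (H *ᵥ s) i = 1} with hk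
  refine ⟨(k, d), by simp only; omega, hpos, hcard, by simp only; omega, by simp only; omega, ?_,
    fun hg0 => ?_, hmod⟩
  · obtain ⟨t, ht⟩ := hpar
    simp only
    omega
  -- For g = 0 the code is its own radical, so the nonzero vector 1 lies in the doubly even code.
  · have heq : C ⊓ dualCode C = C := Submodule.eq_of_le_of_finrank_eq inf_le_left (by omega)
    have h1D : (1 : {i : Fin m // (H *ᵥ s) i = 1} → ZMod 2) ∈ C ⊓ dualCode C := by rwa [heq]
    refine ⟨hone (hD 1 h1D), ?_⟩
    rw [Nat.one_le_iff_ne_zero]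
    intro h0
    simp only at h0
    rw [hd, Submodule.finrank_eq_zero] at h0
    rw [h0, Submodule.mem_bot] at h1D
    obtain ⟨i⟩ := hne
    exact one_ne_zero (congrFun h1D i)

/-! ### Invariance under relabelling of coordinates. -/

section Transport

variable {ι κ : Type} [Fintype ι] [Fintype κ]

theorem dotProduct_comp_symm (e : κ ≃ ι) (v w : κ → ZMod 2) :
    (v ∘ e.symm) ⬝ᵥ (w ∘ e.symm) = v ⬝ᵥ w :=
  Equiv.sum_comp e.symm fun i => v i * w i

theorem dualCode_map (e : κ ≃ ι) (C : Submodule (ZMod 2) (κ → ZMod 2)) :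
    dualCode (C.map (LinearEquiv.funCongrLeft (ZMod 2) (ZMod 2) e.symm).toLinearMap) =
      (dualCode C).map (LinearEquiv.funCongrLeft (ZMod 2) (ZMod 2) e.symm).toLinearMap := by
  ext v
  rw [mem_dualCode, Submodule.mem_map]
  constructor
  · intro h
    refine ⟨v ∘ e, fun w hw => ?_, funext fun i => congrArg v (e.apply_symm_apply i)⟩
    have := h _ (Submodule.mem_map_of_mem hw)
    rw [← dotProduct_comp_symm e]
    have h2 : (v ∘ e) ∘ e.symm = v := funext fun i => congrArg v (e.apply_symm_apply i)
    rw [h2]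
    exact this
  · rintro ⟨u, hu, rfl⟩ w hw
    obtain ⟨x, hx, rfl⟩ := Submodule.mem_map.mp hw
    exact (dotProduct_comp_symm e u x).trans (hu x hx)

theorem hammingNorm_comp_symm (e : κ ≃ ι) (v : κ → ZMod 2) :
    hammingNorm (v ∘ e.symm) = hammingNorm v := by
  rw [hammingNorm_eq_sum, hammingNorm_eq_sum]
  exact Equiv.sum_comp e.symm fun i => (v i).val

end Transport

/-- Apart from the rank of H, all conditions depend on the selected rows up to order only, so they
can be read off from `M`: its column space has radical span D and dimension |D| + |F|. -/
theorem mem_family_of {m n k : ℕ} {H : Matrix (Fin m) (Fin n) (ZMod 2)} {s : Vec n}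
    (e : Fin k ≃ {i : Fin m // (H *ᵥ s) i = 1}) (hk : 0 < k) {M : Matrix (Fin k) (Fin n) (ZMod 2)}
    (hM : ∀ i, M i = H (e i)) {D F : List (Vec k)} (hD : DInv D) (hF : FInv D F)
    (hspan : Submodule.span (ZMod 2) (Set.range M.col) = spanOf (D ++ F)) (hrank : H.rank = n) :
    (H, s) ∈ family n m F.length := by
  have hrad : spanOf (D ++ F) ⊓ dualCode (spanOf (D ++ F)) = spanOf D := by
    ext v
    rw [Submodule.mem_inf, ← mem_orthTo]
    exact ⟨fun h => hF.rad v h.1 h.2, fun h => ⟨spanOf_mono (by simp) h, hF.orth v h⟩⟩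
  have hcode : secretCode H s = (spanOf (D ++ F)).map
      (LinearEquiv.funCongrLeft (ZMod 2) (ZMod 2) e.symm).toLinearMap := by
    rw [← hspan, Submodule.map_span, ← Set.range_comp, secretCode]
    congr 2
    funext j i
    change H i j = M (e.symm i) j
    rw [hM, e.apply_symm_apply]
  refine ⟨⟨e ⟨0, hk⟩⟩, ?_, ?_, hrank⟩
  · simp only [secretSelfDual]
    rw [hcode, dualCode_map, ← Submodule.map_inf _ (LinearEquiv.injective _), hrad]
    rintro _ ⟨v, hv, rfl⟩
    have := hammingNorm_comp_symm e v
    change 4 ∣ hammingNorm (v ∘ e.symm)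
    rw [this]
    exact hD.even v hv
  · have hgram : (secretRows H s)ᵀ * secretRows H s = Mᵀ * M := by
      ext a b
      simp only [Matrix.mul_apply, Matrix.transpose_apply]
      rw [← Equiv.sum_comp e]
      refine Finset.sum_congr rfl fun i _ => ?_
      rw [hM]
      rfl
    have h1 := rank_gram M
    rw [hspan, hrad, hD.rank, hF.rank] at h1
    simp only
    rw [hgram]
    omega

/-- While the dimension is below n, vectors outside the span exist. One that is not orthogonal to s
is corrected by adding a row r of L with r·s = 1, which keeps it outside. -/
theorem addIndependentRows_support {n : ℕ} {s : Vec n} (t : ℕ) {L L' : List (Vec n)}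
    (ht : Module.finrank (ZMod 2) (spanOf L) + t ≤ n) (hs : ∃ r ∈ L, r ⬝ᵥ s = 1)
    (hL' : L' ∈ (addIndependentRows s t L).support) :
    ∃ P : List (Vec n), L' = L ++ P ∧ P.length = t ∧ (∀ p ∈ P, p ⬝ᵥ s = 0) ∧
      Module.finrank (ZMod 2) (spanOf L') = Module.finrank (ZMod 2) (spanOf L) + t := by
  induction t generalizing L with
  | zero =>
    rw [(PMF.mem_support_pure_iff _ _).mp hL']
    exact ⟨[], by simp⟩
  | succ t ih =>
    obtain ⟨p, hp, hL'⟩ := (PMF.mem_support_bind_iff _ _ _).mp hL'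
    obtain ⟨r, hr, hrs⟩ := hs
    have hne : {p | p ⬝ᵥ s = 0 ∧ p ∉ spanOf L}.Nonempty := by
      have : ∃ p, p ∉ spanOf L := by
        by_contra hcon
        push Not at hcon
        have : spanOf L = ⊤ := eq_top_iff.mpr fun p _ => hcon p
        rw [this, finrank_top] at ht
        simp at ht
      obtain ⟨p, hp⟩ := this
      rcases zmod_two_cases (p ⬝ᵥ s) with h | h
      · exact ⟨p, h, hp⟩
      · refine ⟨p + r, ?_, fun h' => hp ?_⟩
        · rw [add_dotProduct, h, hrs, CharTwo.add_self_eq_zero]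
        · simpa using sub_mem h' (mem_spanOf hr)
    obtain ⟨h1, h2⟩ := support_draw_subset hne hp
    obtain ⟨P, e1, e2, e3, e4⟩ := ih (by rw [finrank_spanOf_concat h2]; omega)
      ⟨r, by simp [hr], hrs⟩ hL'
    refine ⟨p :: P, by rw [e1]; simp, by simp [e2], ?_, ?_⟩
    · intro q hq
      rcases List.mem_cons.mp hq with rfl | hq
      · exact h1
      · exact e3 q hq
    · rw [e4, finrank_spanOf_concat h2]
      ring

theorem addRows_support {n : ℕ} {s : Vec n} (t : ℕ) {L L' : List (Vec n)}
    (hL' : L' ∈ (addRows s t L).support) :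
    ∃ P : List (Vec n), L' = L ++ P ∧ P.length = t ∧ ∀ p ∈ P, p ⬝ᵥ s = 0 := by
  induction t generalizing L with
  | zero =>
    rw [(PMF.mem_support_pure_iff _ _).mp hL']
    exact ⟨[], by simp⟩
  | succ t ih =>
    obtain ⟨p, hp, hL'⟩ := (PMF.mem_support_bind_iff _ _ _).mp hL'
    have h1 : p ⬝ᵥ s = 0 := support_draw_subset (S := {p | p ⬝ᵥ s = 0}) ⟨0, zero_dotProduct s⟩ hp
    obtain ⟨P, e1, e2, e3⟩ := ih hL'
    refine ⟨p :: P, by rw [e1]; simp, by simp [e2], ?_⟩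
    intro q hq
    rcases List.mem_cons.mp hq with rfl | hq
    · exact h1
    · exact e3 q hq

theorem span_range_getD {n k : ℕ} {L : List (Vec k)} (hL : L.length ≤ n) :
    Submodule.span (ZMod 2) (Set.range fun j : Fin n => L.getD j 0) = spanOf L := by
  apply le_antisymm
  · rw [Submodule.span_le]
    rintro _ ⟨j, rfl⟩
    by_cases hj : (j : ℕ) < L.length
    · simp only [List.getD_eq_getElem _ _ hj]
      exact mem_spanOf (List.getElem_mem hj)
    · simp only [List.getD_eq_default _ _ (not_lt.mp hj)]
      exact zero_mem _
  · refine spanOf_le fun v hv => ?_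
    obtain ⟨j, hj, rfl⟩ := List.getElem_of_mem hv
    exact Submodule.subset_span ⟨⟨j, by omega⟩, List.getD_eq_getElem _ _ hj⟩

/-- As (HQ)(Q⁻¹s) = Hs, the same rows are selected up to order; an invertible Q preserves the column
space of M and the rank of H. -/
theorem obfuscate_support {m n k : ℕ} {L P : List (Vec n)} {s : Vec n} (hk : 0 < k)
    (hLk : L.length = k) (hLP : (L ++ P).length = m) (hL : ∀ r ∈ L, r ⬝ᵥ s = 1)
    (hP : ∀ r ∈ P, r ⬝ᵥ s = 0) {M : Matrix (Fin k) (Fin n) (ZMod 2)}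
    (hM : ∀ (i : Fin k), M i = L[i]) {D F : List (Vec k)} (hD : DInv D) (hF : FInv D F)
    (hspan : Submodule.span (ZMod 2) (Set.range M.col) = spanOf (D ++ F))
    (hrank : Module.finrank (ZMod 2) (spanOf (L ++ P)) = n)
    {x : Matrix (Fin m) (Fin n) (ZMod 2) × Vec n}
    (hx : x ∈ (obfuscate (Matrix.of fun i => (L ++ P).getD i 0) s).support) :
    x ∈ family n m F.length := by
  obtain ⟨σ, -, hx⟩ := (PMF.mem_support_bind_iff _ _ _).mp hx
  obtain ⟨Q, -, hx⟩ := (PMF.mem_support_bind_iff _ _ _).mp hx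
  rw [(PMF.mem_support_pure_iff _ _).mp hx]
  set H : Matrix (Fin m) (Fin n) (ZMod 2) := Matrix.of fun i => (L ++ P).getD i 0 with hH
  have hQQ : Q.val * (Q⁻¹).val = 1 := Q.mul_inv
  have hQQ' : (Q⁻¹).val * Q.val = 1 := Q.inv_mul
  have hmul : ∀ i, ((H.submatrix σ id * Q.val) *ᵥ ((Q⁻¹).val *ᵥ s)) i = H (σ i) ⬝ᵥ s := fun i => by
    rw [Matrix.mulVec_mulVec, Matrix.mul_assoc, hQQ, Matrix.mul_one]
    rfl
  have hHs : ∀ i, H i ⬝ᵥ s = 1 ↔ (i : ℕ) < k := fun i => by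
    have hi : (i : ℕ) < (L ++ P).length := by rw [hLP]; exact i.2
    have e : H i = (L ++ P)[(i : ℕ)] := List.getD_eq_getElem _ _ hi
    rw [e, List.getElem_append]
    split_ifs with h
    · simp only [hL _ (List.getElem_mem h), true_iff]
      omega
    · simp only [hP _ (List.getElem_mem _), zero_ne_one, false_iff]
      omega
  have hkm : k ≤ m := by
    rw [← hLk, ← hLP, List.length_append]
    omega
  let e : Fin k ≃ {i : Fin m // ((H.submatrix σ id * Q.val) *ᵥ ((Q⁻¹).val *ᵥ s)) i = 1} :=
    { toFun := fun i => ⟨σ.symm (Fin.castLE hkm i), by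
        rw [hmul, Equiv.apply_symm_apply, hHs]
        exact i.2⟩
      invFun := fun i => ⟨σ i, (hHs _).mp ((hmul _).symm.trans i.2)⟩
      left_inv := fun i => by simp
      right_inv := fun i => by
        apply Subtype.ext
        simp }
  refine mem_family_of e hk (M := M * Q.val) (fun i => ?_) hD hF ?_ ?_
  · change (M * Q.val) i = (H.submatrix σ id * Q.val) (σ.symm (Fin.castLE hkm i))
    have hi : (i : ℕ) < (L ++ P).length := by rw [hLP]; omega
    have : M i = H (Fin.castLE hkm i) := by
      rw [hM]
      refine ((List.getD_eq_getElem _ _ hi).trans ?_).symm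
      exact List.getElem_append_left _
    funext j
    rw [Matrix.mul_apply', Matrix.mul_apply', this]
    congr 1
    funext a
    simp [Matrix.submatrix]
  · rw [← hspan, span_range_col, span_range_col, Matrix.mulVecLin_mul]
    refine LinearMap.range_comp_of_range_eq_top _ (LinearMap.range_eq_top.mpr fun v => ?_)
    exact ⟨(Q⁻¹).val *ᵥ v, by rw [Matrix.mulVecLin_apply, Matrix.mulVec_mulVec, hQQ,
      Matrix.one_mulVec]⟩
  · rw [Matrix.rank_mul_eq_left_of_isUnit_det _ _ (Matrix.isUnits_det_units Q),
      Matrix.rank_eq_finrank_span_row]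
    have e1 : Set.range (H.submatrix σ id).row = Set.range fun i : Fin m => (L ++ P).getD i 0 := by
      have : (H.submatrix σ id).row = (fun i : Fin m => (L ++ P).getD i 0) ∘ σ := rfl
      rw [this, σ.surjective.range_comp]
    rw [e1, span_range_getD hLP.le, hrank]

theorem stabilizerConstruction_support {n m g : ℕ} (h : (admissible n m g).Nonempty) :
    (stabilizerConstruction n m g).support ⊆ family n m g := by
  intro x hx
  obtain ⟨⟨k, d⟩, hq, hx⟩ := (PMF.mem_support_bind_iff _ _ _).mp hx
  have hfin : (admissible n m g).Finite := by
    refine ((Set.finite_Iic m).prod (Set.finite_Iic n)).subset ?_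
    rintro ⟨a, b⟩ ⟨h1, -, h3, -⟩
    exact ⟨h3, by simp only [Set.mem_Iic] at *; omega⟩
  rw [support_draw hfin h] at hq
  obtain ⟨D, hD, hx⟩ := (PMF.mem_support_bind_iff _ _ _).mp hx
  obtain ⟨F, hF, hx⟩ := (PMF.mem_support_bind_iff _ _ _).mp hx
  obtain ⟨iD, lD, oD⟩ := DInv.sampleD_support hq hD
  obtain ⟨iF, lF⟩ := FInv.sampleF_support hq iD lD oD hF
  obtain ⟨s, hs, hx⟩ := (PMF.mem_support_bind_iff _ _ _).mp hx
  obtain ⟨L, hL, hx⟩ := (PMF.mem_support_bind_iff _ _ _).mp hx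
  obtain ⟨L', hL', hx⟩ := (PMF.mem_support_bind_iff _ _ _).mp hx
  obtain ⟨q1, q2, q3, q4, q5, -, -, -⟩ := hq
  simp only at q1 q2 q3 q4 q5
  set M : Matrix (Fin k) (Fin n) (ZMod 2) := Matrix.of fun i j => (F ++ D).getD j 0 i with hM
  have hspan : Submodule.span (ZMod 2) (Set.range M.col) = spanOf (D ++ F) := by
    have : M.col = fun j : Fin n => (F ++ D).getD j 0 := rfl
    rw [this, span_range_getD (by simp; omega), spanOf_append, spanOf_append, sup_comm]
  -- Solvable because `FInv` keeps 1 in the column space.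
  have hone : {s : Vec n | M *ᵥ s = 1}.Nonempty := by
    have := iF.one
    rw [← hspan, span_range_col] at this
    obtain ⟨v, hv⟩ := this
    exact ⟨v, hv⟩
  have hMs : M *ᵥ s = 1 := support_draw_subset hone hs
  have hrow : ∀ r ∈ List.ofFn M, r ⬝ᵥ s = 1 := by
    intro r hr
    obtain ⟨i, rfl⟩ := (List.mem_ofFn' _ _).mp hr
    exact congrFun hMs i
  have hMrank : Module.finrank (ZMod 2) (spanOf (List.ofFn M)) = g + d := by
    have e : {v | v ∈ List.ofFn M} = Set.range M.row := by
      ext v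
      exact List.mem_ofFn' _ _
    rw [spanOf, e, ← Matrix.rank_eq_finrank_span_row, Matrix.rank_eq_finrank_span_cols, hspan,
      iF.rank, lD, lF, add_comm]
  have hlen : (List.ofFn M).length = k := List.length_ofFn
  obtain ⟨P, rfl, p2, p3, p4⟩ := addIndependentRows_support _ (by omega)
    ⟨M ⟨0, q2⟩, (List.mem_ofFn' _ _).mpr ⟨_, rfl⟩, congrFun hMs _⟩ hL
  obtain ⟨P', rfl, p2', p3'⟩ := addRows_support _ hL'
  rw [List.append_assoc] at hx
  rw [← lF]
  refine obfuscate_support (L := List.ofFn M) (P := P ++ P') q2 hlen ?_ hrow ?_ (M := M) ?_ iD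
    iF hspan ?_ hx
  · rw [List.length_append, List.length_append, hlen]
    omega
  · intro r hr
    rcases List.mem_append.mp hr with hr | hr
    · exact p3 r hr
    · exact p3' r hr
  · intro i
    exact (List.getElem_ofFn _).symm
  · apply le_antisymm
    · simpa using Submodule.finrank_le (spanOf (List.ofFn M ++ (P ++ P')))
    · have h1 : Module.finrank (ZMod 2) (spanOf (List.ofFn M ++ P)) ≤
          Module.finrank (ZMod 2) (spanOf (List.ofFn M ++ (P ++ P'))) :=
        Submodule.finrank_mono (spanOf_mono (by rw [← List.append_assoc]; simp))
      omega

end IQP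
namespace IQP

/-! ## Programs that grow lists of vectors -/

variable {K N : ℕ} {μ : Mem}

theorem RowList.concat {μ' : Mem} {x lo : ℕ} {L : List (Vec K)} {v : Vec K}
    (h : RowList μ x lo L) (hμ : ∀ i < L.length, μ' x (lo + i) = μ x (lo + i))
    (hv : Row μ' x (lo + L.length) v) : RowList μ' x lo (L ++ [v]) := by
  intro i hi
  simp only [List.length_append, List.length_singleton] at hi
  by_cases h' : i < L.length
  · rw [List.getElem_append_left h']
    exact (h i h').congr (hμ i h')
  · obtain rfl : i = L.length := by omega
    simpa using hv

/-- The rows of an array, starting with the first one, up to the number in a variable. -/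
abbrev Rng.stack (x c : ℕ) : Rng := ⟨x, .lit 0, .var c⟩

/-- Append the vector in array 33 to a list of vectors. -/
def Prog.push (x c : ℕ) : Prog :=
  .seq (.copyRow x (.var c) 33 (.lit 0)) (.assign c (.add (.var c) (.lit 1)))

@[simp] theorem Prog.writes_push (x c : ℕ) : (push x c).writes = [13, x, 13, c] := rfl

theorem Hoare.push {x c : ℕ} {L : List (Vec K)} {v : Vec K} (hK : μ 10 0 0 = K) (hKN : K ≤ N)
    (hx : x ≠ 10 ∧ x ≠ 13 ∧ x ≠ 33) (hc : c ≠ 13 ∧ c ≠ x) (h : (Rng.stack x c).Holds N μ L)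
    (hL : L.length + 1 ≤ N) (hv : Row μ 33 0 v) :
    Hoare N (.push x c) μ fun μ' => (Rng.stack x c).Holds N μ' (L ++ [v]) := by
  have e : μ c 0 0 = L.length := h.1
  refine Hoare.seq (Hoare.copyRow hK hKN ⟨hx.1, hx.2.1⟩ (by omega) (by simp [Expr.avoids, hc]) rfl
    hv (Or.inl hx.2.2)) fun μ₁ h₁ F₁ => Hoare.set ⟨?_, ?_, by simpa using hL⟩
  · have e₁ : μ₁ c 0 0 = L.length := by rw [F₁ c (by simp [hc]), e]
    simp [Expr.eval, e₁]
  · refine RowList.concat (μ := μ) h.2.1 (fun i hi => ?_) ?_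
    · rw [Mem.write_of_ne _ hc.2.symm]
      exact h₁.2.2 _ (by simp [Expr.eval, e]; omega)
    · refine Row.frame ?_ (Frame.write _ _ _ _ _) (by simpa using hc.2.symm)
      simpa [Expr.eval, e] using h₁.1

/-- Store the Hamming weight modulo 4 of a vector in the variable 16. -/
def Prog.weight (x : ℕ) (i : Expr) : Prog :=
  .seq (.assign 16 (.lit 0)) (.forTo 13 (.var 10) (.cond (.cell x i (.var 13))
    (.cond (.sub (.var 16) (.lit 2)) (.assign 16 (.lit 0)) (.assign 16 (.add (.var 16) (.lit 1))))
    .skip))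

@[simp] theorem Prog.writes_weight (x : ℕ) (i : Expr) :
    (weight x i).writes = [16, 13, 16, 16, 13] := rfl

theorem hammingNorm_eq_sum_ext (v : Vec K) :
    hammingNorm v = ∑ j ∈ Finset.range K, (IQP.ext v j).val := by
  rw [hammingNorm_eq_sum, Finset.sum_range]
  simp

theorem Hoare.weight {x : ℕ} {i : Expr} {v : Vec K} (hK : μ 10 0 0 = K) (hKN : K ≤ N)
    (hx : x ≠ 13 ∧ x ≠ 16) (hi : i.avoids [13, 16] = true) (hv : Row μ x (i.eval μ) v) :
    Hoare N (.weight x i) μ fun μ' => μ' 16 0 0 = hammingNorm v % 4 := by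
  refine Hoare.set_seq ?_
  have hF : Frame [13, 16] μ (μ.write 16 0 0 0) := (Frame.write μ 16 0 0 0).mono (by simp)
  refine Hoare.conseq (Hoare.forTo
    (fun t μ' => μ' 16 0 0 = (∑ j ∈ Finset.range t, (IQP.ext v j).val) % 4) K
    (by simp) rfl ?_ hKN ?_ ?_) ?_
  · simpa [Expr.eval] using hK
  · simp [Expr.eval]
  · intro t ht μ' hI hv' hfr
    have hfr' : Frame [13, 16] μ μ' := hF.trans (hfr.mono (by simp))
    have e : (Expr.cell x i (.var 13)).eval μ' = (IQP.ext v t).val := by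
      simp only [Expr.eval, hfr'.eval hi, hv', hfr' x (by simp [hx]), hv.ext ht]
    have hlt : (IQP.ext v t).val < 2 := ZMod.val_lt _
    rw [Finset.sum_range_succ]
    refine Sim.cond (fun h => Sim.cond (fun h' => Hoare.set ?_) fun h' => Hoare.set ?_)
      fun h => Hoare.skip ?_
    · rw [e] at h
      simp only [Expr.eval, hI] at h'
      simp [Expr.eval]
      omega
    · rw [e] at h
      simp only [Expr.eval, hI] at h'
      simp [Expr.eval, hI]
      omega
    · rw [e] at h
      simpa [h] using hI
  · intro μ' h _
    simpa only [hammingNorm_eq_sum_ext] using h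

/-! ## Sampling the doubly even code -/

/-- The columns of `D` sampled so far. -/
abbrev dRng : Rng := .stack 35 23

/-- The all-ones vector. -/
abbrev oneRng : Rng := ⟨36, .lit 0, .lit 1⟩

/-- No vectors. -/
abbrev noRng : Rng := ⟨36, .lit 0, .lit 0⟩

theorem Rng.holds_nil (r : Rng) (h : r.cnt = .lit 0) : r.Holds N μ ([] : List (Vec K)) :=
  ⟨by rw [h]; rfl, fun i hi => absurd hi (by simp), by simp⟩

theorem Rng.holds_singleton {r : Rng} {v : Vec K} (h : r.cnt = .lit 1) (hN : 1 ≤ N)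
    (hv : Row μ r.arr (r.lo.eval μ) v) : r.Holds N μ [v] := by
  refine ⟨by rw [h]; rfl, fun i hi => ?_, by simpa using hN⟩
  obtain rfl : i = 0 := by simpa using hi
  exact hv

/-- Sample a further column of `D`. -/
def Prog.extendD : Prog :=
  .seq (.drawNot dRng oneRng dRng) (.seq (.copyRow 35 (.var 23) 33 (.lit 0)) (.seq
  (.weight 33 (.lit 0)) (.seq (.cond (.var 16)
    (.seq (.prepNot ⟨35, .lit 0, .add (.var 23) (.lit 1)⟩ oneRng
        ⟨35, .lit 0, .add (.var 23) (.lit 1)⟩)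
      (.cond (.sub (.var 12) (.var 11))
        (.seq (.pick 30) (.seq (.weight 33 (.lit 0)) (.cond (.var 16) (.xorRow 35 (.var 23) 33 (.lit 0))
          (.copyRow 35 (.var 23) 33 (.lit 0)))))
        (.seq (.drawTest dRng oneRng ⟨35, .var 23, .lit 1⟩) (.copyRow 35 (.var 23) 33 (.lit 0)))))
    .skip) (.assign 23 (.add (.var 23) (.lit 1))))))

/-- The arrays and variables written to when sampling `D`. -/
abbrev extendVars : List ℕ := 16 :: 23 :: 35 :: drawVars

theorem Prog.writes_extendD : extendD.writes ⊆ extendVars := by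
  simp only [extendD, writes, List.append_subset, and_assoc]
  exact ⟨List.Subset.trans (writes_drawNot _ _ _) (by simp), by simp, by simp,
    List.Subset.trans (writes_prepNot _ _ _) (by simp),
    List.Subset.trans (writes_pick _) (by simp), by simp, by simp,
    by simp, List.Subset.trans (writes_drawTest _ _ _) (by simp), by simp, by simp, by simp⟩

theorem Sim.extendD {D : List (Vec K)} (hD : DInv D) (hr : HasRoom D) (hK : μ 10 0 0 = K)
    (hKN : K ≤ N) (h : dRng.Holds N μ D) (h1 : Row μ 36 0 (1 : Vec K)) :
    Sim N .extendD μ (extendD D) fun v μ' => dRng.Holds N μ' (D ++ [v]) := by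
  have hlen := hr.two_mul_le
  have e23 : μ 23 0 0 = D.length := h.1
  -- Even weight is orthogonality to 1, which gives the draw the form V \ W.
  have hset : ∀ L : List (Vec K), ∀ v, v ∈ {v : Vec K | Even (hammingNorm v) ∧ v ∈ orthTo L ∧
      v ∉ spanOf L} ↔ v ∈ orthTo (L ++ [1]) ∧ v ∉ spanOf L := fun L v => by
    rw [orthTo_concat, ← even_hammingNorm_iff]
    exact ⟨fun h => ⟨⟨h.2.1, h.1⟩, h.2.2⟩, fun h => ⟨h.1.2, h.1.1, h.2⟩⟩
  -- The candidate sits in row |D| of array 35 before the counter 23 is advanced; `Good` says that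
  -- everything else this program relies on is intact.
  let Good : Mem → Prop := fun μ' => μ' 10 0 0 = K ∧ μ' 23 0 0 = D.length ∧ μ' 36 = μ 36 ∧
    ∀ i, i ≠ D.length → μ' 35 i = μ 35 i
  have good0 : Good μ := ⟨hK, e23, rfl, fun _ _ => rfl⟩
  have goodF : ∀ {μ₁ μ₂}, Good μ₁ → Frame (16 :: drawVars) μ₁ μ₂ → Good μ₂ := fun g F =>
    ⟨by rw [F 10 (by simp), g.1], by rw [F 23 (by simp), g.2.1], by rw [F 36 (by simp), g.2.2.1],
      fun i hi => by rw [F 35 (by simp), g.2.2.2 i hi]⟩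
  have goodX : ∀ {μ₁ μ₂}, Good μ₁ → Frame [13, 35] μ₁ μ₂ →
      (∀ i, i ≠ (Expr.var 23).eval μ₁ → μ₂ 35 i = μ₁ 35 i) → Good μ₂ := fun {μ₁ μ₂} g F e =>
    ⟨by rw [F 10 (by simp), g.1], by rw [F 23 (by simp), g.2.1], by rw [F 36 (by simp), g.2.2.1],
      fun i hi => by rw [e i (by simpa only [Expr.eval, g.2.1] using hi), g.2.2.2 i hi]⟩
  have goodOne : ∀ {μ'}, Good μ' → oneRng.Holds N μ' [(1 : Vec K)] := fun {μ'} g =>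
    Rng.holds_singleton rfl (by omega) (h1.congr (by rw [g.2.2.1]))
  have goodD : ∀ {μ'}, Good μ' → dRng.Holds N μ' D := fun {μ'} g =>
    ⟨g.2.1, fun i hi => (h.2.1 i hi).congr (g.2.2.2 _ (by simp only [Expr.eval]; omega)), h.2.2⟩
  have goodC : ∀ {μ'} {v : Vec K}, Good μ' → Row μ' 35 D.length v →
      RowList μ' 35 0 (D ++ [v]) := fun {μ' v} g hv =>
    RowList.concat (goodD g).2.1 (fun _ _ => rfl) (by simpa [Expr.eval] using hv)
  have hcopy : ∀ {μ'} {v : Vec K}, Good μ' → Row μ' 33 0 v →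
      Hoare N (.copyRow 35 (.var 23) 33 (.lit 0)) μ' fun μ'' => Good μ'' ∧
        Row μ'' 35 D.length v := fun {μ' v} g hv =>
    (Hoare.copyRow g.1 hKN (by simp) (by simp) rfl rfl hv (Or.inl (by simp))).conseq
      fun μ'' h F => ⟨goodX g (F.mono (by simp)) h.2.2, by simpa only [Expr.eval, g.2.1] using h.1⟩
  refine Sim.seq (Sim.drawNot rfl rfl rfl hK hKN h (goodOne good0) h (hset D))
    fun a ha μ₁ ra F₁ => ?_
  have g₁ := goodF good0 (F₁.mono (List.Subset.trans (Prog.writes_drawNot _ _ _) (by simp)))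
  obtain ⟨ha1, ha2, ha3⟩ := support_draw_subset (DInv.exists_first hr) ha
  refine Hoare.seq_sim (hcopy g₁ ra) fun μ₂ ⟨g₂, r₂⟩ F₂ => ?_
  have r₂' := ra.frame F₂ (by simp)
  refine Hoare.seq_sim (Hoare.weight (v := a) g₂.1 hKN (by simp) rfl r₂') fun μ₃ w₃ F₃ => ?_
  have g₃ := goodF g₂ (F₃.mono (by simp))
  have r₃ := r₂.frame F₃ (by simp)
  refine Sim.seq_hoare (Q := fun c μ' => Good μ' ∧ Row μ' 35 D.length c) ?_ fun c _ μ' hc _ => ?_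
  · by_cases h4 : 4 ∣ hammingNorm a
    · rw [if_pos h4]
      refine Sim.cond (fun h0 => absurd (Nat.mod_eq_zero_of_dvd h4) ?_) fun _ =>
        Hoare.sim_pure a (Hoare.skip ⟨g₃, r₃⟩)
      rw [← w₃]
      exact h0
    rw [if_neg h4]
    refine Sim.cond (fun _ => ?_) fun h0 => absurd (Nat.dvd_of_mod_eq_zero (w₃.symm.trans h0)) h4
    have c₃ : (⟨35, .lit 0, .add (.var 23) (.lit 1)⟩ : Rng).Holds N μ₃ (D ++ [a]) :=
      ⟨by simp [Expr.eval, g₃.2.1], goodC g₃ r₃, by simp; omega⟩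
    refine Hoare.seq_sim (Hoare.prepNot rfl rfl rfl g₃.1 hKN c₃ (goodOne g₃) c₃)
      fun μ₄ p₄ F₄ => ?_
    replace F₄ := F₄.mono (Prog.writes_prepNot _ _ _)
    have g₄ := goodF g₃ (F₄.mono (by simp))
    have r₄ := r₃.frame F₄ (by simp)
    have hset' : ∀ v, v ∈ {v : Vec K | Even (hammingNorm v) ∧ v ∈ orthTo (D ++ [a]) ∧
        v ∉ spanOf (D ++ [a])} ↔ v ∈ perp (D ++ [a]) ⊓ perp [1] ∧
          v ∉ perp (D ++ [a]) ⊓ perp [1] ⊓ spanOf (D ++ [a]) := fun v => by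
      rw [hset, ← perp_append]
      change v ∈ perp _ ∧ _ ↔ _
      simp only [Submodule.mem_inf]
      tauto
    have hne := p₄.nonempty_iff
    rw [← Set.ext hset'] at hne
    by_cases h5 : {v : Vec K | Even (hammingNorm v) ∧ v ∈ orthTo (D ++ [a]) ∧
        v ∉ spanOf (D ++ [a])}.Nonempty
    · rw [if_pos h5]
      refine Sim.cond (fun _ => ?_) fun h0 => absurd h0 (hne.mpr h5)
      refine Sim.seq (p₄.sim_pick g₄.1 hKN hset') fun b _ μ₅ rb F₅ => ?_
      replace F₅ := F₅.mono (Prog.writes_pick _)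
      have g₅ := goodF g₄ (F₅.mono (by simp))
      have r₅ := r₄.frame F₅ (by simp)
      refine Hoare.seq_sim (Hoare.weight (v := b) g₅.1 hKN (by simp) rfl rb) fun μ₆ w₆ F₆ => ?_
      have g₆ := goodF g₅ (F₆.mono (by simp))
      have r₆ := r₅.frame F₆ (by simp)
      have rb' := rb.frame F₆ (by simp)
      by_cases h6 : 4 ∣ hammingNorm b
      · rw [if_pos h6]
        refine Sim.cond (fun h0 => absurd (Nat.mod_eq_zero_of_dvd h6) ?_) fun _ =>
          Hoare.sim_pure b (hcopy g₆ rb')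
        rw [← w₆]
        exact h0
      · rw [if_neg h6]
        refine Sim.cond (fun _ => Hoare.sim_pure (a + b) ?_) fun h0 =>
          absurd (Nat.dvd_of_mod_eq_zero (w₆.symm.trans h0)) h6
        refine (Hoare.xorRow (v := a) (w := b) g₆.1 hKN (by simp) (by simp) rfl rfl
          (by simpa only [Expr.eval, g₆.2.1] using r₆) rb' (by simp)).conseq fun μ₇ h F => ?_
        exact ⟨goodX g₆ (F.mono (by simp)) h.2, by simpa only [Expr.eval, g₆.2.1] using h.1⟩
    · rw [if_neg h5]
      refine Sim.cond (fun h0 => absurd (hne.mp h0) h5) fun _ => ?_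
      -- The weight condition modulo 4 is not linear, but in this branch it amounts to a·v = 1.
      rw [hD.set_eq ha1 ha2 h4 h5 (hD.exists_next hr ha1 ha2 ha3 h5)]
      refine Sim.seq_hoare (Sim.drawTest (L₃ := [a]) rfl rfl rfl g₄.1 hKN (goodD g₄) (goodOne g₄)
        (Rng.holds_singleton rfl (by omega) (by simpa only [Expr.eval, g₄.2.1] using r₄))
        fun v => ?_) fun c _ μ₅ rc F₅ => ?_
      · rw [orthTo_concat, ← even_hammingNorm_iff]
        change _ ↔ _ ∧ ¬ ∀ c ∈ [a], c ⬝ᵥ v = 0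
        simp only [List.mem_singleton, forall_eq, Set.mem_ofPred_eq]
        rcases zmod_two_cases (a ⬝ᵥ v) with h0 | h0 <;> simp [h0]
      · exact hcopy (goodF g₄ (F₅.mono
          (List.Subset.trans (Prog.writes_drawTest _ _ _) (by simp)))) rc
  · refine Hoare.set ⟨?_, ?_, by simp; omega⟩
    · simp [Expr.eval, hc.1.2.1]
    · exact (goodC hc.1 hc.2).frame (Frame.write _ _ _ _ _) (by simp)

theorem growD_eq_iter (t i : ℕ) (D : List (Vec K)) :
    growD t D = iter (fun _ D => (extendD D).map fun v => D ++ [v]) t i D := by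
  induction t generalizing i D with
  | zero => rfl
  | succ t ih =>
    rw [growD, iter, PMF.bind_map]
    change (extendD D).bind _ = _
    congr 1
    funext v
    exact ih (i + 1) _


/-- The input parameter `g`. -/
abbrev Expr.g : Expr := .cell 0 (.lit 0) (.lit 2)

/-- Sample the columns of `D`. For `g = 0` the first one is the all-ones vector. -/
def Prog.sampleD : Prog :=
  .seq (.assign 23 (.lit 0)) (.seq
  (.cond .g .skip (.seq (.copyRow 35 (.lit 0) 36 (.lit 0)) (.assign 23 (.lit 1))))
  (.forTo 25 (.sub (.var 22) (.sub (.lit 1) .g)) .extendD))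

theorem Prog.writes_sampleD : sampleD.writes ⊆ 25 :: extendVars := by
  simp only [sampleD, writes, List.append_subset, writes_forTo, List.cons_subset]
  exact ⟨by simp, ⟨by simp, by simp, by simp⟩, by simp,
    List.Subset.trans writes_extendD (by simp), by simp⟩

theorem Sim.sampleD {n m g d : ℕ} (hq : (K, d) ∈ admissible n m g) (hg : μ 0 0 2 = g)
    (hd : μ 22 0 0 = d) (hK : μ 10 0 0 = K) (hKN : K ≤ N) (h1 : Row μ 36 0 (1 : Vec K)) :
    Sim N .sampleD μ (sampleD K g d) fun D μ' => dRng.Holds N μ' D := by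
  obtain ⟨-, -, -, -, h5, -, h7, h8⟩ := id hq
  simp only at h5 h7 h8
  -- Common to both cases: `d - (1 - g)` is d - 1 for g = 0 and d otherwise.
  have key : ∀ (D₀ : List (Vec K)) (t : ℕ) (μ' : Mem), D₀.length + t = d → t = d - (1 - g) →
      DInv D₀ → dRng.Holds N μ' D₀ → Frame [13, 23, 35] μ μ' →
      Sim N (.forTo 25 (.sub (.var 22) (.sub (.lit 1) .g)) .extendD) μ' (growD t D₀)
        fun D μ'' => dRng.Holds N μ'' D := by
    intro D₀ t μ' ht ht' hD₀ hol F
    rw [growD_eq_iter t 0]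
    refine (Sim.forTo (e := .sub (.var 22) (.sub (.lit 1) .g)) _
      (fun i D μ'' => dRng.Holds N μ'' D ∧ DInv D ∧ D.length = D₀.length + i) t
      D₀ (fun h => by simpa using Prog.writes_extendD h) ?_ ?_ (by omega) ⟨?_, hD₀, rfl⟩ ?_).conseq
      fun D _ μ'' h _ => h.1
    · refine Expr.avoids_mono (ws := 25 :: extendVars) ?_ rfl
      exact List.cons_subset_cons _ Prog.writes_extendD
    · simp only [Expr.eval, F 22 (by simp), F 0 (by simp), hd, hg, ht']
    · exact hol.frame (ws := [25]) rfl (Frame.write _ _ _ _ _)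
    · rintro i hi D μ₁ ⟨a1, a2, a3⟩ hv F₁
      replace F₁ := F.append (F₁.mono (List.cons_subset_cons _ Prog.writes_extendD))
      refine Sim.map _ (Sim.extendD a2 (hasRoom_of_lt (d := d) (by omega) h8 (by omega)) ?_ hKN a1 ?_)
        fun v hv' μ₂ h₂ F₂ => ⟨h₂.frame (ws := [25]) rfl (Frame.write _ _ _ _ _),
          a2.concat_of_support (hasRoom_of_lt (d := d) (by omega) h8 (by omega)) hv', ?_⟩
      · rw [F₁ 10 (by simp), hK]
      · exact h1.frame F₁ (by simp)
      · simp; omega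
  rw [IQP.sampleD]
  refine Hoare.set_seq ?_
  have F₁ : Frame [23] μ (μ.write 23 0 0 0) := Frame.write _ _ _ _ _
  by_cases h0 : g = 0
  · rw [if_pos h0]
    obtain ⟨e1, e2⟩ := h7 h0
    have hK0 : 0 < K := by omega
    refine Hoare.seq_sim (Q := fun μ' => dRng.Holds N μ' [(1 : Vec K)]) (Sim.cond (fun h => ?_) fun _ =>
      ?_) fun μ₂ h₂ F₂ => key _ _ _ ?_ ?_ (DInv.one e1 hK0) h₂
      ((F₁.append F₂).mono (by simp))
    · simp [Expr.eval, hg, h0] at h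
    · refine Hoare.seq (Hoare.copyRow (v := (1 : Vec K)) (by simpa using hK) hKN (by simp) (by simp)
        rfl rfl (h1.frame F₁ (by simp)) (by simp)) fun μ₂ h₂ F₂ => Hoare.set ⟨?_, ?_, ?_⟩
      · simp [Expr.eval]
      · intro i hi
        obtain rfl : i = 0 := by simpa using hi
        exact h₂.1.frame (Frame.write _ _ _ _ _) (by simp)
      · simp; omega
    · simp; omega
    · omega
  · rw [if_neg h0]
    refine Hoare.seq_sim (Q := fun μ' => dRng.Holds N μ' ([] : List (Vec K))) (Sim.cond (fun _ =>
      Hoare.skip ⟨?_, fun i hi => absurd hi (by simp), by simp⟩) fun h => ?_) fun μ₂ h₂ F₂ =>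
      key _ _ _ (by simp) (by omega) DInv.nil h₂ ((F₁.append F₂).mono (by simp))
    · simp [Expr.eval]
    · simp [Expr.eval, hg, h0] at h

end IQP
namespace IQP

variable {K N : ℕ} {μ : Mem}

/-! ## Sampling the columns of `F` -/

/-- The columns of `F` sampled so far. -/
abbrev fRng : Rng := .stack 34 24

/-- Sample two further columns of `F`. -/
def Prog.extendF : Prog :=
  .seq (.drawNot dRng fRng dRng) (.seq (.push 34 24) (.seq
  (.drawTest dRng ⟨34, .lit 0, .sub (.var 24) (.lit 1)⟩ ⟨34, .sub (.var 24) (.lit 1), .lit 1⟩)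
  (.push 34 24)))

theorem Prog.writes_extendF : extendF.writes ⊆ 24 :: 34 :: drawVars := by
  simp only [extendF, writes, List.append_subset]
  exact ⟨List.Subset.trans (writes_drawNot _ _ _) (by simp), by simp,
    List.Subset.trans (writes_drawTest _ _ _) (by simp), by simp⟩

/-- Two further columns of `F`. -/
noncomputable def extendF (D F : List (Vec K)) : PMF (List (Vec K)) := do
  let a ← draw {v | v ∈ orthTo (D ++ F) ∧ v ∉ spanOf D}
  let b ← draw {v | v ∈ orthTo (D ++ F) ∧ a ⬝ᵥ v = 1}
  pure (F ++ [a, b])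

theorem Sim.extendF {D F : List (Vec K)} (hK : μ 10 0 0 = K) (hKN : K ≤ N)
    (hD : dRng.Holds N μ D) (hF : fRng.Holds N μ F) (hFN : F.length + 2 ≤ N) :
    Sim N .extendF μ (extendF D F) fun F' μ' => fRng.Holds N μ' F' := by
  refine Sim.seq (Sim.drawNot rfl rfl rfl hK hKN hD hF hD fun v => Iff.rfl) fun a _ μ₁ ra F₁ => ?_
  replace F₁ := F₁.mono (Prog.writes_drawNot _ _ _)
  refine Hoare.seq_sim (Hoare.push (by rw [F₁ 10 (by simp), hK]) hKN (by simp) (by simp)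
    (hF.frame rfl F₁) (by omega) ra) fun μ₂ h₂ F₂ => ?_
  replace F₂ := F₁.append F₂
  have e24 : μ₂ 24 0 0 = F.length + 1 := by simpa [Expr.eval] using h₂.1
  refine Sim.seq (d := draw {v | v ∈ orthTo (D ++ F) ∧ a ⬝ᵥ v = 1}) (Sim.drawTest (L₁ := D)
    (L₂ := F) (L₃ := [a]) rfl rfl rfl (by rw [F₂ 10 (by simp), hK]) hKN (hD.frame rfl F₂)
    ⟨by simp [Expr.eval, e24], fun i hi => ?_, by omega⟩ (Rng.holds_singleton rfl (by omega) ?_)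
    fun v => ?_) fun b _ μ₃ rb F₃ => ?_
  · have := h₂.2.1 i (by simp; omega)
    rwa [List.getElem_append_left hi] at this
  · have := h₂.2.1 F.length (by simp)
    simp only [List.getElem_concat_length] at this
    simpa [Expr.eval, e24] using this
  · change _ ↔ _ ∧ ¬ ∀ c ∈ [a], c ⬝ᵥ v = 0
    simp only [List.mem_singleton, forall_eq, Set.mem_ofPred_eq]
    rcases zmod_two_cases (a ⬝ᵥ v) with h0 | h0 <;> simp [h0]
  · replace F₃ := F₃.mono (Prog.writes_drawTest _ _ _)
    refine Hoare.sim_pure _ ((Hoare.push (v := b) ?_ hKN (by simp) (by simp)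
      (h₂.frame rfl F₃) (by simp; omega) rb).conseq fun μ₄ h₄ _ => ?_)
    · rw [F₃ 10 (by simp), F₂ 10 (by simp), hK]
    · rwa [List.append_assoc] at h₄

theorem growF_eq_iter (D : List (Vec K)) (t i : ℕ) (F : List (Vec K)) :
    growF D t F = iter (fun _ F => extendF D F) t i F := by
  induction t generalizing i F with
  | zero => rfl
  | succ t ih =>
    rw [growF, iter, extendF]
    change PMF.bind _ _ = (PMF.bind _ _).bind _
    rw [PMF.bind_bind]
    congr 1
    funext a
    change PMF.bind _ _ = (PMF.bind _ _).bind _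
    rw [PMF.bind_bind]
    congr 1
    funext b
    change _ = (PMF.pure _).bind _
    rw [PMF.pure_bind]
    exact ih (i + 1) _

/-- Sample the first columns of `F`. -/
def Prog.firstF : Prog :=
  .cond .g
    (.seq (.dot 36 (.lit 0) 36 (.lit 0)) (.cond (.var 14)
      (.seq (.copyRow 33 (.lit 0) 36 (.lit 0)) (.push 34 24))
      (.seq (.prep dRng noRng oneRng) (.cond (.sub (.var 12) (.var 11))
        (.seq (.pick 30) (.seq (.copyRow 38 (.lit 0) 33 (.lit 0)) (.seq
          (.copyRow 33 (.lit 0) 36 (.lit 0)) (.seq (.xorRow 33 (.lit 0) 38 (.lit 0)) (.seq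
          (.push 34 24) (.seq (.copyRow 33 (.lit 0) 38 (.lit 0)) (.push 34 24)))))))
        .skip))))
    .skip

/-- Sample the columns of `F`. -/
def Prog.sampleF : Prog :=
  .seq (.assign 24 (.lit 0)) (.seq .firstF (.loop (.sub .g (.var 24)) .extendF))

/-- The arrays and variables written to when sampling `F`. -/
abbrev sampleFVars : List ℕ := 24 :: 34 :: 38 :: drawVars

theorem Prog.writes_firstF : firstF.writes ⊆ sampleFVars := by
  simp only [firstF, writes, List.append_subset, and_assoc]
  exact ⟨by simp, by simp, by simp, List.Subset.trans (writes_prep _ _ _) (by simp),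
    List.Subset.trans (writes_pick _) (by simp), by simp, by simp, by simp, by simp, by simp,
    by simp, by simp, by simp⟩

theorem Prog.writes_sampleF : sampleF.writes ⊆ sampleFVars := by
  simp only [sampleF, writes, List.append_subset]
  exact ⟨by simp, writes_firstF, List.Subset.trans writes_extendF (by simp)⟩

open Classical in
/-- The first columns of `F`. -/
noncomputable def firstF (g : ℕ) (D : List (Vec K)) : PMF (List (Vec K)) :=
  if g = 0 then PMF.pure [] else if Odd K then PMF.pure [1] else if (1 : Vec K) ∉ spanOf D then
    (draw {v | v ∈ orthTo D ∧ Odd (hammingNorm v)}).bind fun c => PMF.pure [1 + c, c]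
  else PMF.pure []

theorem sampleF_eq {g : ℕ} (h : K % 2 = g % 2) (D : List (Vec K)) :
    sampleF g D = (firstF g D).bind fun F => growF D ((g - F.length) / 2) F := by
  rw [sampleF, firstF]
  split_ifs with h1 h2 h3
  · simp [h1, growF]
  · simp
  · rw [sampleF_of_one_mem, PMF.pure_bind]
    · simp
    · rw [Nat.odd_iff] at h2
      omega
  · rw [PMF.bind_bind]
    change PMF.bind _ _ = _
    congr 1
    funext c
    simp

/-- The congruence m₁ ≡ g modulo 2 makes the number of missing columns even, so appending pairs
stops exactly at g. -/
theorem firstF_length {g : ℕ} (h : K % 2 = g % 2) {D F : List (Vec K)}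
    (hF : F ∈ (firstF g D).support) : F.length + 2 * ((g - F.length) / 2) = g := by
  rw [firstF] at hF
  have hodd := Nat.odd_iff (n := K)
  split_ifs at hF with h1 h2 h3
  · obtain rfl := (PMF.mem_support_pure_iff _ _).mp hF
    simp
    omega
  · obtain rfl := (PMF.mem_support_pure_iff _ _).mp hF
    simp only [h2, true_iff] at hodd
    simp
    omega
  · obtain rfl := (PMF.mem_support_pure_iff _ _).mp hF
    simp only [h2, false_iff] at hodd
    simp
    omega
  · obtain ⟨c, -, hF⟩ := (PMF.mem_support_bind_iff _ _ _).mp hF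
    obtain rfl := (PMF.mem_support_pure_iff _ _).mp hF
    simp only [h2, false_iff] at hodd
    simp
    omega

theorem Sim.firstF {g : ℕ} (hg : μ 0 0 2 = g) (hK : μ 10 0 0 = K) (hKN : K ≤ N)
    (hN : 2 ≤ N) (h1 : Row μ 36 0 (1 : Vec K)) {D : List (Vec K)} (hD : dRng.Holds N μ D)
    (h24 : μ 24 0 0 = 0) : Sim N .firstF μ (firstF g D) fun F μ' => fRng.Holds N μ' F := by
  have hnil : ∀ {μ' : Mem}, μ' 24 0 0 = 0 → fRng.Holds N μ' ([] : List (Vec K)) := fun h =>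
    ⟨by simp [Expr.eval, h], fun i hi => absurd hi (by simp), by simp⟩
  -- The program reads the parity of the length off from 1·1.
  have e14 : (1 : Vec K) ⬝ᵥ 1 = 0 ↔ ¬ Odd K := by
    rw [one_dotProduct_one, Fintype.card_fin, ZMod.natCast_eq_zero_iff_even, Nat.not_odd_iff_even]
  rw [IQP.firstF]
  by_cases h0 : g = 0
  · rw [if_pos h0]
    refine Sim.cond (fun h => absurd h ?_) fun _ => Hoare.sim_pure _ (Hoare.skip (hnil h24))
    simp [Expr.eval, hg, h0]
  rw [if_neg h0]
  refine Sim.cond (fun _ => ?_) fun h => absurd h (by simp [Expr.eval, hg, h0])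
  refine Hoare.seq_sim (Hoare.dot (a := (1 : Vec K)) (b := 1) hK hKN (by simp) (by simp) rfl rfl
    h1 h1) fun μ₁ d₁ F₁ => ?_
  replace F₁ : Frame [13, 14] μ μ₁ := F₁.mono (by simp)
  have k₁ : μ₁ 10 0 0 = K := by rw [F₁ 10 (by simp), hK]
  have o₁ : Row μ₁ 36 0 (1 : Vec K) := h1.frame F₁ (by simp)
  have n₁ : μ₁ 24 0 0 = 0 := by rw [F₁ 24 (by simp), h24]
  by_cases h2 : Odd K
  · rw [if_pos h2]
    refine Sim.cond (fun _ => Hoare.sim_pure _ ?_) fun h => ?_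
    · refine Hoare.seq (Hoare.copyRow k₁ hKN (by simp) (by simp) rfl rfl o₁ (by simp))
        fun μ₂ h₂ F₂ => ?_
      exact Hoare.push (L := []) (by rw [F₂ 10 (by simp), k₁]) hKN (by simp) (by simp)
        (hnil (by rw [F₂ 24 (by simp), n₁])) (by simp; omega) h₂.1
    · simp only [Expr.eval, d₁, ZMod.val_eq_zero, e14] at h
      exact absurd h2 h
  rw [if_neg h2]
  refine Sim.cond (fun h => ?_) fun _ => ?_
  · simp only [Expr.eval, d₁, ne_eq, ZMod.val_eq_zero, e14] at h
    exact absurd h2 h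
  refine Hoare.seq_sim (Hoare.prep (L₂ := []) (L₃ := [1]) rfl rfl rfl k₁ hKN
    (hD.frame (ws := [13, 14]) rfl F₁)
    (Rng.holds_nil _ rfl) (Rng.holds_singleton rfl (by omega) o₁)) fun μ₂ p₂ F₂ => ?_
  replace F₂ := F₂.mono (Prog.writes_prep _ _ _)
  have k₂ : μ₂ 10 0 0 = K := by rw [F₂ 10 (by simp), k₁]
  have o₂ : Row μ₂ 36 0 (1 : Vec K) := o₁.frame F₂ (by simp)
  have n₂ : μ₂ 24 0 0 = 0 := by rw [F₂ 24 (by simp), n₁]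
  have hset : ∀ v : Vec K, v ∈ {v : Vec K | v ∈ orthTo D ∧ Odd (hammingNorm v)} ↔
      v ∈ perp D ⊓ perp [] ∧ v ∉ perp D ⊓ perp [] ⊓ perp [1] := fun v => by
    rw [perp_nil, inf_top_eq]
    change v ∈ perp D ∧ Odd (hammingNorm v) ↔ _
    rw [← Nat.not_even_iff_odd, even_hammingNorm_iff, Submodule.mem_inf, mem_perp (L := [1])]
    simp only [List.mem_singleton, forall_eq]
    tauto
  have hne : _ ↔ {v : Vec K | v ∈ orthTo D ∧ Odd (hammingNorm v)}.Nonempty :=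
    p₂.nonempty_iff.trans (exists_congr fun v => (hset v).symm)
  -- Membership of 1 in span D is not tested separately: the emptiness test of the draw decides it.
  have hspan : (1 : Vec K) ∉ spanOf D ↔ {v | v ∈ orthTo D ∧ Odd (hammingNorm v)}.Nonempty := by
    constructor
    · intro h
      obtain ⟨c, hc, hc'⟩ := exists_perp h
      refine ⟨c, hc, ?_⟩
      rw [← Nat.not_even_iff_odd, even_hammingNorm_iff, dotProduct_comm, hc']
      exact one_ne_zero
    · rintro ⟨c, hc, hc'⟩ h
      rw [← Nat.not_even_iff_odd, even_hammingNorm_iff] at hc'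
      exact hc' (dotProduct_eq_zero_of_mem h hc)
  replace hne := hne.trans hspan.symm
  by_cases h3 : (1 : Vec K) ∉ spanOf D
  · rw [if_pos h3]
    refine Sim.cond (fun _ => ?_) fun h => absurd h (hne.mpr h3)
    refine Sim.seq (p₂.sim_pick k₂ hKN hset) fun c _ μ₃ rc F₃ => Hoare.sim_pure _ ?_
    replace F₃ := F₃.mono (Prog.writes_pick _)
    refine Hoare.seq (Hoare.copyRow (by rw [F₃ 10 (by simp), k₂]) hKN (by simp) (by simp) rfl rfl rc
      (by simp)) fun μ₄ ⟨h₄, _⟩ F₄ => ?_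
    replace F₄ := F₃.append F₄
    refine Hoare.seq (Hoare.copyRow (by rw [F₄ 10 (by simp), k₂]) hKN (by simp) (by simp) rfl rfl
      (o₂.frame F₄ (by simp)) (by simp)) fun μ₅ ⟨h₅, _⟩ F₅ => ?_
    replace h₄ := h₄.frame F₅ (by simp)
    replace F₅ := F₄.append F₅
    refine Hoare.seq (Hoare.xorRow (by rw [F₅ 10 (by simp), k₂]) hKN (by simp) (by simp) rfl rfl
      h₅ h₄ (by simp)) fun μ₆ ⟨h₆, _⟩ F₆ => ?_
    replace h₄ := h₄.frame F₆ (by simp)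
    replace F₆ := F₅.append F₆
    refine Hoare.seq (Hoare.push (L := []) (by rw [F₆ 10 (by simp), k₂]) hKN (by simp) (by simp)
      (hnil (by rw [F₆ 24 (by simp), n₂])) (by simp; omega) h₆) fun μ₇ h₇ F₇ => ?_
    replace h₄ := h₄.frame F₇ (by simp)
    replace F₇ := F₆.append F₇
    refine Hoare.seq (Hoare.copyRow (by rw [F₇ 10 (by simp), k₂]) hKN (by simp) (by simp) rfl rfl
      h₄ (by simp)) fun μ₈ ⟨h₈, _⟩ F₈ => ?_
    replace h₇ := h₇.frame rfl F₈
    replace F₈ := F₇.append F₈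
    exact Hoare.push (by rw [F₈ 10 (by simp), k₂]) hKN (by simp) (by simp) h₇ (by simpa using hN) h₈
  · rw [if_neg h3]
    refine Sim.cond (fun h => absurd (hne.mp h) h3) fun _ => Hoare.sim_pure _ (Hoare.skip (hnil n₂))

theorem Sim.sampleF {n m g d : ℕ} (hq : (K, d) ∈ admissible n m g) (hg : μ 0 0 2 = g)
    (hK : μ 10 0 0 = K) (hKN : K ≤ N) (hN : 2 ≤ N) (h1 : Row μ 36 0 (1 : Vec K))
    {D : List (Vec K)} (hD : dRng.Holds N μ D) :
    Sim N .sampleF μ (sampleF g D) fun F μ' => fRng.Holds N μ' F := by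
  obtain ⟨-, h2, -, -, h5, h6, -, -⟩ := id hq
  simp only at h2 h5 h6
  rw [sampleF_eq h6]
  have F₁ : Frame [24] μ (μ.write 24 0 0 0) := Frame.write _ _ _ _ _
  refine Hoare.set_seq (Sim.seq (Sim.firstF ?_ ?_ hKN hN (h1.frame F₁ (by simp))
    (hD.frame (ws := [24]) rfl F₁) ?_) fun F₀ hF₀ μ' a0 F => ?_)
  · simpa using hg
  · simpa using hK
  · simp
  replace F := F₁.append (F.mono Prog.writes_firstF)
  have ht := firstF_length h6 hF₀
  generalize (g - F₀.length) / 2 = t at *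
  rw [growF_eq_iter D t 0]
  refine (Sim.loop (e := .sub .g (.var 24)) _ (fun i F μ'' => fRng.Holds N μ'' F ∧
    F.length = F₀.length + 2 * i) t F₀ (by omega) ⟨a0, rfl⟩ ?_ ?_).conseq fun F' _ μ'' h _ => h.1
  · rintro i hi L μ₁ ⟨a1, a2⟩ F₁
    replace F₁ := F.append (F₁.mono Prog.writes_extendF)
    refine ⟨?_, ?_⟩
    · have : μ₁ 24 0 0 = L.length := a1.1
      simp only [Expr.eval, F₁ 0 (by simp), hg, this, a2]
      omega
    · refine (Sim.extendF (by rw [F₁ 10 (by simp), hK]) hKN (hD.frame rfl F₁) a1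
        (by omega)).conseq fun L' hL' μ₂ h₂ _ => ⟨h₂, ?_⟩
      obtain ⟨a, _, hL'⟩ := (PMF.mem_support_bind_iff _ _ _).mp hL'
      obtain ⟨b, _, hL'⟩ := (PMF.mem_support_bind_iff _ _ _).mp hL'
      rw [(PMF.mem_support_pure_iff _ _).mp hL']
      simp
      omega
  · rintro L μ₁ ⟨a1, a2⟩ F₁
    replace F₁ := F.append (F₁.mono Prog.writes_extendF)
    have : μ₁ 24 0 0 = L.length := a1.1
    simp only [Expr.eval, F₁ 0 (by simp), hg, this, a2]
    omega

end IQP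
namespace IQP

variable {N : ℕ} {μ : Mem}

/-! ## Sampling the parameters of the code -/

theorem Hoare.loop {c : Prog} {e : Expr} (I : ℕ → Mem → Prop) (cnt : ℕ)
    (hcnt : cnt ≤ N) (h0 : I 0 μ)
    (hstep : ∀ i < cnt, ∀ μ', I i μ' → Frame c.writes μ μ' →
      e.eval μ' ≠ 0 ∧ Hoare N c μ' (I (i + 1)))
    (hend : ∀ μ', I cnt μ' → Frame c.writes μ μ' → e.eval μ' = 0) :
    Hoare N (.loop e c) μ (I cnt) := by
  have := Sim.loop (fun _ => PMF.pure) (fun i (_ : Unit) => I i) cnt () hcnt h0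
    (fun i hi _ => hstep i hi) fun _ => hend
  rwa [iter_pure] at this

/-- Store the remainder of a number modulo a constant in a variable. -/
def Prog.modLit (x : ℕ) (e : Expr) (c : ℕ) : Prog :=
  .seq (.assign x e) (.loop (.sub (.var x) (.lit (c - 1))) (.assign x (.sub (.var x) (.lit c))))

@[simp] theorem Prog.writes_modLit (x : ℕ) (e : Expr) (c : ℕ) :
    (modLit x e c).writes = [x, x] := rfl

theorem Hoare.modLit {x c : ℕ} {e : Expr} (hc : 0 < c) (he : e.eval μ ≤ N) :
    Hoare N (.modLit x e c) μ fun μ' => μ' x 0 0 = e.eval μ % c := by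
  refine Hoare.set_seq ((Hoare.loop (fun i μ' => μ' x 0 0 + c * i = e.eval μ) (e.eval μ / c)
    ((Nat.div_le_self _ _).trans he) ?_ ?_ ?_).conseq ?_)
  · simp [Expr.eval]
  · intro i hi μ' h _
    have h1 : c * (i + 1) ≤ e.eval μ :=
      (Nat.mul_le_mul_left c hi).trans (Nat.mul_div_le _ _)
    rw [mul_add, mul_one] at h1
    refine ⟨?_, Hoare.set ?_⟩
    · simp only [Expr.eval]
      omega
    · simp only [Expr.eval, Mem.write_apply, and_self, if_true, mul_add, mul_one]
      omega
  · intro μ' h _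
    have h1 := Nat.div_add_mod (e.eval μ) c
    have h2 := Nat.mod_lt (e.eval μ) hc
    simp only [Expr.eval]
    omega
  · intro μ' h _
    have h1 := Nat.div_add_mod (e.eval μ) c
    omega

/-- The input parameter `n`. -/
abbrev Expr.n : Expr := .cell 0 (.lit 0) (.lit 0)

/-- The input parameter `m`. -/
abbrev Expr.m : Expr := .cell 0 (.lit 0) (.lit 1)

/-- An expression that vanishes if the numbers in the variables 21 and 22 are admissible. The
variables 3 to 6 have to hold the remainders of the number in the variable 21 modulo 2, 4 and 8,
and that of `g` modulo 2. -/
def Expr.violation : Expr :=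
  .add (.sub (.add .g (.var 22)) .n) <| .add (.sub (.lit 1) (.var 21)) <|
  .add (.sub (.var 21) .m) <| .add (.sub (.add .n (.var 21)) (.add .m (.add .g (.var 22)))) <|
  .add (.sub (.add .g (.add (.var 22) (.var 22))) (.var 21)) <|
  .add (.add (.sub (.var 3) (.var 6)) (.sub (.var 6) (.var 3))) <|
  .add (.sub (.var 4) (.add .g (.add .g .g))) <| .add (.sub (.sub (.lit 1) .g) (.var 22)) <|
  .sub (.add (.sub (.lit 1) (.sub (.var 21) (.add (.var 22) (.add (.var 22) (.lit 1)))))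
    (.sub (.lit 1) (.add (.sub (.lit 2) (.var 5)) (.sub (.var 5) (.lit 6))))) (.lit 1)

/-- A sum vanishes iff all summands do, and a truncated difference vanishes iff an inequality holds.
For g > 0, the term 3g dominates every remainder modulo 4 and disables the condition for g = 0. The
last summand adds the indicators of the premise and of a bad residue and subtracts 1. -/
theorem Expr.eval_violation {n m g a b : ℕ} (hn : μ 0 0 0 = n) (hm : μ 0 0 1 = m)
    (hg : μ 0 0 2 = g) (h21 : μ 21 0 0 = a) (h22 : μ 22 0 0 = b) (h3 : μ 3 0 0 = a % 2)
    (h4 : μ 4 0 0 = a % 4) (h5 : μ 5 0 0 = a % 8) (h6 : μ 6 0 0 = g % 2) :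
    violation.eval μ = 0 ↔ (a, b) ∈ admissible n m g := by
  simp only [violation, Expr.eval, hn, hm, hg, h21, h22, h3, h4, h5, h6, Nat.add_eq_zero_iff]
  change _ ↔ g + b ≤ n ∧ 0 < a ∧ a ≤ m ∧ n + a ≤ m + g + b ∧ g + 2 * b ≤ a ∧ a % 2 = g % 2 ∧
    (g = 0 → 4 ∣ a ∧ 1 ≤ b) ∧ (a ≤ 2 * b + 1 → a % 8 = 0 ∨ a % 8 = 1 ∨ a % 8 = 7)
  refine and_congr (by omega) <| and_congr (by omega) <| and_congr (by omega) <|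
    and_congr (by omega) <| and_congr (by omega) <| and_congr (by omega) <|
    and_assoc.symm.trans <| and_congr (by omega) ?_
  omega

/-- Append the numbers in the variables 21 and 22 to the list in array 39 if they are
admissible. -/
def Prog.testPair : Prog :=
  .seq (.modLit 3 (.var 21) 2) (.seq (.modLit 4 (.var 21) 4) (.seq (.modLit 5 (.var 21) 8) (.seq
  (.modLit 6 .g 2) (.cond .violation .skip (.seq (.set 39 (.var 26) (.lit 0) (.var 21)) (.seq
  (.set 39 (.var 26) (.lit 1) (.var 22)) (.assign 26 (.add (.var 26) (.lit 1)))))))))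

@[simp] theorem Prog.writes_testPair :
    testPair.writes = [3, 3, 4, 4, 5, 5, 6, 6, 39, 39, 26] := rfl

/-- Array 39 lists the admissible pairs up to a given one. -/
def Listed (n m g i j : ℕ) (μ : Mem) : Prop :=
  ∃ L : List (ℕ × ℕ), L.Nodup ∧ (∀ p, p ∈ L ↔ p ∈ admissible n m g ∧
    (p.1 < i ∨ p.1 = i ∧ p.2 < j)) ∧ μ 26 0 0 = L.length ∧
    ∀ (t : ℕ) (h : t < L.length), μ 39 t 0 = L[t].1 ∧ μ 39 t 1 = L[t].2

theorem Listed.frame {n m g i j : ℕ} {μ' : Mem} {ws : List ℕ} (h : Listed n m g i j μ)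
    (hF : Frame ws μ μ') (h1 : 26 ∉ ws) (h2 : 39 ∉ ws) : Listed n m g i j μ' := by
  rw [Listed, hF 26 h1, hF 39 h2]
  exact h

theorem Hoare.testPair {n m g a b : ℕ} (hn : μ 0 0 0 = n) (hm : μ 0 0 1 = m)
    (hg : μ 0 0 2 = g) (h21 : μ 21 0 0 = a) (h22 : μ 22 0 0 = b) (ha : a ≤ N) (hgN : g ≤ N)
    (h : Listed n m g a b μ) : Hoare N .testPair μ (Listed n m g a (b + 1)) := by
  refine Hoare.seq (Hoare.modLit (by omega) (by simpa [Expr.eval, h21] using ha))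
    fun μ₁ m₁ F₁ => ?_
  refine Hoare.seq (Hoare.modLit (by omega) (by
    simpa [Expr.eval, F₁ 21, h21] using ha)) fun μ₂ m₂ F₂ => ?_
  replace F₂' := F₁.append F₂
  refine Hoare.seq (Hoare.modLit (by omega) (by
    simpa [Expr.eval, F₂' 21, h21] using ha)) fun μ₃ m₃ F₃ => ?_
  replace F₃' := F₂'.append F₃
  refine Hoare.seq (Hoare.modLit (by omega) (by
    simpa [Expr.eval, F₃' 0, hg] using hgN)) fun μ₄ m₄ F₄ => ?_
  replace F₄' := F₃'.append F₄
  have e21 : μ₄ 21 0 0 = a := by rw [F₄' 21 (by simp), h21]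
  have e22 : μ₄ 22 0 0 = b := by rw [F₄' 22 (by simp), h22]
  have hv : Expr.violation.eval μ₄ = 0 ↔ (a, b) ∈ admissible n m g := by
    refine Expr.eval_violation ?_ ?_ ?_ e21 e22 ?_ ?_ ?_ ?_
    · rw [F₄' 0 (by simp), hn]
    · rw [F₄' 0 (by simp), hm]
    · rw [F₄' 0 (by simp), hg]
    · rw [F₄ 3 (by simp), F₃ 3 (by simp), F₂ 3 (by simp), m₁]
      simp [Expr.eval, h21]
    · rw [F₄ 4 (by simp), F₃ 4 (by simp), m₂]
      simp [Expr.eval, F₁ 21, h21]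
    · rw [F₄ 5 (by simp), m₃]
      simp [Expr.eval, F₂' 21, h21]
    · rw [m₄]
      simp [Expr.eval, F₃' 0, hg]
  obtain ⟨L, l1, l2, l3, l4⟩ := h.frame F₄' (by simp) (by simp)
  refine Sim.cond (fun h0 => Hoare.skip ⟨L, l1, fun p => ?_, l3, l4⟩) fun h0 => ?_
  · rw [ne_eq, hv] at h0
    rw [l2]
    refine and_congr_right fun hp => ?_
    have : p.1 = a → p.2 ≠ b := fun e1 e2 => h0 (by rw [← e1, ← e2]; exact hp)
    omega
  · rw [hv] at h0
    refine Hoare.set_seq (Hoare.set_seq (Hoare.set ⟨L ++ [(a, b)], ?_, fun p => ?_, ?_, ?_⟩))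
    · rw [List.nodup_append]
      refine ⟨l1, by simp, ?_⟩
      intro p hp q hq
      obtain rfl := List.mem_singleton.mp hq
      rintro rfl
      have := ((l2 _).mp hp).2
      simp at this
    · rw [List.mem_append, l2, List.mem_singleton, Prod.ext_iff]
      constructor
      · rintro (h | h)
        · exact ⟨h.1, by omega⟩
        · refine ⟨?_, by simp only at h; omega⟩
          rw [show p = (a, b) from Prod.ext h.1 h.2]
          exact h0
      · rintro ⟨h1, h2⟩
        by_cases h3 : p.1 = a ∧ p.2 = b
        · exact Or.inr h3
        · exact Or.inl ⟨h1, by omega⟩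
    · simp [Expr.eval, l3]
    · intro t ht
      simp only [List.length_append, List.length_singleton] at ht
      by_cases h' : t < L.length
      · rw [List.getElem_append_left h']
        have : t ≠ L.length := by omega
        simpa [Expr.eval, l3, this] using l4 t h'
      · obtain rfl : t = L.length := by omega
        simp [Expr.eval, l3, e21, e22]

/-- Sample the number of rows and the number of columns of `D`. -/
def Prog.parameters : Prog :=
  .seq (.assign 26 (.lit 0)) (.seq
  (.forTo 21 (.add .m (.lit 1)) (.forTo 22 (.add .n (.lit 1)) .testPair)) (.seq
  (.rand 27 (.lit 0) (.lit 0) (.sub (.var 26) (.lit 1))) (.seq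
  (.assign 21 (.cell 39 (.var 27) (.lit 0))) (.assign 22 (.cell 39 (.var 27) (.lit 1))))))

theorem Hoare.enumerate {n m g : ℕ} (hn : μ 0 0 0 = n) (hm : μ 0 0 1 = m)
    (hg : μ 0 0 2 = g) (hN : n + m + g + 1 ≤ N) (h0 : μ 26 0 0 = 0) :
    Hoare N (.forTo 21 (.add .m (.lit 1)) (.forTo 22 (.add .n (.lit 1)) .testPair)) μ
      (Listed n m g (m + 1) 0) := by
  refine Hoare.forTo (fun i => Listed n m g i 0) (m + 1) (by simp) rfl (by simp [Expr.eval, hm])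
    (by omega) ⟨[], by simp, by simp, by simpa using h0, by simp⟩ fun i hi μ₁ h₁ v₁ F₁ => ?_
  refine (Hoare.forTo (Listed n m g i) (n + 1) (by simp) rfl
    (by simp [Expr.eval, F₁ 0, hn]) (by omega) (h₁.frame (Frame.write _ _ _ _ _) (by simp) (by simp))
    fun j hj μ₂ h₂ v₂ F₂ => ?_).conseq fun μ₂ h₂ F₂ => ?_
  · refine (Hoare.testPair (by simp [F₂ 0, F₁ 0, hn]) (by simp [F₂ 0, F₁ 0, hm])
      (by simp [F₂ 0, F₁ 0, hg]) (by simp [F₂ 21, v₁]) v₂ (by omega) (by omega) h₂).conseq ?_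
    exact fun μ₃ h₃ _ => h₃.frame (Frame.write _ _ _ _ _) (by simp) (by simp)
  -- Admissible d are at most n, so the slice is complete once d has run through 0, …, n.
  · obtain ⟨L, l1, l2, l3, l4⟩ := h₂.frame (Frame.write _ 21 0 0 (i + 1)) (by simp) (by simp)
    refine ⟨L, l1, fun p => ?_, l3, l4⟩
    rw [l2]
    refine and_congr_right fun hp => ?_
    have := hp.1
    omega

/-- The list has no repetitions, so a uniform index gives a uniform pair. -/
theorem Sim.parameters {n m g : ℕ} (hn : μ 0 0 0 = n) (hm : μ 0 0 1 = m)
    (hg : μ 0 0 2 = g) (hN : n + m + g + 1 ≤ N) (hne : (admissible n m g).Nonempty) :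
    Sim N .parameters μ (draw (admissible n m g)) fun q μ' =>
      μ' 21 0 0 = q.1 ∧ μ' 22 0 0 = q.2 := by
  have F₁ : Frame [26] μ (μ.write 26 0 0 0) := Frame.write _ _ _ _ _
  refine Hoare.set_seq (Hoare.seq_sim (Hoare.enumerate (n := n) (m := m) (g := g)
    (by simpa using hn) (by simpa using hm) (by simpa using hg) hN (by simp [Expr.eval]))
    fun μ₂ ⟨L, l1, l2, l3, l4⟩ _ => ?_)
  have hL : ∀ p, p ∈ L ↔ p ∈ admissible n m g := fun p => by
    rw [l2]
    refine and_iff_left_of_imp fun hp => ?_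
    have := hp.2.2.1
    omega
  obtain ⟨p, hp⟩ := hne
  have hpos := List.length_pos_of_mem ((hL p).mpr hp)
  have hlen : (Expr.sub (.var 26) (.lit 1)).eval μ₂ + 1 = L.length := by
    simp only [Expr.eval, l3]
    omega
  rw [← uniform_map_eq_draw (f := fun r : Fin ((Expr.sub (.var 26) (.lit 1)).eval μ₂ + 1) =>
    L[(r : ℕ)]'(by omega)) (S := admissible n m g) ?_ ?_]
  · refine Sim.map (Q := fun (r : Fin _) μ' => μ' 21 0 0 = (L[(r : ℕ)]'(by omega)).1 ∧
      μ' 22 0 0 = (L[(r : ℕ)]'(by omega)).2) _ ?_ fun _ _ _ h _ => h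
    refine Sim.seq_hoare (Q := fun (r : Fin _) μ' => μ' 27 0 0 = r) (Sim.rand fun r => ?_)
      fun r _ μ₃ h₃ F₃ => ?_
    · simp [Expr.eval]
    · refine Hoare.set_seq (Hoare.set ?_)
      have := l4 r (by omega)
      simp [Expr.eval, h₃, F₃ 39, this]
  · intro r r' hrr
    exact Fin.ext ((List.Nodup.getElem_inj_iff l1).mp hrr)
  · ext q
    rw [← hL, List.mem_iff_getElem]
    constructor
    · rintro ⟨r, rfl⟩
      exact ⟨r, by omega, rfl⟩
    · rintro ⟨i, hi, rfl⟩
      exact ⟨⟨i, by omega⟩, rfl⟩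

theorem Prog.writes_parameters : parameters.writes ⊆ [3, 4, 5, 6, 21, 22, 26, 27, 39] := by
  simp [parameters]

end IQP
namespace IQP

variable {K N : ℕ} {μ : Mem}

/-! ## Sampling the rows of the matrix -/

/-- Store a row of the matrix with columns `F`, `D` and zero, extended by the bit 1. -/
def Prog.stabRow : Prog :=
  .seq (.mapRow 42 (.var 25) .n (.lit 0)) (.seq
  (.mapRow 42 (.var 25) .g (.cell 34 (.var 13) (.var 25))) (.seq
  (.forTo 13 (.var 22) (.set 42 (.var 25) (.add .g (.var 13)) (.cell 35 (.var 13) (.var 25))))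
  (.set 42 (.var 25) .n (.lit 1))))

@[simp] theorem Prog.writes_stabRow :
    stabRow.writes = [13, 42, 13, 13, 42, 13, 13, 42, 13, 42] := rfl

theorem Hoare.stabRow {k n i : ℕ} {F D : List (Vec k)} (hn : μ 0 0 0 = n)
    (hg : μ 0 0 2 = F.length) (hd : μ 22 0 0 = D.length) (hi : μ 25 0 0 = i) (hik : i < k)
    (hl : F.length + D.length ≤ n) (hN : n ≤ N) (hF : fRng.Holds N μ F) (hD : dRng.Holds N μ D) :
    Hoare N .stabRow μ fun μ' => (∀ i', i' ≠ i → μ' 42 i' = μ 42 i') ∧ Row μ' 42 i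
      (Fin.snoc (α := fun _ => ZMod 2) (fun j : Fin n => (F ++ D).getD j 0 ⟨i, hik⟩) 1) := by
  refine Hoare.seq (Hoare.mapRow (fun _ => 0) (cnt := n) hn hN (by simp) rfl rfl
    fun _ _ _ _ _ _ => rfl) fun μ₁ h₁ F₁ => ?_
  simp only [Expr.eval, hi] at h₁
  refine Hoare.seq (Hoare.mapRow (fun j => μ 34 j i) (cnt := F.length) (by
    simp only [Expr.eval, F₁ 0 (by simp), hg]) (by omega) (by simp) rfl rfl ?_) fun μ₂ h₂ F₂ => ?_
  · intro k _ μ' F' v' _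
    simp only [Expr.eval, F' 34 (by simp), F' 25 (by simp), F₁ 34 (by simp), F₁ 25 (by simp), v', hi]
  have e25 : μ₁ 25 0 0 = i := by rw [F₁ 25 (by simp), hi]
  simp only [Expr.eval, e25] at h₂
  replace F₂ := F₁.append F₂
  refine Hoare.seq (Hoare.forTo (fun t μ' => ∀ i' j', μ' 42 i' j' =
    if i' = i ∧ F.length ≤ j' ∧ j' < F.length + t then μ 35 (j' - F.length) i else μ₂ 42 i' j')
    D.length (by simp) rfl (by simp only [Expr.eval, F₂ 22 (by simp), hd]) (by omega)
    ?_ ?_) fun μ₃ h₃ F₃ => Hoare.set ?_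
  · intro i' j'
    rw [if_neg (by omega)]
    simp
  · intro t ht μ' h v' F'
    replace F' := F₂.append F'
    refine Hoare.set fun i' j' => ?_
    simp only [Expr.eval, F' 25 (by simp), F' 0 (by simp), F' 35 (by simp), hi, hg, v',
      Mem.write_apply, h, true_and]
    by_cases h1 : i' = i
    · by_cases h2 : j' = F.length + t
      · simp [h1, h2]
      · have : F.length ≤ j' ∧ j' < F.length + t ↔ F.length ≤ j' ∧ j' < F.length + (t + 1) := by
          omega
        simp [h1, h2, this]
    · simp [h1]
  replace F₃ := F₂.append F₃
  simp only [Expr.eval, F₃ 25 (by simp), F₃ 0 (by simp), hi, hn]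
  constructor
  · intro i' hi'
    funext j'
    simp [h₁, h₂, h₃, hi']
  · intro j
    refine Fin.lastCases ?_ (fun j => ?_) j
    · simp [ZMod.val_one]
    · have hj : (j : ℕ) ≠ n := by omega
      simp only [Fin.snoc_castSucc, Fin.val_castSucc, Mem.write_apply, hj, and_false, if_false, h₃,
        h₂, h₁, true_and]
      by_cases h4 : (j : ℕ) < F.length
      · rw [if_neg (by omega), if_pos h4, List.getD_append _ _ _ _ h4,
          List.getD_eq_getElem _ _ h4]
        have := hF.2.1 j h4 ⟨i, hik⟩
        simpa [Expr.eval] using this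
      · rw [List.getD_append_right _ _ _ _ (by omega)]
        by_cases h5 : (j : ℕ) < F.length + D.length
        · rw [if_pos (by omega), List.getD_eq_getElem _ _ (by omega)]
          have := hD.2.1 (j - F.length) (by omega) ⟨i, hik⟩
          simpa [Expr.eval] using this
        · rw [if_neg (by omega), if_neg h4, if_pos j.2, List.getD_eq_default _ _ (by omega)]
          rfl

/-- The rows of the matrix sampled so far. -/
abbrev yRng : Rng := .stack 42 24

/-- The vector `s`. -/
abbrev sRng : Rng := ⟨38, .lit 0, .lit 1⟩

/-- Store the rows not orthogonal to `s`, and sample `s`. -/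
def Prog.secret : Prog :=
  .seq (.assign 10 .n) (.seq (.forTo 25 (.var 21) .stabRow) (.seq (.assign 24 (.var 21)) (.seq
  (.drawAff yRng) (.seq (.copyRow 38 (.lit 0) 33 (.lit 0)) (.set 38 (.lit 0) .n (.lit 0))))))

/-- The arrays and variables written to when sampling rows. -/
abbrev rowVars : List ℕ := 25 :: 38 :: 24 :: 42 :: 10 :: 40 :: drawVars

theorem Prog.writes_secret : secret.writes ⊆ rowVars := by
  simp only [secret, writes, List.append_subset]
  exact ⟨by simp, by simp, by simp, List.Subset.trans (writes_drawAff _) (by simp), by simp,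
    by simp⟩

theorem RowList.dropLast {n x lo : ℕ} {L : List (Vec (n + 1))} (h : RowList μ x lo L) :
    RowList μ x lo (L.map dropLast) := fun i hi j => by
  simpa [IQP.dropLast] using h i (by simpa using hi) j.castSucc

theorem Sim.secret {k n : ℕ} {F D : List (Vec k)} (hn : μ 0 0 0 = n)
    (hg : μ 0 0 2 = F.length) (hk : μ 21 0 0 = k) (hd : μ 22 0 0 = D.length)
    (hl : F.length + D.length ≤ n) (hN : n + 1 ≤ N) (hkN : k ≤ N) (hF : fRng.Holds N μ F)
    (hD : dRng.Holds N μ D) {M : Matrix (Fin k) (Fin n) (ZMod 2)}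
    (hM : M = Matrix.of fun i (j : Fin n) => (F ++ D).getD j 0 i) :
    Sim N .secret μ (draw {s : Vec n | M *ᵥ s = 1}) fun s μ' =>
      yRng.Holds N μ' (List.ofFn fun i => M i) ∧
      Row μ' 38 0 (Fin.snoc (α := fun _ => ZMod 2) s 0 : Vec (n + 1)) ∧ μ' 10 0 0 = n := by
  have F₁ : Frame [10] μ (μ.write 10 0 0 n) := Frame.write _ _ _ _ _
  -- The extra coordinate is the right-hand side of Ms = 1. Afterwards the same cells serve as rows
  -- of length n, the last one being ignored.
  let v : Fin k → Vec (n + 1) := fun i => Fin.snoc (α := fun _ => ZMod 2) (M i) 1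
  refine Hoare.set_seq ?_
  simp only [Expr.eval, hn]
  refine Hoare.seq_sim (Hoare.forTo (fun t μ' => ∀ i : Fin k, (i : ℕ) < t → Row μ' 42 i (v i)) k
    (by simp) rfl (by simpa [Expr.eval] using hk) hkN (fun i hi => absurd hi (by omega)) ?_)
    fun μ₂ h₂ F₂ => ?_
  · intro t ht μ' h v' F'
    replace F' := F₁.append F'
    refine (Hoare.stabRow (n := n) (F := F) (D := D) (by rw [F' 0 (by simp), hn])
      (by rw [F' 0 (by simp), hg]) (by rw [F' 22 (by simp), hd]) v' ht hl (by omega)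
      (hF.frame rfl F') (hD.frame rfl F')).conseq fun μ'' ⟨h1, h2⟩ F'' i hi => ?_
    refine Row.frame ?_ (Frame.write _ 25 0 0 (t + 1)) (by simp)
    by_cases hit : (i : ℕ) = t
    · subst hit
      have e : M i = fun j : Fin n => (F ++ D).getD j 0 i := by rw [hM]; rfl
      simpa only [v, e] using h2
    · exact (h i (by omega)).congr (h1 i hit)
  have k₂ : μ₂ 10 0 0 = n := by rw [F₂ 10 (by simp)]; simp
  replace F₂ := F₁.append F₂
  refine Hoare.set_seq ?_
  simp only [Expr.eval, F₂ 21 (by simp), hk]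
  have G : Frame [24] μ₂ (μ₂.write 24 0 0 k) := Frame.write _ _ _ _ _
  have F₂ := F₂.append G
  have y₂ : yRng.Holds N (μ₂.write 24 0 0 k) (List.ofFn v) := by
    refine ⟨by simp [Expr.eval], fun i hi => ?_, by simpa using hkN⟩
    rw [List.length_ofFn] at hi
    have := (h₂ ⟨i, hi⟩ hi).frame G (by simp)
    simpa [Expr.eval] using this
  refine Sim.seq_hoare (Sim.drawAff (n := n) (L := List.ofFn v) rfl
    (by simpa using k₂) hN y₂ fun s => ?_) fun s _ μ₃ ⟨r₃, k₃⟩ F₃ => ?_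
  · rw [Set.mem_ofPred_eq, List.forall_mem_ofFn_iff, funext_iff]
    refine forall_congr' fun i => ?_
    have e1 : dropLast (v i) = M i := by
      funext j
      simp [dropLast, v]
    have e2 : v i (Fin.last n) = 1 := by simp [v]
    rw [e1, e2]
    rfl
  · replace F₃ := F₃.mono (Prog.writes_drawAff _)
    have y₃ : yRng.Holds N μ₃ (List.ofFn v) := y₂.frame rfl F₃
    refine Hoare.seq (Hoare.copyRow k₃ (by omega) (by simp) (by simp) rfl rfl r₃ (by simp))
      fun μ₄ ⟨r₄, _⟩ F₄ => Hoare.set ?_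
    have e0 : μ₄ 0 0 0 = n := by
      rw [F₄ 0 (by simp), F₃ 0 (by simp), F₂ 0 (by simp), hn]
    simp only [Expr.eval, e0]
    have F₅ := F₄.append (Frame.write μ₄ 38 0 n 0)
    have y₅ := y₃.frame rfl F₅
    refine ⟨⟨by simpa using y₅.1, ?_, by simpa using y₅.2.2⟩, fun j => ?_, ?_⟩
    · have := y₅.2.1.dropLast
      have e : (List.ofFn v).map dropLast = List.ofFn fun i => M i := by
        rw [List.map_ofFn]
        congr 1
        funext i j
        simp [dropLast, v]
      rwa [e] at this
    · refine Fin.lastCases (by simp) (fun j => ?_) j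
      have hj : (j : ℕ) ≠ n := by omega
      simpa [hj, Expr.eval] using r₄ j
    · rw [F₅ 10 (by simp), k₃]


/-! ### The redundant rows. -/

/-- Add random rows orthogonal to `s`, the first ones outside of the span of the earlier rows. -/
def Prog.redundant : Prog :=
  .seq (.forTo 25 (.sub .n (.add .g (.var 22))) (.seq (.drawNot sRng noRng yRng) (.push 42 24)))
  (.forTo 25 (.sub (.sub .m (.var 21)) (.sub .n (.add .g (.var 22))))
    (.seq (.drawAff sRng) (.push 42 24)))

theorem Prog.writes_drawNot_push (r₁ r₂ r₃ : Rng) :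
    (seq (drawNot r₁ r₂ r₃) (push 42 24)).writes ⊆ 24 :: 42 :: 10 :: 40 :: drawVars := by
  simp only [writes, List.append_subset]
  exact ⟨List.Subset.trans (writes_drawNot _ _ _) (by simp), by simp⟩

theorem Prog.writes_drawAff_push (r : Rng) :
    (seq (drawAff r) (push 42 24)).writes ⊆ 24 :: 42 :: 10 :: 40 :: drawVars := by
  simp only [writes, List.append_subset]
  exact ⟨List.Subset.trans (writes_drawAff _) (by simp), by simp⟩

theorem Prog.writes_redundant : redundant.writes ⊆ rowVars := by
  have h1 := writes_drawNot_push sRng noRng yRng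
  have h2 := writes_drawAff_push sRng
  simp only [redundant, writes, writes_forTo, List.append_subset, List.cons_subset] at *
  refine ⟨⟨by simp, ?_, by simp⟩, ⟨by simp, ?_, by simp⟩⟩
  · exact ⟨List.Subset.trans h1.1 (by simp), List.Subset.trans h1.2 (by simp)⟩
  · exact ⟨List.Subset.trans h2.1 (by simp), List.Subset.trans h2.2 (by simp)⟩

theorem addIndependentRows_eq_iter {n : ℕ} (s : Vec n) (t i : ℕ) (L : List (Vec n)) :
    addIndependentRows s t L = iter (fun _ L => (draw {p | p ⬝ᵥ s = 0 ∧ p ∉ spanOf L}).map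
      fun p => L ++ [p]) t i L := by
  induction t generalizing i L with
  | zero => rfl
  | succ t ih =>
    rw [addIndependentRows, iter, PMF.bind_map]
    change PMF.bind _ _ = _
    congr 1
    funext v
    exact ih (i + 1) _

theorem addRows_eq_iter {n : ℕ} (s : Vec n) (t i : ℕ) (L : List (Vec n)) :
    addRows s t L = iter (fun _ L => (draw {p | p ⬝ᵥ s = 0}).map fun p => L ++ [p]) t i L := by
  induction t generalizing i L with
  | zero => rfl
  | succ t ih =>
    rw [addRows, iter, PMF.bind_map]
    change PMF.bind _ _ = _
    congr 1
    funext v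
    exact ih (i + 1) _

/-- The state while rows are added. -/
def RowState {n : ℕ} (N : ℕ) (s : Vec n) (μ : Mem) (L : List (Vec n)) : Prop :=
  yRng.Holds N μ L ∧ Row μ 38 0 (Fin.snoc (α := fun _ => ZMod 2) s 0 : Vec (n + 1)) ∧ μ 10 0 0 = n

theorem RowState.frame {n : ℕ} {s : Vec n} {L : List (Vec n)} {μ' : Mem} (h : RowState N s μ L)
    (hF : Frame [25] μ μ') : RowState N s μ' L :=
  ⟨h.1.frame rfl hF, h.2.1.frame hF (by simp), by rw [hF 10 (by simp), h.2.2]⟩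

theorem RowState.row {n : ℕ} {s : Vec n} {L : List (Vec n)} (h : RowState N s μ L) :
    Row μ 38 0 s := fun j => by simpa using h.2.1 j.castSucc

theorem Sim.independentRow {n : ℕ} {s : Vec n} {L : List (Vec n)} (h : RowState N s μ L)
    (hN : n + 1 ≤ N) (hL : L.length + 1 ≤ N) :
    Sim N (.seq (.drawNot sRng noRng yRng) (.push 42 24)) μ
      (draw {p | p ⬝ᵥ s = 0 ∧ p ∉ spanOf L}) fun p μ' => RowState N s μ' (L ++ [p]) := by
  refine Sim.seq_hoare (Sim.drawNot (L₁ := [s]) (L₂ := []) rfl rfl rfl h.2.2 (by omega)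
    (Rng.holds_singleton rfl (by omega) h.row) (Rng.holds_nil _ rfl) h.1 fun p => ?_)
    fun p _ μ₁ r₁ F₁ => ?_
  · rw [List.append_nil]
    change _ ↔ (∀ c ∈ [s], c ⬝ᵥ p = 0) ∧ _
    simp only [List.mem_singleton, forall_eq, Set.mem_ofPred_eq, dotProduct_comm s]
  · replace F₁ := F₁.mono (Prog.writes_drawNot _ _ _)
    refine (Hoare.push (by rw [F₁ 10 (by simp), h.2.2]) (by omega) (by simp) (by simp)
      (h.1.frame rfl F₁) hL r₁).conseq fun μ₂ h₂ F₂ => ⟨h₂, ?_, ?_⟩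
    · exact h.2.1.frame (F₁.append F₂) (by simp)
    · rw [(F₁.append F₂) 10 (by simp), h.2.2]

/-- This set contains 0, so it is not of the form V \ W. Storing s with a trailing 0 makes it the
solution set of an affine system, which is of that form one dimension higher. -/
theorem Sim.orthogonalRow {n : ℕ} {s : Vec n} {L : List (Vec n)} (h : RowState N s μ L)
    (hN : n + 1 ≤ N) (hL : L.length + 1 ≤ N) :
    Sim N (.seq (.drawAff sRng) (.push 42 24)) μ
      (draw {p | p ⬝ᵥ s = 0}) fun p μ' => RowState N s μ' (L ++ [p]) := by
  refine Sim.seq_hoare (Sim.drawAff (L := [Fin.snoc (α := fun _ => ZMod 2) s 0]) rfl h.2.2 hN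
    (Rng.holds_singleton rfl (by omega) h.2.1) fun p => ?_) fun p _ μ₁ r₁ F₁ => ?_
  · have e : dropLast (Fin.snoc (α := fun _ => ZMod 2) s 0) = s := by
      funext j
      simp [dropLast]
    simp [e, dotProduct_comm s]
  · replace F₁ := F₁.mono (Prog.writes_drawAff _)
    refine (Hoare.push r₁.2 (by omega) (by simp) (by simp)
      (h.1.frame rfl F₁) hL r₁.1).conseq fun μ₂ h₂ F₂ => ⟨h₂, ?_, ?_⟩
    · exact h.2.1.frame (F₁.append F₂) (by simp)
    · rw [F₂ 10 (by simp), r₁.2]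

theorem Sim.redundant {n m g k d : ℕ} {s : Vec n} {L : List (Vec n)} (hn : μ 0 0 0 = n)
    (hm : μ 0 0 1 = m) (hg : μ 0 0 2 = g) (hk : μ 21 0 0 = k) (hd : μ 22 0 0 = d)
    (hN : n + m + 1 ≤ N) (hL : L.length = k) (hkm : k ≤ m) (hr : n + k ≤ m + g + d)
    (h : RowState N s μ L) :
    Sim N .redundant μ ((addIndependentRows s (n - (g + d)) L).bind
      (addRows s (m - k - (n - (g + d))))) fun L' μ' => RowState N s μ' L' ∧ L'.length = m := by
  refine Sim.seq (Q := fun L' μ' => RowState N s μ' L' ∧ L'.length = k + (n - (g + d))) ?_ ?_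
  · rw [addIndependentRows_eq_iter s _ 0]
    refine (Sim.forTo _ (fun i L' μ' => RowState N s μ' L' ∧ L'.length = k + i) _ L
      (fun h => by simpa using Prog.writes_drawNot_push _ _ _ h)
      (Expr.avoids_mono (List.cons_subset_cons _ (Prog.writes_drawNot_push _ _ _)) rfl) ?_
      (by omega) ⟨h.frame (Frame.write _ _ _ _ _), hL⟩ ?_)
    · simp only [Expr.eval, hn, hg, hd]
    · rintro i hi L' μ' ⟨h', l'⟩ v' F'
      refine Sim.map _ (Sim.independentRow h' (by omega) (by omega)) fun p _ μ'' h'' _ =>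
        ⟨h''.frame (Frame.write _ _ _ _ _), ?_⟩
      simp; omega
  · rintro L₁ - μ₁ ⟨h₁, l₁⟩ F₁
    replace F₁ : Frame rowVars μ μ₁ := F₁.mono (List.Subset.trans
      (List.subset_append_left _ _) Prog.writes_redundant)
    rw [addRows_eq_iter s _ 0]
    refine (Sim.forTo _ (fun i L' μ' => RowState N s μ' L' ∧ L'.length = k + (n - (g + d)) + i) _ L₁
      (fun h => by simpa using Prog.writes_drawAff_push _ h)
      (Expr.avoids_mono (List.cons_subset_cons _ (Prog.writes_drawAff_push _)) rfl) ?_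
      (by omega) ⟨h₁.frame (Frame.write _ _ _ _ _), l₁⟩ ?_).conseq
      fun L' _ μ' h _ => ⟨h.1, by have := h.2; omega⟩
    · simp only [Expr.eval, F₁ 0 (by simp), F₁ 21 (by simp), F₁ 22 (by simp), hn, hm, hg, hk, hd]
    · rintro i hi L' μ' ⟨h', l'⟩ v' F'
      refine Sim.map _ (Sim.orthogonalRow h' (by omega) (by omega)) fun p _ μ'' h'' _ =>
        ⟨h''.frame (Frame.write _ _ _ _ _), ?_⟩
      simp; omega

end IQP
namespace IQP

/-! ## Uniform distributions from successive draws -/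

/-- Total mass one forces `U` to be nonempty and the common value to be 1/|U|. -/
theorem eq_draw_of_const {α : Type} [Inhabited α] {p : PMF α} {U : Set α} (hU : U.Finite)
    {κ : ENNReal} (h : ∀ x ∈ U, p x = κ) (h' : ∀ x, x ∉ U → p x = 0) : p = draw U := by
  classical
  lift U to Finset α using hU
  have h1 := p.tsum_coe
  rw [tsum_eq_sum (s := U) fun x hx => h' x (by simpa using hx),
    Finset.sum_congr rfl (g := fun _ => κ) (fun x hx => h x (by simpa using hx)), Finset.sum_const,
    nsmul_eq_mul] at h1
  have hne : U.Nonempty := by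
    rw [Finset.nonempty_iff_ne_empty]
    rintro rfl
    simp at h1
  rw [draw_eq_uniformOfFinset rfl hne]
  ext x
  rw [PMF.uniformOfFinset_apply]
  split_ifs with hx
  · rw [h x (by simpa using hx)]
    exact ENNReal.eq_inv_of_mul_eq_one_left (by rwa [mul_comm])
  · exact h' x (by simpa using hx)

theorem draw_apply {α : Type} [Inhabited α] {S : Set α} (hS : S.Finite) (hne : S.Nonempty) {a : α}
    (ha : a ∈ S) : draw S a = (S.ncard : ENNReal)⁻¹ := by
  classical
  lift S to Finset α using hS
  have hne' : S.Nonempty := hne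
  rw [draw_eq_uniformOfFinset rfl hne', PMF.uniformOfFinset_apply_of_mem _ (by simpa using ha),
    Set.ncard_coe_finset]

/-- Second-stage sets of equal size c give each pair the probability 1/(|S| c), and the outcome
determines the pair. -/
theorem draw_bind {α β γ : Type} [Inhabited α] [Inhabited β] [Inhabited γ] {S : Set α}
    (hS : S.Finite) (hne : S.Nonempty) {T : α → Set β} {c : ℕ} (hc : c ≠ 0)
    (hT : ∀ a ∈ S, (T a).Finite ∧ (T a).ncard = c) {f : α → β → γ}
    (hf : ∀ a ∈ S, ∀ b ∈ T a, ∀ a' ∈ S, ∀ b' ∈ T a', f a b = f a' b' → a = a' ∧ b = b')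
    {U : Set γ} (hU : ∀ x, x ∈ U ↔ ∃ a ∈ S, ∃ b ∈ T a, f a b = x) :
    ((draw S).bind fun a => (draw (T a)).map (f a)) = draw U := by
  have hTne : ∀ a ∈ S, (T a).Nonempty := fun a ha => by
    rw [← Set.ncard_pos (hT a ha).1, (hT a ha).2]
    omega
  have hUfin : U.Finite := by
    refine (hS.biUnion fun a ha => ((hT a ha).1.image (f a))).subset fun x hx => ?_
    obtain ⟨a, ha, b, hb, rfl⟩ := (hU x).mp hx
    exact Set.mem_biUnion ha ⟨b, hb, rfl⟩
  refine eq_draw_of_const hUfin (κ := (S.ncard : ENNReal)⁻¹ * (c : ENNReal)⁻¹) ?_ ?_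
  · intro x hx
    obtain ⟨a, ha, b, hb, rfl⟩ := (hU x).mp hx
    rw [PMF.bind_apply, tsum_eq_single a, PMF.map_apply, tsum_eq_single b, if_pos rfl,
      draw_apply hS hne ha, draw_apply (hT a ha).1 ⟨b, hb⟩ hb, (hT a ha).2]
    · intro b' hb'
      split_ifs with h
      · rw [PMF.apply_eq_zero_iff, support_draw (hT a ha).1 ⟨b, hb⟩]
        exact fun hb'' => hb' (hf a ha b hb a ha b' hb'' h).2.symm
      · rfl
    · intro a' ha'
      by_cases h : a' ∈ S
      · rw [(PMF.apply_eq_zero_iff ((draw (T a')).map (f a')) _).mpr, mul_zero]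
        rw [PMF.mem_support_map_iff, support_draw (hT a' h).1 (hTne a' h)]
        rintro ⟨b', hb', e⟩
        exact ha' (hf a' h b' hb' a ha b hb e).1
      · rw [(PMF.apply_eq_zero_iff (draw S) _).mpr, zero_mul]
        rwa [support_draw hS hne]
  · intro x hx
    rw [PMF.apply_eq_zero_iff, PMF.mem_support_bind_iff]
    rintro ⟨a, ha, hx'⟩
    rw [support_draw hS hne] at ha
    rw [PMF.mem_support_map_iff, support_draw (hT a ha).1 (hTne a ha)] at hx'
    obtain ⟨b, hb, e⟩ := hx'
    exact hx ((hU x).mpr ⟨a, ha, b, hb, e⟩)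

/-! ## Random permutations -/

/-- A permutation of t + 1 points amounts to the image of 0 and a permutation of t points, chosen
independently. -/
theorem draw_perm_succ (t : ℕ) :
    draw (Set.univ : Set (Equiv.Perm (Fin (t + 1)))) =
      (PMF.uniformOfFintype (Fin (t + 1))).bind fun p =>
        (draw (Set.univ : Set (Equiv.Perm (Fin t)))).map fun e =>
          Equiv.Perm.decomposeFin.symm (p, e) := by
  rw [← draw_univ]
  refine (draw_bind Set.finite_univ Set.univ_nonempty
    (c := Fintype.card (Equiv.Perm (Fin t))) Fintype.card_ne_zero (fun a _ => ?_) ?_ ?_).symm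
  · exact ⟨Set.finite_univ, by rw [Set.ncard_univ, Nat.card_eq_fintype_card]⟩
  · intro a _ b _ a' _ b' _ h
    simpa using h
  · intro x
    simp only [Set.mem_univ, true_and, true_iff]
    exact ⟨(Equiv.Perm.decomposeFin x).1, (Equiv.Perm.decomposeFin x).2, by simp⟩

/-- Swap the element with index `i` with one of the next `M` elements or with itself. -/
noncomputable def randomSwap (M i : ℕ) (ρ : ℕ → ℕ) : PMF (ℕ → ℕ) :=
  (PMF.uniformOfFintype (Fin (M + 1))).map fun p : Fin (M + 1) => ρ ∘ Equiv.swap i (i + p)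

/-- One step of a random shuffle of `m` elements. -/
noncomputable def shuffleStep (m i : ℕ) (ρ : ℕ → ℕ) : PMF (ℕ → ℕ) := randomSwap (m - i - 1) i ρ

/-- Let a permutation act on the numbers starting with `i`. -/
def shiftPerm {t : ℕ} (i : ℕ) (σ : Equiv.Perm (Fin t)) (j : ℕ) : ℕ :=
  if h : i ≤ j ∧ j - i < t then i + σ ⟨j - i, h.2⟩ else j

/-- Matches one swap of the shuffle with the decomposition of a permutation by the image of its
first point. -/
theorem swap_shiftPerm {t : ℕ} (i : ℕ) (p : Fin (t + 1)) (e : Equiv.Perm (Fin t)) :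
    Equiv.swap i (i + p) ∘ shiftPerm (i + 1) e =
      shiftPerm i (Equiv.Perm.decomposeFin.symm (p, e)) := by
  funext j
  have hp := p.2
  by_cases h : i ≤ j ∧ j - i < t + 1
  · obtain ⟨x, rfl⟩ := Nat.exists_eq_add_of_le h.1
    have hx : x < t + 1 := by omega
    have hR : shiftPerm i (Equiv.Perm.decomposeFin.symm (p, e)) (i + x) =
        i + Equiv.Perm.decomposeFin.symm (p, e) ⟨x, hx⟩ := by
      rw [shiftPerm, dif_pos h]
      simp
    rw [hR, Function.comp_apply]
    cases x with
    | zero =>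
      have h0 : (⟨0, hx⟩ : Fin (t + 1)) = 0 := rfl
      rw [h0, Equiv.Perm.decomposeFin_symm_apply_zero, shiftPerm, dif_neg (by omega), add_zero,
        Equiv.swap_apply_left]
    | succ x =>
      have h0 : (⟨x + 1, hx⟩ : Fin (t + 1)) = Fin.succ ⟨x, by omega⟩ := rfl
      have h1 : shiftPerm (i + 1) e (i + (x + 1)) = i + (e ⟨x, by omega⟩).succ := by
        rw [shiftPerm, dif_pos (by omega), Fin.val_succ]
        have : i + (x + 1) - (i + 1) = x := by omega
        simp only [this]
        omega
      rw [h0, Equiv.Perm.decomposeFin_symm_apply_succ, h1, Equiv.swap_apply_def, Equiv.swap_apply_def]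
      simp only [Fin.ext_iff, Nat.add_eq_left, Nat.add_left_cancel_iff, Fin.val_zero]
      split_ifs <;> simp
  · have h1 : shiftPerm (i + 1) e j = j := by rw [shiftPerm, dif_neg (by omega)]
    rw [Function.comp_apply, h1, shiftPerm, dif_neg h]
    exact Equiv.swap_apply_of_ne_of_ne (by omega) (by omega)

theorem iter_shuffleStep (t i : ℕ) (ρ : ℕ → ℕ) :
    iter (shuffleStep (i + t)) t i ρ =
      (draw (Set.univ : Set (Equiv.Perm (Fin t)))).map fun σ => ρ ∘ shiftPerm i σ := by
  induction t generalizing i ρ with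
  | zero =>
    have : (fun σ : Equiv.Perm (Fin 0) => ρ ∘ shiftPerm i σ) = Function.const _ ρ := by
      funext σ j
      simp [shiftPerm]
    rw [this, PMF.map_const]
    rfl
  | succ t ih =>
    have h : i + (t + 1) - i - 1 = t := by omega
    have h' : i + (t + 1) = i + 1 + t := by omega
    rw [draw_perm_succ, PMF.map_bind, iter, shuffleStep, h, randomSwap, PMF.bind_map]
    congr 1
    funext p
    rw [PMF.map_comp, h']
    refine (ih (i + 1) _).trans ?_
    congr 1
    funext e
    rw [Function.comp_assoc, swap_shiftPerm]
    rfl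

/-! ## Random invertible matrices -/

theorem iter_succ_right {α : Type} (f : ℕ → α → PMF α) (t i : ℕ) (a : α) :
    iter f (t + 1) i a = (iter f t i a).bind (f (i + t)) := by
  induction t generalizing i a with
  | zero => simp [iter]
  | succ t ih =>
    rw [iter, iter, PMF.bind_bind]
    congr 1
    funext b
    rw [ih, add_right_comm, add_assoc]

variable {n : ℕ}

/-- The lists of linearly independent vectors of some length. -/
def indepLists (n t : ℕ) : Set (List (Vec n)) :=
  {L | L.length = t ∧ Module.finrank (ZMod 2) (spanOf L) = t}

theorem ncard_notMem_spanOf {t : ℕ} {L : List (Vec n)} (h : L ∈ indepLists n t) :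
    {v | v ∉ spanOf L}.ncard = 2 ^ n - 2 ^ t := by
  have h1 : {v | v ∉ spanOf L} = (spanOf L : Set (Vec n))ᶜ := rfl
  have h2 := Module.natCard_eq_pow_finrank (K := ZMod 2) (V := spanOf L)
  rw [h.2, Nat.card_zmod] at h2
  rw [h1, Set.ncard_compl, ← h2]
  congr 1
  simp

theorem indepLists_finite (n t : ℕ) : (indepLists n t).Finite :=
  (List.finite_length_eq (Vec n) t).subset fun _ h => h.1

/-- Each independent list of length t has 2^n - 2^t extensions, so uniformity passes on to length t
+ 1. -/
theorem iter_indepLists (t : ℕ) (ht : t ≤ n) : (indepLists n t).Nonempty ∧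
    iter (fun _ L => (draw {v : Vec n | v ∉ spanOf L}).map fun v => L ++ [v]) t 0 [] =
      draw (indepLists n t) := by
  induction t with
  | zero =>
    have h : indepLists n 0 = {[]} := by
      ext L
      simp only [indepLists, Set.mem_ofPred_eq, Set.mem_singleton_iff, List.length_eq_zero_iff]
      exact ⟨fun h => h.1, fun h => by simp [h]⟩
    rw [h]
    refine ⟨Set.singleton_nonempty _, (eq_draw_of_const (Set.finite_singleton _) (κ := 1) ?_ ?_)⟩
    · rintro x rfl
      simp [iter]
    · intro x hx
      simpa [iter] using hx
  | succ t ih =>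
    obtain ⟨hne, ih⟩ := ih (by omega)
    have hpow : 2 ^ t < 2 ^ n := Nat.pow_lt_pow_right (by omega) (by omega)
    have hU : ∀ x, x ∈ indepLists n (t + 1) ↔ ∃ L ∈ indepLists n t, ∃ v ∈ {v | v ∉ spanOf L},
        L ++ [v] = x := by
      intro x
      constructor
      · rintro ⟨h1, h2⟩
        obtain rfl | ⟨L, v, rfl⟩ := List.eq_nil_or_concat x
        · simp at h1
        rw [List.concat_eq_append] at *
        have hl : L.length = t := by simpa using h1
        have hle := finrank_spanOf_le L
        by_cases hv : v ∈ spanOf L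
        · rw [spanOf_append, spanOf_singleton, sup_eq_left.mpr (by simpa using hv)] at h2
          omega
        · rw [finrank_spanOf_concat hv] at h2
          exact ⟨L, ⟨hl, by omega⟩, v, hv, rfl⟩
      · rintro ⟨L, hL, v, hv, rfl⟩
        exact ⟨by simp [hL.1], by rw [finrank_spanOf_concat hv, hL.2]⟩
    constructor
    · obtain ⟨L, hL⟩ := hne
      have h1 := ncard_notMem_spanOf hL
      have h2 : {v | v ∉ spanOf L}.Nonempty := by
        rw [← Set.ncard_pos (Set.toFinite _)]
        omega
      obtain ⟨v, hv⟩ := h2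
      exact ⟨L ++ [v], (hU _).mpr ⟨L, hL, v, hv, rfl⟩⟩
    · rw [iter_succ_right, ih]
      refine draw_bind (indepLists_finite n t) hne (c := 2 ^ n - 2 ^ t) (by omega)
        (fun L hL => ⟨Set.toFinite _, ncard_notMem_spanOf hL⟩) ?_ hU
      intro L _ v _ L' _ v' _ h
      simpa using h

/-- The matrix with the given columns. -/
def colMatrix (L : List (Vec n)) : Matrix (Fin n) (Fin n) (ZMod 2) :=
  Matrix.of fun i j => L.getD j 0 i

open Classical in
/-- The invertible matrix with the given columns. -/
noncomputable def colUnit (L : List (Vec n)) : GL (Fin n) (ZMod 2) :=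
  if h : IsUnit (colMatrix L).det then Matrix.GeneralLinearGroup.mk'' _ h else 1

theorem isUnit_colMatrix_iff {L : List (Vec n)} (h : L.length = n) :
    IsUnit (colMatrix L).det ↔ L ∈ indepLists n n := by
  rw [← Matrix.isUnit_iff_isUnit_det, ← Matrix.linearIndependent_cols_iff_isUnit,
    linearIndependent_iff_card_eq_finrank_span]
  have : (colMatrix L).col = fun j : Fin n => L.getD j 0 := rfl
  rw [this, Set.finrank, span_range_getD h.le, Fintype.card_fin]
  exact ⟨fun h' => ⟨h, h'.symm⟩, fun h' => h'.2.symm⟩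

theorem colUnit_val {L : List (Vec n)} (h : L ∈ indepLists n n) :
    (colUnit L).val = colMatrix L := by
  rw [colUnit, dif_pos ((isUnit_colMatrix_iff h.1).mpr h)]
  rfl

theorem draw_GL : draw (Set.univ : Set (GL (Fin n) (ZMod 2))) =
    (draw (indepLists n n)).map colUnit := by
  rw [draw_map (indepLists_finite n n) (iter_indepLists n le_rfl).1]
  · congr 1
    symm
    rw [Set.eq_univ_iff_forall]
    intro Q
    have hlen : (List.ofFn fun j => Q.val.col j).length = n := List.length_ofFn
    have e : colMatrix (List.ofFn fun j => Q.val.col j) = Q.val := by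
      ext i j
      simp [colMatrix]
    have hQ : (List.ofFn fun j => Q.val.col j) ∈ indepLists n n := by
      rw [← isUnit_colMatrix_iff hlen, e]
      exact Matrix.isUnits_det_units Q
    exact ⟨_, hQ, Units.ext ((colUnit_val hQ).trans e)⟩
  · intro L hL L' hL' h
    have h' : colMatrix L = colMatrix L' := by rw [← colUnit_val hL, ← colUnit_val hL', h]
    refine List.ext_getElem (hL.1.trans hL'.1.symm) fun j h1 h2 => ?_
    funext i
    have := congrFun₂ h' i ⟨j, by rw [← hL.1]; exact h1⟩
    simpa [colMatrix, h1, h2] using this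

end IQP
namespace IQP

variable {n N : ℕ} {μ : Mem}

/-! ## The obfuscation -/

/-- Store a random permutation of the numbers below `m` in array 43. -/
def Prog.shuffle : Prog :=
  .seq (.mapRow 43 (.lit 0) .m (.var 13)) (.forTo 25 .m
    (.seq (.rand 26 (.lit 0) (.lit 0) (.sub (.sub .m (.var 25)) (.lit 1))) (.seq
    (.assign 27 (.cell 43 (.lit 0) (.add (.var 25) (.var 26)))) (.seq
    (.set 43 (.lit 0) (.add (.var 25) (.var 26)) (.cell 43 (.lit 0) (.var 25)))
    (.set 43 (.lit 0) (.var 25) (.var 27))))))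

theorem Prog.writes_shuffle : shuffle.writes ⊆ [13, 25, 26, 27, 43] := by
  simp [shuffle]

theorem shiftPerm_injective {m : ℕ} :
    Function.Injective fun σ : Equiv.Perm (Fin m) => shiftPerm 0 σ := by
  intro σ σ' h
  ext j
  have := congrFun h j
  simpa [shiftPerm] using this

theorem Sim.shuffle {m : ℕ} (hm : μ 0 0 1 = m) (hN : m ≤ N) :
    Sim N .shuffle μ (draw (Set.univ : Set (Equiv.Perm (Fin m)))) fun σ μ' =>
      ∀ j : Fin m, μ' 43 0 j = σ j := by
  refine Hoare.seq_sim (Hoare.mapRow (fun j => j) hm hN (by simp) rfl rfl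
    fun j _ μ' _ v' _ => v') fun μ₁ h₁ F₁ => ?_
  have key := iter_shuffleStep m 0 id
  rw [zero_add] at key
  -- The loop works with functions on ℕ; the permutation is recovered by a left inverse of the
  -- injective embedding.
  have hmap : ((draw (Set.univ : Set (Equiv.Perm (Fin m)))).map fun σ => id ∘ shiftPerm 0 σ).map
      (Function.invFun fun σ : Equiv.Perm (Fin m) => shiftPerm 0 σ) = draw Set.univ := by
    rw [PMF.map_comp]
    have : (Function.invFun fun σ : Equiv.Perm (Fin m) => shiftPerm 0 σ) ∘
        (fun σ : Equiv.Perm (Fin m) => id ∘ shiftPerm 0 σ) = id :=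
      Function.invFun_comp shiftPerm_injective
    rw [this, PMF.map_id]
  rw [← hmap]
  refine Sim.map (Q := fun ρ μ' => ∀ j < m, μ' 43 0 j = ρ j) _ ?_ ?_
  · rw [← key]
    refine Sim.forTo (shuffleStep m) (fun _ ρ μ' => ∀ j < m, μ' 43 0 j = ρ j) m id (by simp) rfl
      (by simp [Expr.eval, F₁ 0, hm]) hN (fun j hj => by simp [h₁, Expr.eval, hj]) ?_
    intro i hi ρ μ₂ h₂ v₂ F₂
    replace F₂ := F₁.append F₂
    have e : (Expr.sub (.sub .m (.var 25)) (.lit 1)).eval μ₂ = m - i - 1 := by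
      simp only [Expr.eval, F₂ 0 (by simp), hm, v₂]
    rw [shuffleStep, randomSwap, ← e]
    refine Sim.map (Q := fun (p : Fin _) μ' => ∀ j < m, μ' 43 0 j = (ρ ∘ Equiv.swap i (i + p)) j)
      _ ?_ fun p _ μ' h _ j hj => by simpa using h j hj
    refine Sim.seq_hoare (Q := fun (p : Fin _) μ' => μ' 26 0 0 = p) (Sim.rand fun p => ?_)
      fun p _ μ₃ h₃ F₃ => ?_
    · simp [Expr.eval]
    have hp := p.2
    have v₃ : μ₃ 25 0 0 = i := by rw [F₃ 25 (by simp), v₂]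
    have e43 : μ₃ 43 = μ₂ 43 := F₃ 43 (by simp)
    refine Hoare.set_seq (Hoare.set_seq (Hoare.set fun j hj => ?_))
    have hi' := h₂ i hi
    have hp' := h₂ (i + p) (by omega)
    have hj' := h₂ j hj
    simp only [Expr.eval, Mem.write_apply, h₃, v₃, e43, Function.comp_apply, Equiv.swap_apply_def]
    by_cases h5 : j = i
    · simp [h5, hp']
    · by_cases h6 : j = i + p
      · have : (p : ℕ) ≠ 0 := by omega
        simp [h6, this, hi']
      · simp [h5, h6, hj']
  · intro ρ hρ μ' h _
    obtain ⟨σ, _, rfl⟩ := (PMF.mem_support_map_iff _ _ _).mp hρ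
    intro j
    have e : Function.invFun (fun σ : Equiv.Perm (Fin m) => shiftPerm 0 σ) (id ∘ shiftPerm 0 σ) =
        σ := Function.leftInverse_invFun shiftPerm_injective σ
    rw [e, h j j.2]
    simp [shiftPerm]

/-- The columns of the invertible matrix sampled so far. -/
abbrev qRng : Rng := .stack 37 23

/-- Sample an invertible matrix. -/
def Prog.invertible : Prog :=
  .seq (.assign 23 (.lit 0)) (.forTo 25 .n (.seq (.drawNot noRng noRng qRng) (.push 37 23)))

theorem Prog.writes_drawNot_push_q (r₁ r₂ r₃ : Rng) :
    (seq (drawNot r₁ r₂ r₃) (push 37 23)).writes ⊆ 23 :: 37 :: drawVars := by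
  simp only [writes, List.append_subset]
  exact ⟨List.Subset.trans (writes_drawNot _ _ _) (by simp), by simp⟩

theorem Prog.writes_invertible : invertible.writes ⊆ 25 :: 23 :: 37 :: drawVars := by
  have h := List.Subset.trans (writes_drawNot_push_q noRng noRng qRng)
    (List.subset_cons_self 25 _)
  simp only [invertible, writes, writes_forTo, List.append_subset, List.cons_subset] at *
  exact ⟨by simp, by simp, h, by simp⟩

theorem Sim.invertible (hn : μ 0 0 0 = n) (hK : μ 10 0 0 = n) (hN : n ≤ N) :
    Sim N .invertible μ (draw (Set.univ : Set (GL (Fin n) (ZMod 2)))) fun Q μ' =>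
      ∀ j : Fin n, Row μ' 37 j (Q.val.col j) := by
  rw [draw_GL, ← (iter_indepLists n le_rfl).2]
  have F₁ : Frame [23] μ (μ.write 23 0 0 0) := Frame.write _ _ _ _ _
  refine Hoare.set_seq (Sim.map (Q := fun L μ' => qRng.Holds N μ' L) _ (Sim.conseq
    (Sim.forTo _ (fun i L μ' => qRng.Holds N μ' L ∧ L.length = i) n []
    (fun h => by simpa using Prog.writes_drawNot_push_q _ _ _ h) ?_ ?_ hN ⟨⟨?_, ?_, ?_⟩, rfl⟩ ?_)
    fun L _ μ' h _ => h.1) ?_)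
  · exact Expr.avoids_mono (List.cons_subset_cons _ (Prog.writes_drawNot_push_q _ _ _)) rfl
  · simp [Expr.eval, hn]
  · simp [Expr.eval]
  · exact fun i hi => absurd hi (by simp)
  · simp
  · rintro i hi L μ₂ ⟨h₂, l₂⟩ _ F₂
    replace F₂ := F₁.append (F₂.mono (List.cons_subset_cons _ (Prog.writes_drawNot_push_q _ _ _)))
    have k₂ : μ₂ 10 0 0 = n := by rw [F₂ 10 (by simp), hK]
    refine Sim.map (Q := fun v μ' => qRng.Holds N μ' (L ++ [v])) _ ?_ fun v _ μ' h _ =>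
      ⟨h.frame (ws := [25]) rfl (Frame.write _ _ _ _ _), by simp [l₂]⟩
    refine Sim.seq_hoare (Sim.drawNot (L₁ := []) (L₂ := []) rfl rfl rfl k₂ hN (Rng.holds_nil _ rfl)
      (Rng.holds_nil _ rfl) h₂ fun v => ?_) fun v _ μ₃ r₃ F₃ => ?_
    · have : v ∈ orthTo [] := fun c hc => absurd hc (by simp)
      simp [this]
    · replace F₃ := F₃.mono (Prog.writes_drawNot _ _ _)
      exact Hoare.push (by rw [F₃ 10 (by simp), k₂]) hN (by simp) (by simp) (h₂.frame rfl F₃)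
        (by omega) r₃
  · intro L hL μ' h _ j
    rw [(iter_indepLists n le_rfl).2, support_draw (indepLists_finite n n)
      (iter_indepLists n le_rfl).1] at hL
    have hj : (j : ℕ) < L.length := by rw [hL.1]; exact j.2
    have := h.2.1 j hj
    rw [colUnit_val hL]
    have e : (colMatrix L).col j = L[(j : ℕ)] := by
      funext i
      simp [colMatrix, hj]
    rw [e]
    simpa [Expr.eval] using this

/-- Solve the linear system with the columns in array 37 and the right hand side in array 38. -/
def Prog.solve : Prog :=
  .seq (.forTo 25 .n (.seq (.mapRow 41 (.var 25) .n (.cell 37 (.var 13) (.var 25)))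
    (.set 41 (.var 25) .n (.cell 38 (.lit 0) (.var 25))))) (.drawAff ⟨41, .lit 0, .n⟩)

theorem Prog.writes_solve : solve.writes ⊆ 25 :: 41 :: 10 :: 40 :: drawVars := by
  simp only [solve, writes, List.append_subset]
  exact ⟨by simp, List.Subset.trans (writes_drawAff _) (by simp)⟩

/-- The affine sampler doubles as a linear solver: Qx = s has exactly one solution, so the draw is
deterministic. -/
theorem Hoare.solve {Q : GL (Fin n) (ZMod 2)} {s : Vec n} (hn : μ 0 0 0 = n) (hK : μ 10 0 0 = n)
    (hN : n + 1 ≤ N) (hQ : ∀ j : Fin n, Row μ 37 j (Q.val.col j)) (hs : Row μ 38 0 s) :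
    Hoare N .solve μ fun μ' => Row μ' 33 0 ((Q⁻¹).val *ᵥ s) ∧ μ' 10 0 0 = n := by
  let v : Fin n → Vec (n + 1) := fun i => Fin.snoc (α := fun _ => ZMod 2) (Q.val i) (s i)
  refine Hoare.seq (Hoare.forTo (fun t μ' => ∀ i : Fin n, (i : ℕ) < t → Row μ' 41 i (v i)) n
    (by simp) rfl hn (by omega) (fun i hi => absurd hi (by omega)) ?_) fun μ₁ h₁ F₁ => ?_
  · intro t ht μ' h v' F'
    refine Hoare.seq (Hoare.mapRow (fun j => μ 37 j t) (cnt := n) (by simp [Expr.eval, F' 0, hn])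
      (by omega) (by simp) rfl rfl ?_) fun μ₂ h₂ F₂ => Hoare.set ?_
    · intro k _ μ'' F'' v'' _
      simp only [Expr.eval, F'' 37 (by simp), F'' 25 (by simp), F' 37 (by simp), v', v'']
    · have e25 : μ₂ 25 0 0 = t := by rw [F₂ 25 (by simp), v']
      have e0 : μ₂ 0 0 0 = n := by rw [F₂ 0 (by simp), F' 0 (by simp), hn]
      have e38 : μ₂ 38 = μ 38 := by rw [F₂ 38 (by simp), F' 38 (by simp)]
      simp only [Expr.eval, v'] at h₂
      simp only [Expr.eval, e25, e0, e38]
      intro i hi j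
      by_cases hit : (i : ℕ) = t
      · subst hit
        refine Fin.lastCases ?_ (fun j => ?_) j
        · simpa [v] using hs i
        · have hj : (j : ℕ) ≠ n := by omega
          have := hQ j i
          simpa [v, h₂, hj] using this
      · have := h i (by omega) j
        simpa [h₂, hit] using this
  · have hlist : (⟨41, .lit 0, .n⟩ : Rng).Holds N μ₁ (List.ofFn v) := by
      refine ⟨by simp [Expr.eval, F₁ 0, hn], fun i hi => ?_, by simp; omega⟩
      rw [List.length_ofFn] at hi
      simpa [Expr.eval] using h₁ ⟨i, hi⟩ hi
    have hS : ∀ x, x ∈ ({(Q⁻¹).val *ᵥ s} : Set (Vec n)) ↔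
        ∀ c ∈ List.ofFn v, dropLast c ⬝ᵥ x = c (Fin.last n) := by
      intro x
      rw [List.forall_mem_ofFn_iff]
      have e1 : (∀ i, dropLast (v i) ⬝ᵥ x = v i (Fin.last n)) ↔ Q.val *ᵥ x = s := by
        rw [funext_iff]
        refine forall_congr' fun i => ?_
        have e1 : dropLast (v i) = Q.val i := by
          funext j
          simp [dropLast, v]
        have e2 : v i (Fin.last n) = s i := by simp [v]
        rw [e1, e2]
        rfl
      rw [e1, Set.mem_singleton_iff]
      constructor
      · rintro rfl
        rw [Matrix.mulVec_mulVec, ← Units.val_mul, mul_inv_cancel, Units.val_one, Matrix.one_mulVec]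
      · rintro rfl
        rw [Matrix.mulVec_mulVec, ← Units.val_mul, inv_mul_cancel, Units.val_one, Matrix.one_mulVec]
    have hdraw : draw ({(Q⁻¹).val *ᵥ s} : Set (Vec n)) = PMF.pure ((Q⁻¹).val *ᵥ s) := by
      refine (eq_draw_of_const (Set.finite_singleton _) (κ := 1) ?_ ?_).symm
      · rintro x rfl
        simp
      · intro x hx
        simpa using hx
    have h := Sim.drawAff (n := n) rfl (by rw [F₁ 10 (by simp), hK]) hN hlist hS
    rw [hdraw] at h
    intro β out k T f hf
    rw [PMF.pure_bind]
    have := h β out k T (fun _ => f ()) fun x hx μ' hq F => by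
      obtain rfl := (PMF.mem_support_pure_iff _ _).mp hx
      exact hf () (by simp) μ' hq F
    rwa [PMF.pure_bind] at this

end IQP
namespace IQP

/-! ### Output and assembly of the program. -/

variable {n N : ℕ} {μ : Mem}

/-- Store the output. -/
def Prog.output : Prog :=
  .seq (.forTo 25 .m (.forTo 26 .n (.seq (.dot 42 (.cell 43 (.lit 0) (.var 25)) 37 (.var 26))
    (.set 1 (.var 25) (.var 26) (.var 14))))) (.copyRow 2 (.lit 0) 33 (.lit 0))

theorem bit_val (a : ZMod 2) : (if a.val = 0 then (0 : ZMod 2) else 1) = a := by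
  revert a; decide

theorem Hoare.output {m : ℕ} {H : Matrix (Fin m) (Fin n) (ZMod 2)} {σ : Equiv.Perm (Fin m)}
    {Q : Matrix (Fin n) (Fin n) (ZMod 2)} {x : Vec n} (hn : μ 0 0 0 = n) (hm : μ 0 0 1 = m)
    (hK : μ 10 0 0 = n) (hN : n + m ≤ N) (hH : ∀ i : Fin m, Row μ 42 i (H i))
    (hσ : ∀ i : Fin m, μ 43 0 i = σ i) (hQ : ∀ j : Fin n, Row μ 37 j (Q.col j))
    (hx : Row μ 33 0 x) :
    Hoare N .output μ fun μ' => μ'.output n m = (H.submatrix σ id * Q, x) := by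
  have key : ∀ (i : Fin m) (j : Fin n), (H.submatrix σ id * Q) i j = H (σ i) ⬝ᵥ Q.col j :=
    fun _ _ => rfl
  refine Hoare.seq (Hoare.forTo (fun t μ' => ∀ (i : Fin m) (j : Fin n), (i : ℕ) < t →
    μ' 1 i j = ((H.submatrix σ id * Q) i j).val) m (by simp) rfl hm (by omega)
    (fun i j hi => absurd hi (by omega)) fun t ht μ₁ h₁ v₁ F₁ => ?_) fun μ₁ h₁ F₁ => ?_
  · refine (Hoare.forTo (fun u μ' => ∀ (i : Fin m) (j : Fin n),
      ((i : ℕ) < t ∨ (i : ℕ) = t ∧ (j : ℕ) < u) →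
      μ' 1 i j = ((H.submatrix σ id * Q) i j).val) n (by simp) rfl
      (by simp [Expr.eval, F₁ 0, hn]) (by omega) (fun i j hi => ?_) fun u hu μ₂ h₂ v₂ F₂ => ?_).conseq
      fun μ₂ h₂ _ i j hi => ?_
    · simpa using h₁ i j (by omega)
    · have e25 : μ₂ 25 0 0 = t := by rw [F₂ 25 (by simp), v₁]
      replace F₂ := F₁.append F₂
      have e43 : (Expr.cell 43 (.lit 0) (.var 25)).eval μ₂ = σ ⟨t, ht⟩ := by
        simp only [Expr.eval, e25]
        rw [F₂ 43 (by simp)]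
        exact hσ ⟨t, ht⟩
      refine Hoare.seq (Hoare.dot (a := H (σ ⟨t, ht⟩)) (b := Q.col ⟨u, hu⟩)
        (by rw [F₂ 10 (by simp), hK]) (by omega) (by simp) (by simp) rfl rfl ?_ ?_)
        fun μ₃ h₃ F₃ => Hoare.set fun i j hij => ?_
      · rw [e43]
        exact (hH _).frame F₂ (by simp)
      · have : (Expr.var 26).eval μ₂ = u := v₂
        rw [this]
        exact (hQ ⟨u, hu⟩).frame F₂ (by simp)
      · have e1 : μ₃ 25 0 0 = t := by rw [F₃ 25 (by simp), e25]
        have e2 : μ₃ 26 0 0 = u := by rw [F₃ 26 (by simp), v₂]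
        simp only [Expr.eval, e1, e2, h₃, Mem.write_apply]
        by_cases hc : (i : ℕ) = t ∧ (j : ℕ) = u
        · obtain ⟨rfl, rfl⟩ := hc
          simp [key]
        · have := h₂ i j (by omega)
          rw [← this]
          simp [hc, F₃ 1]
    · simpa using h₂ i j (by omega)
  · refine (Hoare.copyRow (v := x) (by rw [F₁ 10 (by simp), hK]) (by omega) (by simp) (by simp) rfl
      rfl (hx.frame F₁ (by simp)) (by simp)).conseq fun μ₂ ⟨h₂, _⟩ F₂ => ?_
    refine Prod.ext ?_ ?_
    · ext i j
      simp only [Mem.output, Matrix.of_apply, F₂ 1 (by simp), h₁ i j i.2, bit_val]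
    · funext j
      have := h₂ j
      simp only [Expr.eval] at this
      simp only [Mem.output, this, bit_val]

/-- Obfuscate an instance and store the output. -/
def Prog.obfuscate : Prog := .seq .shuffle (.seq .invertible (.seq .solve .output))

theorem Sim.obfuscate {m : ℕ} {H : Matrix (Fin m) (Fin n) (ZMod 2)} {s : Vec n}
    (hn : μ 0 0 0 = n) (hm : μ 0 0 1 = m) (hK : μ 10 0 0 = n) (hN : n + m + 1 ≤ N)
    (hH : ∀ i : Fin m, Row μ 42 i (H i)) (hs : Row μ 38 0 s) :
    Sim N .obfuscate μ (obfuscate H s) fun y μ' => μ'.output n m = y := by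
  refine Sim.seq (Sim.shuffle hm (by omega)) fun σ _ μ₁ h₁ F₁ => ?_
  replace F₁ := F₁.mono Prog.writes_shuffle
  refine Sim.seq (Sim.invertible (n := n) (by rw [F₁ 0 (by simp), hn]) (by rw [F₁ 10 (by simp), hK])
    (by omega)) fun Q _ μ₂ h₂ F₂ => Hoare.sim_pure _ ?_
  replace F₂ := F₂.mono Prog.writes_invertible
  have F₂' := F₁.append F₂
  refine Hoare.seq (Hoare.solve (Q := Q) (s := s) (by rw [F₂' 0 (by simp), hn])
    (by rw [F₂' 10 (by simp), hK]) (by omega) h₂ (hs.frame F₂' (by simp))) fun μ₃ h₃ F₃ => ?_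
  replace F₃ := F₃.mono Prog.writes_solve
  have F₃' := F₂'.append F₃
  refine Hoare.output (by rw [F₃' 0 (by simp), hn]) (by rw [F₃' 0 (by simp), hm]) h₃.2 (by omega)
    (fun i => (hH i).frame F₃' (by simp)) (fun i => ?_) (fun j => (h₂ j).frame F₃ (by simp)) h₃.1
  rw [F₃ 43 (by simp), F₂ 43 (by simp), h₁]

/-! ## The sampling algorithm -/

/-- The program for the stabilizer construction. -/
def Prog.stabilizerConstruction : Prog :=
  .seq .parameters (.seq (.assign 10 (.var 21)) (.seq (.mapRow 36 (.lit 0) (.var 10) (.lit 1))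
  (.seq .sampleD (.seq .sampleF (.seq .secret (.seq .redundant .obfuscate))))))

theorem admissible_finite (n m g : ℕ) : (admissible n m g).Finite := by
  refine ((Set.finite_Iic m).prod (Set.finite_Iic n)).subset ?_
  rintro ⟨a, b⟩ ⟨h1, -, h3, -⟩
  exact ⟨h3, by simp only [Set.mem_Iic] at *; omega⟩

theorem Sim.congr {c : Prog} {α : Type} {d d' : PMF α} {Q : α → Mem → Prop} (h : d = d')
    (h' : Sim N c μ d' Q) : Sim N c μ d Q := h ▸ h'

theorem Sim.stabilizerConstruction {m g : ℕ} (hn : μ 0 0 0 = n) (hm : μ 0 0 1 = m)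
    (hg : μ 0 0 2 = g) (hN : n + m + g + 2 ≤ N) (hne : (admissible n m g).Nonempty) :
    Sim N .stabilizerConstruction μ (stabilizerConstruction n m g) fun y μ' =>
      μ'.output n m = y := by
  refine Sim.seq (Sim.parameters hn hm hg (by omega) hne) fun ⟨k, d⟩ hq μ₁ ⟨k₁, d₁⟩ F₁ => ?_
  rw [support_draw (admissible_finite n m g) hne] at hq
  replace F₁ := F₁.mono Prog.writes_parameters
  obtain ⟨q1, q2, q3, q4, q5, -, -, -⟩ := id hq
  simp only at q1 q2 q3 q4 q5 k₁ d₁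
  refine Hoare.set_seq ?_
  simp only [Expr.eval, k₁]
  have F₂ := F₁.append (Frame.write μ₁ 10 0 0 k)
  have k₂ : (μ₁.write 10 0 0 k) 21 0 0 = k := by simpa using k₁
  have d₂ : (μ₁.write 10 0 0 k) 22 0 0 = d := by simpa using d₁
  have K₂ : (μ₁.write 10 0 0 k) 10 0 0 = k := by simp
  generalize μ₁.write 10 0 0 k = μ₂ at *
  refine Hoare.seq_sim (Hoare.mapRow (fun _ => 1) (cnt := k) K₂ (by omega) (by simp) rfl rfl
    fun _ _ _ _ _ _ => rfl) fun μ₃ h₃ G₃ => ?_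
  have F₃ := F₂.append G₃
  have o₃ : Row μ₃ 36 0 (1 : Vec k) := fun j => by
    simp [h₃, Expr.eval, ZMod.val_one]
  have k₃ : μ₃ 21 0 0 = k := by rw [G₃ 21 (by simp), k₂]
  have d₃ : μ₃ 22 0 0 = d := by rw [G₃ 22 (by simp), d₂]
  have K₃ : μ₃ 10 0 0 = k := by rw [G₃ 10 (by simp), K₂]
  refine Sim.seq (Sim.sampleD hq (by rw [F₃ 0 (by simp), hg]) d₃ K₃ (by omega) o₃)
    fun D hD μ₄ D₄ G₄ => ?_
  obtain ⟨iD, lD, oD⟩ := DInv.sampleD_support hq hD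
  replace G₄ := G₄.mono Prog.writes_sampleD
  have F₄ := F₃.append G₄
  refine Sim.seq (Sim.sampleF hq (by rw [F₄ 0 (by simp), hg]) (by rw [G₄ 10 (by simp), K₃])
    (by omega) (by omega) (o₃.frame G₄ (by simp)) D₄) fun F hF μ₅ h₅ G₅ => ?_
  obtain ⟨iF, lF⟩ := FInv.sampleF_support hq iD lD oD hF
  replace G₅ := G₅.mono Prog.writes_sampleF
  have F₅ := F₄.append G₅
  have D₅ := D₄.frame rfl G₅
  have G₅' := G₄.append G₅
  have k₅ : μ₅ 21 0 0 = k := by rw [G₅' 21 (by simp), k₃]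
  have d₅ : μ₅ 22 0 0 = d := by rw [G₅' 22 (by simp), d₃]
  refine Sim.seq (Sim.secret (n := n) (by rw [F₅ 0 (by simp), hn]) (by rw [F₅ 0 (by simp), hg, lF])
    k₅ (by rw [d₅, lD]) (by omega) (by omega) (by omega) h₅ D₅ rfl) fun s _ μ₆ h₆ G₆ => ?_
  replace G₆ := G₆.mono Prog.writes_secret
  have F₆ := F₅.append G₆
  -- Both kinds of redundant rows are added by one subprogram, so the binds are reassociated.
  refine Sim.congr (PMF.bind_bind _ _ _).symm ?_
  refine Sim.seq (Sim.redundant (n := n) (m := m) (g := g) (k := k) (d := d) (s := s)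
    (by rw [F₆ 0 (by simp), hn]) (by rw [F₆ 0 (by simp), hm])
    (by rw [F₆ 0 (by simp), hg]) (by rw [G₆ 21 (by simp), k₅]) (by rw [G₆ 22 (by simp), d₅])
    (by omega) List.length_ofFn q3 q4 h₆) fun L _ μ₇ ⟨h₇, l₇⟩ G₇ => ?_
  replace G₇ := G₇.mono Prog.writes_redundant
  have F₇ := F₆.append G₇
  refine Sim.obfuscate (by rw [F₇ 0 (by simp), hn]) (by rw [F₇ 0 (by simp), hm]) h₇.2.2 (by omega)
    (fun i => ?_) h₇.row
  have hi : (i : ℕ) < L.length := by omega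
  have := h₇.1.2.1 i hi
  have e : (Matrix.of fun i : Fin m => L.getD i 0) i = L[(i : ℕ)] := List.getD_eq_getElem _ _ hi
  rw [e]
  simpa [Expr.eval] using this

end IQP

/-! ### The theorem. -/

theorem theorem3 :
    ∃ (A : IQP.Prog) (p : Polynomial ℕ), ∀ n m g : ℕ, (IQP.family n m g).Nonempty →
      A.HaltsWithin n m g (p.eval (n + m + g)) ∧
      A.outputDist n m g (p.eval (n + m + g)) = IQP.stabilizerConstruction n m g ∧
      (IQP.stabilizerConstruction n m g).support ⊆ IQP.family n m g := by
  -- No loop makes more than N = n + m + g + 2 rounds, so the structural cost at N, composed with X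
  -- + 2, bounds the time.
  refine ⟨.stabilizerConstruction,
    IQP.Prog.stabilizerConstruction.costPoly.comp (Polynomial.X + Polynomial.C 2),
    fun n m g h => ?_⟩
  have hne := IQP.admissible_nonempty h
  have hp : (IQP.Prog.stabilizerConstruction.costPoly.comp
      (Polynomial.X + Polynomial.C 2)).eval (n + m + g) =
      IQP.Prog.stabilizerConstruction.cost (n + m + g + 2) := by
    rw [Polynomial.eval_comp, Polynomial.eval_add, Polynomial.eval_X, Polynomial.eval_C,
      IQP.Prog.eval_costPoly]
  -- Instantiated with nothing left to run, no further steps, and the output as the observed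
  -- function of the memory.
  have hsim := IQP.Sim.stabilizerConstruction (n := n) (m := m) (g := g)
    (μ := (IQP.Prog.stabilizerConstruction.start n m g).mem) rfl rfl rfl le_rfl hne
    _ (IQP.Mem.output n m) [] 0 PMF.pure fun y _ μ' hy _ => ⟨fun c' hc' => ?_, ?_⟩
  · rw [PMF.bind_pure, add_zero, ← hp] at hsim
    exact ⟨hsim.1, hsim.2, IQP.stabilizerConstruction_support hne⟩
  · rw [(PMF.mem_support_pure_iff _ _).mp hc']
  · rw [IQP.Config.run, PMF.pure_map, hy]
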